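/- Let $Z_i=(X_i,Y_i)$, $i=1,\dots,n$, be i.i.d. with $X_i\in\mathbb R^d$ of density $f_0$ and $Y_i\mid X_i=x\sim N(-\Lambda_0^{-1}\Theta_0^{T}x,\Lambda_0^{-1})$, where $\Lambda_0\in\mathbb R^{p\times p}$ is symmetric with all eigenvalues in $[C_L,C_U]$, $0<C_L\le C_U<\infty$, $\Theta_0\in\mathbb R^{d\times p}$, and $n,p,d\ge 1$. Let $X$ and $Y$ be the data matrices with rows $X_i$ and $Y_i$, and $S_{xx}=X^TX/n$, $S_{xy}=X^TY/n$, $S_{yy}=Y^TY/n$. Let $(\hat\Lambda,\hat\Theta)$ minimize, over positive definite $\Lambda$ and all $\Theta$, $$l_2(\Lambda,\Theta)+\lambda_2\sum_{i\ne j}|\Lambda_{ij}|+\lambda_3\sum_{i,j}|\Theta_{ij}|,\qquad l_2(\Lambda,\Theta)=-\log|\Lambda|+\mathrm{tr}\big(S_{yy}\Lambda+2S_{xy}^T\Theta+\Lambda^{-1}\Theta^TS_{xx}\Theta\big),$$ with $\lambda_2,\lambda_3\ge 0$. Notation. $\Gamma_0=(\Lambda_0^T,\Theta_0^T)^T$ has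 support $S$, with complement $\bar S$; $\gamma$ is the largest number of nonzero entries in a column of $\Gamma_0$; $s_\Lambda$ and $s_\Theta$ are the numbers of nonzero off-diagonal entries of $\Lambda_0$ and of nonzero entries of $\Theta_0$. With $\Sigma_0=\Lambda_0^{-1}$, $H_0$ is the Hessian of $l_2$ at $(\Lambda_0,\Theta_0)$ in its Kronecker form, with blocks $\Sigma_0\otimes(\Sigma_0+2\Sigma_0\Theta_0^TS_{xx}\Theta_0\Sigma_0)$ for $(\Lambda,\Lambda)$, $-2\Sigma_0\otimes S_{xx}\Theta_0\Sigma_0$ for $(\Theta,\Lambda)$, the transpose of the latter for $(\Lambda,\Theta)$, and $2\Sigma_0\otimes S_{xx}$ for $(\Theta,\Theta)$. Put $C_\sigma=\max_i\Sigma_{0,ii}$, $C_\Sigma=\max_{i,j}|\Sigma_{0,ij}|$, $C_\Theta=\max_{i,j}|\Theta_{0,ij}|$, $C_X=\max_j\|X^j\|_2/\sqrt n$ (where $X^j$ is the $j$th column of $X$), $C_X^\star=\max\{C_X^2,1\}$, $\kappa_H=\max_{i,j}|(H_0^{-1})_{ij}|$. Assumptions. Fix $\alpha\in(0,1)$ and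 $\tau>2$. (i) For each column $i$ of $\Theta_0$, with support $S_i$, the smallest eigenvalue of $X_{S_i}^TX_{S_i}/n$ is positive. (ii) $H_0$ is invertible, and every absolute row sum of $H_{0,\bar SS}(H_{0,SS})^{-1}$ is at most $1-\alpha$. (iii) $n\ge C_{2,1}C_{2,2}^2C_\sigma^2\gamma^4(1+8\alpha^{-1})^4[\tau\log(pd)+\log4]$, where $C_{2,1}=\max\{12800,32C_X^2\}$ and $C_{2,2}=\kappa_H\max\{3C_\Sigma/\gamma,\ 2/(C_\Theta\gamma),\ 412\,C_\Sigma^4C_\Theta^2C_X^2\}$. (iv) $\max\{\lambda_2,\lambda_3\}=8\alpha^{-1}C_\sigma C_X^\star\sqrt{3200}\sqrt{(\tau\log(pd)+\log4)/n}$. Let $\hat f$ be the estimated density of $X$ (any probability density on $\mathbb R^d$, which may depend on the data), and define $$\mathrm{SKL}\big(f_0(y|x),\hat f(y|x)\big)=\int \mathrm{KL}\big(f_0(\cdot|x),\hat f(\cdot|x)\big)f_0(x)\,dx+\int \mathrm{KL}\big(\hat f(\cdot|x),f_0(\cdot|x)\big)\hat f(x)\,dx,$$ where $f_0(\cdot|x)$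 and $\hat f(\cdot|x)$ are the densities of $N(-\Lambda_0^{-1}\Theta_0^Tx,\Lambda_0^{-1})$ and $N(-\hat\Lambda^{-1}\hat\Theta^Tx,\hat\Lambda^{-1})$, and $\mathrm{KL}(g,h)=\int g\log(g/h)$. Theorem. For all $C_L,C_U,\tau,\alpha$ as above and all real $\bar\kappa,\bar c_X,\bar c_\Theta,\bar s,\bar m$ there is a constant $K>0$, depending only on these numbers, such that the following holds for all $n,p,d,\Lambda_0,\Theta_0,f_0$ as above with $C_\Theta\le\bar c_\Theta$, $\max\{p+s_\Lambda,s_\Theta\}\le\bar s\,p$ (for instance $\bar s=\gamma$) and $\int x^Tx\,f_0(x)\,dx\le\bar m$. There is an event of probability at least $1-\big(p^{-(\tau-2)}+(pd)^{-(\tau-1)}\big)$ on which: whenever (i)-(iv) hold, $\kappa_H\le\bar\kappa$, $C_X\le\bar c_X$, $\int x^Tx\,\hat f(x)\,dx\le\bar m$ and $\|\hat\Lambda-\Lambda_0\|_F\le C_L/2$, one has $$\mathrm{SKL}\big(f_0(y|x),\hat f(y|x)\big)\le K\Big(n^{-5/2}p^{5/2}(\log pd)^{5/2}+n^{-1}p^2\log(pd)\Big).$$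 -/

import Mathlib

open MeasureTheory Matrix
open scoped ENNReal Kronecker

noncomputable section

namespace CGGM

/-- Elementwise maximum norm `max_{i,j} |A i j|` of a matrix with finite index types. -/
def maxAbs {ι κ : Type*} (A : Matrix ι κ ℝ) : ℝ := ⨆ i, ⨆ j, |A i j|

/-- Frobenius norm. -/
def frob {ι κ : Type*} [Fintype ι] [Fintype κ] (A : Matrix ι κ ℝ) : ℝ :=
  Real.sqrt (∑ i, ∑ j, A i j ^ 2)

section Model

variable {n p d : ℕ}

/-- A probability density on `ℝ^d` with respect to Lebesgue measure (a density on a subset of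
`ℝ^d` is extended by zero). -/
def IsDensity (f : (Fin d → ℝ) → ℝ) : Prop :=
  Measurable f ∧ (∀ x, 0 ≤ f x) ∧ ∫⁻ x, ENNReal.ofReal (f x) = 1

/-- The law with density `f`. -/
def law (f : (Fin d → ℝ) → ℝ) : Measure (Fin d → ℝ) :=
  volume.withDensity fun x => ENNReal.ofReal (f x)

/-- The second moment `∫ xᵀx f(x) dx`, as an extended nonnegative number. -/
def secondMoment (f : (Fin d → ℝ) → ℝ) : ℝ≥0∞ :=
  ∫⁻ x, ENNReal.ofReal (x ⬝ᵥ x) ∂(law f)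

/-- The conditional mean `-Λ⁻¹ Θᵀ x`. -/
def condMean (Λ : Matrix (Fin p) (Fin p) ℝ) (Θ : Matrix (Fin d) (Fin p) ℝ)
    (x : Fin d → ℝ) : Fin p → ℝ :=
  -((Λ⁻¹ * Θᵀ) *ᵥ x)

/-- The density at `y` of the normal law `N(-Λ⁻¹ Θᵀ x, Λ⁻¹)`. -/
def condDensity (Λ : Matrix (Fin p) (Fin p) ℝ) (Θ : Matrix (Fin d) (Fin p) ℝ)
    (x : Fin d → ℝ) (y : Fin p → ℝ) : ℝ :=
  Real.sqrt (Λ.det / (2 * Real.pi) ^ p) *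
    Real.exp (-((y - condMean Λ Θ x) ⬝ᵥ (Λ *ᵥ (y - condMean Λ Θ x))) / 2)

/-- The normal law `N(-Λ⁻¹ Θᵀ x, Λ⁻¹)`, the conditional law of `Y` given `X = x`. -/
def condLaw (Λ : Matrix (Fin p) (Fin p) ℝ) (Θ : Matrix (Fin d) (Fin p) ℝ)
    (x : Fin d → ℝ) : Measure (Fin p → ℝ) :=
  volume.withDensity fun y => ENNReal.ofReal (condDensity Λ Θ x y)

/-- The law of `Z = (X, Y)`, with joint density `f(x) f(y|x)`. -/
def jointLaw (f : (Fin d → ℝ) → ℝ) (Λ : Matrix (Fin p) (Fin p) ℝ)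
    (Θ : Matrix (Fin d) (Fin p) ℝ) : Measure ((Fin d → ℝ) × (Fin p → ℝ)) :=
  volume.withDensity fun z => ENNReal.ofReal (f z.1 * condDensity Λ Θ z.1 z.2)

/-- The law of an i.i.d. sample `Z_1, …, Z_n` from the joint law. -/
def sampleLaw (n : ℕ) (f : (Fin d → ℝ) → ℝ) (Λ : Matrix (Fin p) (Fin p) ℝ)
    (Θ : Matrix (Fin d) (Fin p) ℝ) : Measure (Fin n → (Fin d → ℝ) × (Fin p → ℝ)) :=
  Measure.pi fun _ => jointLaw f Λ Θ

/-- The symmetrized Kullback-Leibler divergence between two conditional densities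
`f₁(y|x)`, `f₂(y|x)` of the Gaussian model, each of the two terms being averaged over its own
marginal density of `x`. -/
def condSKL (f₁ : (Fin d → ℝ) → ℝ) (Λ₁ : Matrix (Fin p) (Fin p) ℝ)
    (Θ₁ : Matrix (Fin d) (Fin p) ℝ) (f₂ : (Fin d → ℝ) → ℝ) (Λ₂ : Matrix (Fin p) (Fin p) ℝ)
    (Θ₂ : Matrix (Fin d) (Fin p) ℝ) : ℝ≥0∞ :=
  (∫⁻ x, InformationTheory.klDiv (condLaw Λ₁ Θ₁ x) (condLaw Λ₂ Θ₂ x) ∂(law f₁)) +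
    ∫⁻ x, InformationTheory.klDiv (condLaw Λ₂ Θ₂ x) (condLaw Λ₁ Θ₁ x) ∂(law f₂)

/-- The `n × d` design matrix, with rows `X_1, …, X_n`. -/
def xMat (z : Fin n → (Fin d → ℝ) × (Fin p → ℝ)) : Matrix (Fin n) (Fin d) ℝ :=
  Matrix.of fun i => (z i).1

/-- The `n × p` response matrix, with rows `Y_1, …, Y_n`. -/
def yMat (z : Fin n → (Fin d → ℝ) × (Fin p → ℝ)) : Matrix (Fin n) (Fin p) ℝ :=
  Matrix.of fun i => (z i).2

/-- `n⁻¹ Aᵀ B` (the matrices `S_xx`, `S_xy`, `S_yy`). -/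
def gram {ι κ : Type*} (A : Matrix (Fin n) ι ℝ) (B : Matrix (Fin n) κ ℝ) : Matrix ι κ ℝ :=
  (n : ℝ)⁻¹ • (Aᵀ * B)

/-- The negative conditional log likelihood (up to scaling and constants). -/
def negLogLik (X : Matrix (Fin n) (Fin d) ℝ) (Y : Matrix (Fin n) (Fin p) ℝ)
    (Λ : Matrix (Fin p) (Fin p) ℝ) (Θ : Matrix (Fin d) (Fin p) ℝ) : ℝ :=
  -Real.log Λ.det +
    (gram Y Y * Λ + (2 : ℝ) • ((gram X Y)ᵀ * Θ) + Λ⁻¹ * Θᵀ * (gram X X)ᵀ * Θ).trace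

/-- The penalized objective: `l1` penalties on the off-diagonal entries of `Λ` and on `Θ`. -/
def objective (X : Matrix (Fin n) (Fin d) ℝ) (Y : Matrix (Fin n) (Fin p) ℝ) (lam₂ lam₃ : ℝ)
    (Λ : Matrix (Fin p) (Fin p) ℝ) (Θ : Matrix (Fin d) (Fin p) ℝ) : ℝ :=
  negLogLik X Y Λ Θ + lam₂ * (∑ i, ∑ j, if i = j then 0 else |Λ i j|) +
    lam₃ * ∑ i, ∑ j, |Θ i j|

/-- `(Λ, Θ)` minimizes the penalized objective over all positive definite `Λ` and all `Θ`. -/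
def IsEstimate (X : Matrix (Fin n) (Fin d) ℝ) (Y : Matrix (Fin n) (Fin p) ℝ) (lam₂ lam₃ : ℝ)
    (Λ : Matrix (Fin p) (Fin p) ℝ) (Θ : Matrix (Fin d) (Fin p) ℝ) : Prop :=
  Λ.PosDef ∧ ∀ (Λ' : Matrix (Fin p) (Fin p) ℝ) (Θ' : Matrix (Fin d) (Fin p) ℝ), Λ'.PosDef →
    objective X Y lam₂ lam₃ Λ Θ ≤ objective X Y lam₂ lam₃ Λ' Θ'

/-- The stacked parameter `Γ = (Λᵀ, Θᵀ)ᵀ`. -/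
def stacked (Λ : Matrix (Fin p) (Fin p) ℝ) (Θ : Matrix (Fin d) (Fin p) ℝ) :
    Matrix (Fin p ⊕ Fin d) (Fin p) ℝ :=
  Matrix.fromRows Λ Θ

/-- The Hessian of the negative log likelihood in the parameter `Γ = (Λᵀ, Θᵀ)ᵀ`, in its
Kronecker form: with `Σ = Λ⁻¹`, the blocks are `Σ ⊗ (Σ + 2 Σ Θᵀ S_xx Θ Σ)` in `(Λ, Λ)`,
`-2 Σ ⊗ S_xx Θ Σ` in `(Θ, Λ)` and `2 Σ ⊗ S_xx` in `(Θ, Θ)`. The pair `(a, j)` indexes the entry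
`Γ a j`; in this indexing the factor acting on the rows of `Γ` is written first. -/
def hessian (X : Matrix (Fin n) (Fin d) ℝ) (Λ : Matrix (Fin p) (Fin p) ℝ)
    (Θ : Matrix (Fin d) (Fin p) ℝ) :
    Matrix ((Fin p ⊕ Fin d) × Fin p) ((Fin p ⊕ Fin d) × Fin p) ℝ :=
  (Matrix.fromBlocks
    (Λ⁻¹ + (2 : ℝ) • (Λ⁻¹ * Θᵀ * gram X X * Θ * Λ⁻¹))
    (-(2 : ℝ) • (Λ⁻¹ * Θᵀ * gram X X))
    (-(2 : ℝ) • (gram X X * Θ * Λ⁻¹))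
    ((2 : ℝ) • gram X X)) ⊗ₖ Λ⁻¹

/-- `C_σ`, the largest diagonal entry of `Λ⁻¹`. -/
def cSigma (Λ : Matrix (Fin p) (Fin p) ℝ) : ℝ := ⨆ i, Λ⁻¹ i i

/-- `C_X`, the largest Euclidean norm of a column of `X`, divided by `√n`. -/
def cX (X : Matrix (Fin n) (Fin d) ℝ) : ℝ :=
  ⨆ j, Real.sqrt (∑ i, X i j ^ 2) / Real.sqrt n

/-- `κ_H`, the largest absolute entry of the inverse Hessian. -/
def kappaH (X : Matrix (Fin n) (Fin d) ℝ) (Λ : Matrix (Fin p) (Fin p) ℝ)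
    (Θ : Matrix (Fin d) (Fin p) ℝ) : ℝ :=
  maxAbs (hessian X Λ Θ)⁻¹

open scoped Classical in
/-- `γ`, the largest number of nonzero entries in a column of `Γ`. -/
def maxDegree (Λ : Matrix (Fin p) (Fin p) ℝ) (Θ : Matrix (Fin d) (Fin p) ℝ) : ℕ :=
  Finset.univ.sup fun j : Fin p =>
    (Finset.univ.filter fun a : Fin p ⊕ Fin d => stacked Λ Θ a j ≠ 0).card

open scoped Classical in
/-- `s_Λ`, the number of nonzero off-diagonal entries of `Λ`. -/
def sLambda (Λ : Matrix (Fin p) (Fin p) ℝ) : ℕ :=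
  (Finset.univ.filter fun e : Fin p × Fin p => e.1 ≠ e.2 ∧ Λ e.1 e.2 ≠ 0).card

open scoped Classical in
/-- `s_Θ`, the number of nonzero entries of `Θ`. -/
def sTheta (Θ : Matrix (Fin d) (Fin p) ℝ) : ℕ :=
  (Finset.univ.filter fun e : Fin d × Fin p => Θ e.1 e.2 ≠ 0).card

/-- Restricted convexity: for each column `i` of `Θ` with support `S_i`, the smallest eigenvalue
of the submatrix `n⁻¹ X_{S_i}ᵀ X_{S_i}` of `S_xx` is positive. -/
def RestrictedConvexity (X : Matrix (Fin n) (Fin d) ℝ) (Θ : Matrix (Fin d) (Fin p) ℝ) : Prop :=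
  ∀ i : Fin p, ((gram X X).submatrix
    (Subtype.val : {j : Fin d // Θ j i ≠ 0} → Fin d) Subtype.val).PosDef

open scoped Classical in
/-- Mutual incoherence: with `S` the support of `Γ` and `S'` its complement, every absolute row
sum of `H_{S'S} (H_{SS})⁻¹` is at most `1 - α`. -/
def MutualIncoherence (X : Matrix (Fin n) (Fin d) ℝ) (Λ : Matrix (Fin p) (Fin p) ℝ)
    (Θ : Matrix (Fin d) (Fin p) ℝ) (α : ℝ) : Prop :=
  ∀ e : {e : (Fin p ⊕ Fin d) × Fin p // stacked Λ Θ e.1 e.2 = 0},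
    ∑ s : {s : (Fin p ⊕ Fin d) × Fin p // stacked Λ Θ s.1 s.2 ≠ 0},
      |((hessian X Λ Θ).submatrix
          (Subtype.val : {e : (Fin p ⊕ Fin d) × Fin p // stacked Λ Θ e.1 e.2 = 0} → _)
          (Subtype.val : {s : (Fin p ⊕ Fin d) × Fin p // stacked Λ Θ s.1 s.2 ≠ 0} → _) *
        ((hessian X Λ Θ).submatrix
          (Subtype.val : {s : (Fin p ⊕ Fin d) × Fin p // stacked Λ Θ s.1 s.2 ≠ 0} → _)
          Subtype.val)⁻¹) e s| ≤ 1 - α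

/-- `max {12800, 32 C_X²}`. -/
def const₁ (X : Matrix (Fin n) (Fin d) ℝ) : ℝ := max 12800 (32 * cX X ^ 2)

/-- `κ_H max {3 C_Σ / γ, 2 / (C_Θ γ), 412 C_Σ⁴ C_Θ² C_X²}`, where `C_Σ`, `C_Θ` are the largest
absolute entries of `Λ⁻¹` and `Θ`. -/
def const₂ (X : Matrix (Fin n) (Fin d) ℝ) (Λ : Matrix (Fin p) (Fin p) ℝ)
    (Θ : Matrix (Fin d) (Fin p) ℝ) : ℝ :=
  kappaH X Λ Θ *
    max (max (3 * maxAbs Λ⁻¹ / maxDegree Λ Θ) (2 / (maxAbs Θ * maxDegree Λ Θ)))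
      (412 * maxAbs Λ⁻¹ ^ 4 * maxAbs Θ ^ 2 * cX X ^ 2)

/-- The lower bound required of the sample size. -/
def SampleSizeBound (X : Matrix (Fin n) (Fin d) ℝ) (Λ : Matrix (Fin p) (Fin p) ℝ)
    (Θ : Matrix (Fin d) (Fin p) ℝ) (τ α : ℝ) : Prop :=
  const₁ X * const₂ X Λ Θ ^ 2 * cSigma Λ ^ 2 * (maxDegree Λ Θ : ℝ) ^ 4 * (1 + 8 * α⁻¹) ^ 4 *
    (τ * Real.log (p * d) + Real.log 4) ≤ n

/-- The prescribed regularization level `λ = max {λ₂, λ₃}`. -/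
def regLevel (X : Matrix (Fin n) (Fin d) ℝ) (Λ : Matrix (Fin p) (Fin p) ℝ) (τ α : ℝ) : ℝ :=
  8 * α⁻¹ * cSigma Λ * max (cX X ^ 2) 1 * Real.sqrt 3200 *
    Real.sqrt ((τ * Real.log (p * d) + Real.log 4) / n)

end Model

/-- The rate `n^{-5/2} p^{5/2} (log pd)^{5/2} + n^{-1} p² log pd`. -/
def rate (n p d : ℕ) : ℝ :=
  (n : ℝ) ^ (-(5 / 2) : ℝ) * (p : ℝ) ^ (5 / 2 : ℝ) * Real.log (p * d) ^ (5 / 2 : ℝ) +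
    (n : ℝ)⁻¹ * (p : ℝ) ^ 2 * Real.log (p * d)

/-- The exceptional probability `p^{-(τ-2)} + (pd)^{-(τ-1)}`. -/
def failProb (p d : ℕ) (τ : ℝ) : ℝ :=
  (p : ℝ) ^ (-(τ - 2)) + ((p : ℝ) * d) ^ (-(τ - 1))

end CGGM

end

/-! Let `B` be the symmetric square root of `Λ₀` and `C` its inverse. In the whitened errors `N = C
(Λ' - Λ₀) C` and `W = (Θ₀ Λ₀⁻¹ - Θ' Λ'⁻¹) B`, both divergences at a point `x` are at most `‖N‖² +
‖W‖² xᵀx` once `‖N‖ ≤ 1/2` (`klDiv_condLaw_le`). This smallness is what the assumption `‖Λ' - Λ₀‖ ≤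
C_L / 2` provides. Since the second moments are bounded, it remains to show that `‖N‖²` and `‖W‖²`
are of order `r² p²` with `r² = log(pd)/n`; this is the second term of the rate.

Both errors are controlled by comparing the value of the penalized objective at the estimate with
two other values (`basic_inequalities`). Keeping the estimated precision and inserting the true
regression matrix leaves an inequality for `W` alone. Comparing with the truth gives `‖N‖²`, because
`tr N - log det (1 + N)` is at least `‖N‖²/6`. The noise enters through `GᵀX/n` and `GᵀG/n - 1`,
whose entries are of order `r` by Chernoff bounds (`exists_noise_event`).

Convexity in `W` comes from the bound on the inverse Hessian, which forces `v j ^ 2 ≤ κ vᵀ S_xx v`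
(`sq_le_gram_form`). Summing over coordinates costs a factor `d`, so `‖W‖²` is of order `d³ p r²`,
which suffices when `d³ ≤ c₁ p`. For larger `d` the Hessian bound itself is improbable: it makes
`det S_xx` at least `κ^{-d}`, while a bounded second moment of `X` spread over `d` directions allows
only about `(m/d)^d`. Markov's inequality for a determinant bound makes this exponentially unlikely
in `d` (`exists_design_event`). -/

namespace CGGM

/-! ### Frobenius norm inequalities. -/

section Frobenius

variable {ι κ μ : Type*} [Fintype ι] [Fintype κ] [Fintype μ]

theorem frob_nonneg (A : Matrix ι κ ℝ) : 0 ≤ frob A := Real.sqrt_nonneg _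

theorem frob_sq (A : Matrix ι κ ℝ) : frob A ^ 2 = ∑ i, ∑ j, A i j ^ 2 :=
  Real.sq_sqrt (Finset.sum_nonneg fun _ _ => Finset.sum_nonneg fun _ _ => sq_nonneg _)

open scoped Matrix.Norms.Frobenius in
theorem frob_eq_norm (A : Matrix ι κ ℝ) : frob A = ‖A‖ := by
  rw [Matrix.frobenius_norm_def, frob, Real.sqrt_eq_rpow]
  simp

theorem frob_transpose (A : Matrix ι κ ℝ) : frob Aᵀ = frob A := by
  simp only [frob, Matrix.transpose_apply]
  rw [Finset.sum_comm]

open scoped Matrix.Norms.Frobenius in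
theorem frob_add_le (A B : Matrix ι κ ℝ) : frob (A + B) ≤ frob A + frob B := by
  simpa only [frob_eq_norm] using norm_add_le A B

open scoped Matrix.Norms.Frobenius in
theorem frob_neg (A : Matrix ι κ ℝ) : frob (-A) = frob A := by
  simpa only [frob_eq_norm] using norm_neg A

theorem frob_sub_le (A B : Matrix ι κ ℝ) : frob (A - B) ≤ frob A + frob B := by
  rw [sub_eq_add_neg, ← frob_neg B]; exact frob_add_le _ _

open scoped Matrix.Norms.Frobenius in
theorem frob_mul_le (A : Matrix ι κ ℝ) (B : Matrix κ μ ℝ) : frob (A * B) ≤ frob A * frob B := by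
  simpa only [frob_eq_norm] using Matrix.frobenius_norm_mul A B

theorem frob_sq_eq_sum_col (A : Matrix ι κ ℝ) :
    frob A ^ 2 = ∑ j, (fun i => A i j) ⬝ᵥ (fun i => A i j) := by
  rw [frob_sq, Finset.sum_comm]
  simp only [dotProduct, sq]

theorem sum_abs_le_sqrt_card_mul_frob (s : Finset (ι × κ)) (A : Matrix ι κ ℝ) :
    ∑ e ∈ s, |A e.1 e.2| ≤ Real.sqrt s.card * frob A := by
  have h := sq_sum_le_card_mul_sum_sq (s := s) (f := fun e => |A e.1 e.2|)
  have h2 : ∑ e ∈ s, |A e.1 e.2| ^ 2 ≤ frob A ^ 2 := by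
    rw [frob_sq, ← Finset.sum_product', Finset.univ_product_univ]
    simp only [sq_abs]
    exact Finset.sum_le_sum_of_subset_of_nonneg (Finset.subset_univ _) fun _ _ _ => sq_nonneg _
  refine abs_le_of_sq_le_sq' ?_ (by have := frob_nonneg A; positivity) |>.2
  rw [mul_pow, Real.sq_sqrt (Nat.cast_nonneg _)]
  exact h.trans (by gcongr)

theorem sum_sum_abs_le (A : Matrix ι κ ℝ) :
    ∑ i, ∑ j, |A i j| ≤ Real.sqrt (Fintype.card ι * Fintype.card κ) * frob A := by
  rw [← Finset.sum_product', Finset.univ_product_univ]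
  simpa using sum_abs_le_sqrt_card_mul_frob (Finset.univ : Finset (ι × κ)) A

theorem frob_le_of_abs_le {A : Matrix ι κ ℝ} {e : ℝ} (h : ∀ i j, |A i j| ≤ e) (he : 0 ≤ e) :
    frob A ≤ e * Real.sqrt (Fintype.card ι * Fintype.card κ) := by
  refine Real.sqrt_le_iff.2 ⟨by positivity, ?_⟩
  rw [mul_pow, Real.sq_sqrt (by positivity)]
  calc ∑ i, ∑ j, A i j ^ 2 ≤ ∑ _i : ι, ∑ _j : κ, e ^ 2 := by
        refine Finset.sum_le_sum fun i _ => Finset.sum_le_sum fun j _ => ?_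
        exact sq_le_sq.2 (by rw [abs_of_nonneg he]; exact h i j)
    _ = e ^ 2 * (Fintype.card ι * Fintype.card κ) := by simp; ring

theorem abs_trace_mul_le (A : Matrix ι κ ℝ) (B : Matrix κ ι ℝ) :
    |(A * B).trace| ≤ frob A * frob B := by
  have h : (A * B).trace = ∑ e : ι × κ, A e.1 e.2 * B e.2 e.1 := by
    simp only [trace, diag_apply, mul_apply]
    rw [Fintype.sum_prod_type]
  refine abs_le_of_sq_le_sq ?_ (by have := frob_nonneg A; have := frob_nonneg B; positivity)
  rw [h, mul_pow, ← frob_transpose B, frob_sq, frob_sq]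
  refine (Finset.sum_mul_sq_le_sq_mul_sq _ _ _).trans_eq ?_
  simp only [Fintype.sum_prod_type, transpose_apply]

theorem dotProduct_sq_le (v w : ι → ℝ) : (v ⬝ᵥ w) ^ 2 ≤ (v ⬝ᵥ v) * (w ⬝ᵥ w) := by
  simpa only [dotProduct, sq] using Finset.sum_mul_sq_le_sq_mul_sq Finset.univ v w

theorem mulVec_dotProduct_self_le (A : Matrix ι κ ℝ) (v : κ → ℝ) :
    (A *ᵥ v) ⬝ᵥ (A *ᵥ v) ≤ frob A ^ 2 * (v ⬝ᵥ v) := by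
  rw [frob_sq, Finset.sum_mul, dotProduct]
  refine Finset.sum_le_sum fun i _ => ?_
  have := dotProduct_sq_le (A i) v
  simp only [dotProduct, ← sq] at this
  simpa only [mulVec, dotProduct, ← sq] using this

/-- The hypothesis is an operator norm bound in the guise of a quadratic form, applied to each
column of `M`. It avoids the dimension factor that `frob A` would bring in for `A = B` or `A = C`.
-/
theorem frob_mul_sq_le {A : Matrix ι κ ℝ} {c : ℝ}
    (h : ∀ v, (A *ᵥ v) ⬝ᵥ (A *ᵥ v) ≤ c * (v ⬝ᵥ v)) (M : Matrix κ μ ℝ) :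
    frob (A * M) ^ 2 ≤ c * frob M ^ 2 := by
  rw [frob_sq_eq_sum_col, frob_sq_eq_sum_col, Finset.mul_sum]
  exact Finset.sum_le_sum fun j _ => h fun i => M i j

theorem frob_mul_le_of_form {A : Matrix ι κ ℝ} {c : ℝ} (hc : 0 ≤ c)
    (h : ∀ v, (A *ᵥ v) ⬝ᵥ (A *ᵥ v) ≤ c ^ 2 * (v ⬝ᵥ v)) (M : Matrix κ μ ℝ) :
    frob (A * M) ≤ c * frob M := by
  refine abs_le_of_sq_le_sq' ?_ (mul_nonneg hc (frob_nonneg M)) |>.2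
  rw [mul_pow]
  exact frob_mul_sq_le h M

end Frobenius

/-! ### Spectral calculus and determinant inequalities. -/

section Spectral

variable {ι : Type*} [Fintype ι] [DecidableEq ι]

theorem exists_diagonalization {A : Matrix ι ι ℝ} (hA : A.IsHermitian) :
    ∃ U : Matrix ι ι ℝ, Uᵀ * U = 1 ∧ U * Uᵀ = 1 ∧ A = U * diagonal hA.eigenvalues * Uᵀ := by
  refine ⟨hA.eigenvectorUnitary, ?_, ?_, ?_⟩
  · simpa [star_eq_conjTranspose] using Unitary.coe_star_mul_self hA.eigenvectorUnitary
  · simpa [star_eq_conjTranspose] using Unitary.coe_mul_star_self hA.eigenvectorUnitary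
  · have := hA.spectral_theorem
    rw [Unitary.conjStarAlgAut_apply] at this
    simpa [star_eq_conjTranspose, Function.comp_def] using this

omit [DecidableEq ι] in
theorem dotProduct_mulVec_transpose (A : Matrix ι ι ℝ) (v w : ι → ℝ) :
    (A *ᵥ v) ⬝ᵥ w = v ⬝ᵥ (Aᵀ *ᵥ w) := by
  rw [dotProduct_comm, dotProduct_mulVec, ← mulVec_transpose, dotProduct_comm]

theorem conj_diagonal_mul_conj_diagonal {U : Matrix ι ι ℝ} (hU : Uᵀ * U = 1) (a b : ι → ℝ) :
    (U * diagonal a * Uᵀ) * (U * diagonal b * Uᵀ) = U * diagonal (fun i => a i * b i) * Uᵀ := by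
  calc _ = U * diagonal a * (Uᵀ * U) * diagonal b * Uᵀ := by simp only [Matrix.mul_assoc]
    _ = _ := by rw [hU, Matrix.mul_one, Matrix.mul_assoc U, diagonal_mul_diagonal]

theorem dotProduct_conj_diagonal (U : Matrix ι ι ℝ) (a v : ι → ℝ) :
    v ⬝ᵥ ((U * diagonal a * Uᵀ) *ᵥ v) = ∑ i, a i * (Uᵀ *ᵥ v) i ^ 2 := by
  rw [← mulVec_mulVec, ← mulVec_mulVec, ← transpose_transpose U, ← dotProduct_mulVec_transpose,
    transpose_transpose, dotProduct]
  exact Finset.sum_congr rfl fun i _ => by rw [mulVec_diagonal]; ring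

theorem sum_sq_transpose_mulVec {U : Matrix ι ι ℝ} (hU : U * Uᵀ = 1) (v : ι → ℝ) :
    ∑ i, (Uᵀ *ᵥ v) i ^ 2 = v ⬝ᵥ v := by
  have := dotProduct_conj_diagonal U (fun _ => 1) v
  simp only [diagonal_one, Matrix.mul_one, hU, one_mulVec, one_mul] at this
  exact this.symm

/-- A symmetric square root of a positive definite matrix with spectrum in `[a, b]`, together with
its inverse. -/
theorem exists_sqrt {A : Matrix ι ι ℝ} (hA : A.IsHermitian) {a b : ℝ} (ha : 0 < a)
    (h : ∀ i, a ≤ hA.eigenvalues i ∧ hA.eigenvalues i ≤ b) :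
    ∃ B C : Matrix ι ι ℝ, Bᵀ = B ∧ Cᵀ = C ∧ B * B = A ∧ B * C = 1 ∧ C * B = 1 ∧
      (∀ v, (B *ᵥ v) ⬝ᵥ (B *ᵥ v) ≤ b * (v ⬝ᵥ v)) ∧
      (∀ v, (C *ᵥ v) ⬝ᵥ (C *ᵥ v) ≤ a⁻¹ * (v ⬝ᵥ v)) := by
  obtain ⟨U, hU, hU', hAU⟩ := exists_diagonalization hA
  have hpos : ∀ i, 0 < hA.eigenvalues i := fun i => ha.trans_le (h i).1
  have hs : ∀ i, √(hA.eigenvalues i) ≠ 0 := fun i => (Real.sqrt_pos.2 (hpos i)).ne'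
  have hB : ∀ f : ι → ℝ, (U * diagonal f * Uᵀ)ᵀ = U * diagonal f * Uᵀ := fun f => by
    simp [transpose_mul, Matrix.mul_assoc]
  refine ⟨U * diagonal (fun i => √(hA.eigenvalues i)) * Uᵀ,
    U * diagonal (fun i => (√(hA.eigenvalues i))⁻¹) * Uᵀ, hB _, hB _, ?_, ?_, ?_, ?_, ?_⟩
  · rw [conj_diagonal_mul_conj_diagonal hU]
    conv_rhs => rw [hAU]
    congr 3
    ext i
    exact Real.mul_self_sqrt (hpos i).le
  · rw [conj_diagonal_mul_conj_diagonal hU]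
    simp only [mul_inv_cancel₀ (hs _), diagonal_one, Matrix.mul_one, hU']
  · rw [conj_diagonal_mul_conj_diagonal hU]
    simp only [inv_mul_cancel₀ (hs _), diagonal_one, Matrix.mul_one, hU']
  · intro v
    rw [dotProduct_mulVec_transpose, hB, mulVec_mulVec, conj_diagonal_mul_conj_diagonal hU,
      dotProduct_conj_diagonal, ← sum_sq_transpose_mulVec hU', Finset.mul_sum]
    refine Finset.sum_le_sum fun i _ => ?_
    rw [Real.mul_self_sqrt (hpos i).le]
    exact mul_le_mul_of_nonneg_right (h i).2 (sq_nonneg _)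
  · intro v
    rw [dotProduct_mulVec_transpose, hB, mulVec_mulVec, conj_diagonal_mul_conj_diagonal hU,
      dotProduct_conj_diagonal, ← sum_sq_transpose_mulVec hU', Finset.mul_sum]
    refine Finset.sum_le_sum fun i _ => ?_
    rw [← mul_inv, Real.mul_self_sqrt (hpos i).le]
    exact mul_le_mul_of_nonneg_right (inv_anti₀ ha (h i).1) (sq_nonneg _)

omit [DecidableEq ι] in
theorem abs_dotProduct_mulVec_le (N : Matrix ι ι ℝ) (v : ι → ℝ) :
    |v ⬝ᵥ (N *ᵥ v)| ≤ frob N * (v ⬝ᵥ v) := by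
  have hv : 0 ≤ v ⬝ᵥ v := by simpa using dotProduct_star_self_nonneg v
  refine abs_le_of_sq_le_sq ?_ (mul_nonneg (frob_nonneg N) hv)
  calc (v ⬝ᵥ (N *ᵥ v)) ^ 2 ≤ (v ⬝ᵥ v) * ((N *ᵥ v) ⬝ᵥ (N *ᵥ v)) := dotProduct_sq_le _ _
    _ ≤ (v ⬝ᵥ v) * (frob N ^ 2 * (v ⬝ᵥ v)) := by gcongr; exact mulVec_dotProduct_self_le N v
    _ = _ := by ring

theorem half_le_one_add_form {N : Matrix ι ι ℝ} (hN : frob N ≤ 1 / 2) (v : ι → ℝ) :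
    1 / 2 * (v ⬝ᵥ v) ≤ v ⬝ᵥ ((1 + N) *ᵥ v) ∧ v ⬝ᵥ ((1 + N) *ᵥ v) ≤ 3 / 2 * (v ⬝ᵥ v) := by
  have hv : 0 ≤ v ⬝ᵥ v := by simpa using dotProduct_star_self_nonneg v
  have h := abs_le.1 (abs_dotProduct_mulVec_le N v)
  rw [add_mulVec, one_mulVec, dotProduct_add]
  constructor <;> nlinarith [h.1, h.2]

/-- With `s = √(1 + x)`, the bound `log s ≤ s - 1` gives `x - log (1 + x) ≥ (s - 1)²`, and `x² = (s
- 1)² (s + 1)²` where `(s + 1)² ≤ 6`. -/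
theorem sub_log_one_add_ge {x : ℝ} (h1 : -(1 / 2) ≤ x) (h2 : x ≤ 1 / 2) :
    x ^ 2 / 6 ≤ x - Real.log (1 + x) := by
  have hp : 0 < 1 + x := by linarith
  set s := √(1 + x) with hs
  have hs0 : 0 < s := Real.sqrt_pos.2 hp
  have hs2 : s ^ 2 = 1 + x := Real.sq_sqrt hp.le
  have hl : Real.log (1 + x) ≤ 2 * (s - 1) := by
    rw [← hs2, Real.log_pow]
    push_cast
    linarith [Real.log_le_sub_one_of_pos hs0]
  have hx : x = s ^ 2 - 1 := by linarith
  have hs1 : s ≤ 5 / 4 := by nlinarith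
  have : x ^ 2 / 6 ≤ (s - 1) ^ 2 := by
    rw [hx]
    have : (s ^ 2 - 1) ^ 2 = (s - 1) ^ 2 * (s + 1) ^ 2 := by ring
    rw [this]
    have h3 : (s + 1) ^ 2 ≤ 6 := by nlinarith
    nlinarith [mul_le_mul_of_nonneg_left h3 (sq_nonneg (s - 1))]
  nlinarith

/-- The two left sides are nonnegative and add up to `x² / (1 + x)`, so each is at most `2 x²`. -/
theorem sub_log_one_add_le {x : ℝ} (h1 : -(1 / 2) ≤ x) :
    x - Real.log (1 + x) ≤ 2 * x ^ 2 ∧ (1 + x)⁻¹ - 1 + Real.log (1 + x) ≤ 2 * x ^ 2 := by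
  have hp : 0 < 1 + x := by linarith
  have hi : (1 + x)⁻¹ ≤ 2 := by
    rw [inv_le_comm₀ hp two_pos]; linarith
  have key : x - 1 + (1 + x)⁻¹ ≤ 2 * x ^ 2 := by
    have : x - 1 + (1 + x)⁻¹ = x ^ 2 * (1 + x)⁻¹ := by field_simp; ring
    rw [this]; nlinarith [mul_le_mul_of_nonneg_left hi (sq_nonneg x)]
  have h3 := Real.one_sub_inv_le_log_of_pos hp
  have h4 := Real.log_le_sub_one_of_pos hp
  constructor <;> linarith

/-- Second order bounds for `log det (1 + N)`. -/
theorem logdet_bounds {N : Matrix ι ι ℝ} (hN : N.IsHermitian) (hN2 : frob N ≤ 1 / 2) :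
    0 < (1 + N).det ∧ frob N ^ 2 / 6 ≤ N.trace - Real.log (1 + N).det ∧
      N.trace - Real.log (1 + N).det ≤ 2 * frob N ^ 2 ∧
      ((1 + N)⁻¹).trace - Fintype.card ι + Real.log (1 + N).det ≤ 2 * frob N ^ 2 := by
  obtain ⟨U, hU, hU', hNU⟩ := exists_diagonalization hN
  set ν := hN.eigenvalues with hν
  have htr : ∀ f : ι → ℝ, (U * diagonal f * Uᵀ).trace = ∑ i, f i := fun f => by
    rw [trace_mul_comm, ← Matrix.mul_assoc, hU, Matrix.one_mul, trace_diagonal]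
  have hdet : ∀ f : ι → ℝ, (U * diagonal f * Uᵀ).det = ∏ i, f i := fun f => by
    rw [det_mul_comm, ← Matrix.mul_assoc, hU, Matrix.one_mul, det_diagonal]
  have hfr : frob N ^ 2 = ∑ i, ν i ^ 2 := by
    have h1 : frob N ^ 2 = (N * N).trace := by
      rw [frob_sq]
      simp only [trace, diag_apply, mul_apply, sq]
      refine Finset.sum_congr rfl fun i _ => Finset.sum_congr rfl fun j _ => ?_
      rw [← hN.apply i j, star_trivial]
    rw [h1, hNU, conj_diagonal_mul_conj_diagonal hU, htr]
    simp only [sq]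
  have hν1 : ∀ i, |ν i| ≤ 1 / 2 := fun i => by
    refine abs_le_of_sq_le_sq ?_ (by norm_num)
    calc ν i ^ 2 ≤ ∑ i, ν i ^ 2 :=
          Finset.single_le_sum (f := fun i => ν i ^ 2) (fun i _ => sq_nonneg _) (Finset.mem_univ i)
      _ = frob N ^ 2 := hfr.symm
      _ ≤ _ := pow_le_pow_left₀ (frob_nonneg N) hN2 2
  have hpos : ∀ i, 0 < 1 + ν i := fun i => by linarith [(abs_le.1 (hν1 i)).1]
  have h1N : 1 + N = U * diagonal (fun i => 1 + ν i) * Uᵀ := by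
    have : diagonal (fun i => 1 + ν i) = 1 + diagonal ν := by
      rw [← diagonal_one, diagonal_add]
    rw [this, Matrix.mul_add, Matrix.add_mul, Matrix.mul_one, hU', ← hNU]
  have hinv : (1 + N)⁻¹ = U * diagonal (fun i => (1 + ν i)⁻¹) * Uᵀ := by
    refine inv_eq_right_inv ?_
    rw [h1N, conj_diagonal_mul_conj_diagonal hU]
    simp only [mul_inv_cancel₀ (hpos _).ne', diagonal_one, Matrix.mul_one, hU']
  have hd : (1 + N).det = ∏ i, (1 + ν i) := by rw [h1N, hdet]
  have hlog : Real.log (1 + N).det = ∑ i, Real.log (1 + ν i) := by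
    rw [hd, Real.log_prod fun i _ => (hpos i).ne']
  have ht : N.trace = ∑ i, ν i := by rw [← htr, ← hNU]
  refine ⟨hd ▸ Finset.prod_pos fun i _ => hpos i, ?_, ?_, ?_⟩
  · rw [hfr, hlog, ht, ← Finset.sum_sub_distrib, Finset.sum_div]
    exact Finset.sum_le_sum fun i _ => sub_log_one_add_ge (abs_le.1 (hν1 i)).1 (abs_le.1 (hν1 i)).2
  · rw [hfr, hlog, ht, ← Finset.sum_sub_distrib, Finset.mul_sum]
    exact Finset.sum_le_sum fun i _ => (sub_log_one_add_le (abs_le.1 (hν1 i)).1).1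
  · have hc : (Fintype.card ι : ℝ) = ∑ _i : ι, (1 : ℝ) := by simp
    rw [hfr, hlog, hinv, htr, hc, ← Finset.sum_sub_distrib, ← Finset.sum_add_distrib,
      Finset.mul_sum]
    exact Finset.sum_le_sum fun i _ => (sub_log_one_add_le (abs_le.1 (hν1 i)).1).2

/-- The arithmetic-geometric mean inequality for the eigenvalues. -/
theorem det_le_pow_of_trace_le {A : Matrix ι ι ℝ} (hA : A.PosSemidef) {c : ℝ} (hc : 0 < c)
    (h : A.trace ≤ c * Fintype.card ι) : A.det ≤ c ^ Fintype.card ι := by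
  rw [hA.1.trace_eq_sum_eigenvalues] at h
  rw [hA.1.det_eq_prod_eigenvalues]
  simp only [RCLike.ofReal_real_eq_id, id_eq] at h ⊢
  -- The tangent inequality `x ≤ c exp (x / c - 1)` is applied to each eigenvalue; the trace bound
  -- makes the total exponent nonpositive.
  calc ∏ i, hA.1.eigenvalues i ≤ ∏ i, c * Real.exp (hA.1.eigenvalues i / c - 1) := by
        refine Finset.prod_le_prod (fun i _ => hA.eigenvalues_nonneg i) fun i _ => ?_
        have := Real.add_one_le_exp (hA.1.eigenvalues i / c - 1)
        rw [sub_add_cancel, div_le_iff₀' hc] at this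
        exact this
    _ = c ^ Fintype.card ι * Real.exp (∑ i, (hA.1.eigenvalues i / c - 1)) := by
        rw [Finset.prod_mul_distrib, Real.exp_sum]; simp
    _ ≤ c ^ Fintype.card ι * 1 := by
        gcongr
        rw [Real.exp_le_one_iff, Finset.sum_sub_distrib, ← Finset.sum_div]
        simp only [Finset.sum_const, Finset.card_univ, nsmul_eq_mul, mul_one]
        rw [sub_nonpos, div_le_iff₀' hc]
        exact h
    _ = _ := mul_one _

/-- Hadamard's inequality. -/
theorem det_le_prod_diag {A : Matrix ι ι ℝ} (hA : A.PosDef) : A.det ≤ ∏ i, A i i := by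
  have hd : ∀ i, 0 < A i i := fun i => hA.diag_pos
  have hD : (diagonal fun i => (√(A i i))⁻¹ : Matrix ι ι ℝ)ᴴ = diagonal fun i => (√(A i i))⁻¹ := by
    simp [conjTranspose_eq_transpose_of_trivial]
  have hps := hA.posSemidef.conjTranspose_mul_mul_same (diagonal fun i => (√(A i i))⁻¹)
  -- Scaling by the inverse roots of the diagonal gives a matrix with unit diagonal, whose trace is
  -- the dimension, so its determinant is at most `1`.
  rw [hD] at hps
  have h := det_le_pow_of_trace_le hps one_pos (by
    rw [one_mul, trace]
    simp only [diag_apply, mul_diagonal, diagonal_mul]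
    refine (Finset.sum_le_card_nsmul _ _ 1 fun i _ => le_of_eq ?_).trans (by simp)
    have := Real.mul_self_sqrt (hd i).le
    have := (Real.sqrt_pos.2 (hd i)).ne'
    field_simp
    nlinarith)
  rw [det_mul, det_mul, det_diagonal, one_pow, mul_right_comm, ← Finset.prod_mul_distrib] at h
  have he : ∏ i, (√(A i i))⁻¹ * (√(A i i))⁻¹ = (∏ i, A i i)⁻¹ := by
    rw [← Finset.prod_inv_distrib]
    exact Finset.prod_congr rfl fun i _ => by rw [← mul_inv, Real.mul_self_sqrt (hd i).le]
  rwa [he, inv_mul_le_iff₀ (Finset.prod_pos fun i _ => hd i), mul_one] at h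

/-- The hypothesis bounds the diagonal of `M⁻¹` by `c`, hence its trace, and the
arithmetic-geometric mean inequality for `M⁻¹` bounds its determinant. -/
theorem pow_le_det_of_sq_le_form {M : Matrix ι ι ℝ} (hM : M.PosDef) {c : ℝ} (hc : 0 < c)
    (h : ∀ (v : ι → ℝ) j, v j ^ 2 ≤ c * (v ⬝ᵥ (M *ᵥ v))) : c⁻¹ ^ Fintype.card ι ≤ M.det := by
  have hu : IsUnit M.det := (isUnit_iff_isUnit_det _).1 hM.isUnit
  have hdiag : ∀ j, M⁻¹ j j ≤ c := fun j => by
    rcases le_or_gt (M⁻¹ j j) 0 with h0 | h0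
    · exact h0.trans hc.le
    -- At `v = M⁻¹ e_j`, both `v j` and the form equal `M⁻¹ j j`, so the hypothesis reads `(M⁻¹ j
    -- j)² ≤ c * M⁻¹ j j`.
    have := h (M⁻¹ *ᵥ Pi.single j 1) j
    rw [mulVec_mulVec, mul_nonsing_inv _ hu, one_mulVec, dotProduct_single, mul_one] at this
    simp only [mulVec_single, MulOpposite.op_one, one_smul, col_apply] at this
    nlinarith
  have h1 := det_le_pow_of_trace_le hM.inv.posSemidef hc (by
    rw [trace]
    refine (Finset.sum_le_card_nsmul _ _ c fun i _ => hdiag i).trans_eq ?_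
    simp [mul_comm])
  rw [det_nonsing_inv, Ring.inverse_eq_inv'] at h1
  rw [inv_pow]
  exact inv_le_of_inv_le₀ hM.det_pos h1

/-- The determinant of a ridge matrix is at most a product over the rows of the design. -/
theorem det_one_add_smul_transpose_mul_le {κ : Type*} [Fintype κ] [DecidableEq κ]
    (X : Matrix κ ι ℝ) {t : ℝ} (ht : 0 ≤ t) :
    (1 + t • (Xᵀ * X)).det ≤ ∏ i, (1 + t * (X i ⬝ᵥ X i)) := by
  -- Sylvester's identity passes to the matrix indexed by observations; Hadamard's inequality then
  -- gives one factor per row.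
  have h : (1 + t • (Xᵀ * X)).det = (1 + t • (X * Xᵀ)).det := by
    rw [← Matrix.smul_mul, det_one_add_mul_comm, Matrix.mul_smul]
  rw [h]
  have hp : (1 + t • (X * Xᵀ)).PosDef := PosDef.one.add_posSemidef
    ((posSemidef_self_mul_conjTranspose X).smul ht)
  refine (det_le_prod_diag hp).trans_eq (Finset.prod_congr rfl fun i _ => ?_)
  simp [mul_apply, dotProduct]

/-- Cauchy-Schwarz for the form of `H`, applied to `u` and `H⁻¹ e`. With `e` a unit vector it turns
an upper bound on a diagonal entry of `H⁻¹` into a lower bound on the form. -/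
theorem sq_dotProduct_le_form_mul_inv_form {H : Matrix ι ι ℝ} (hH : H.PosSemidef)
    (hu : IsUnit H.det) (u e : ι → ℝ) :
    (u ⬝ᵥ e) ^ 2 ≤ (u ⬝ᵥ (H *ᵥ u)) * (e ⬝ᵥ (H⁻¹ *ᵥ e)) := by
  set q := H⁻¹ *ᵥ e with hq
  have hHq : H *ᵥ q = e := by rw [hq, mulVec_mulVec, mul_nonsing_inv _ hu, one_mulVec]
  have hsym : Hᵀ = H := by
    have := hH.1
    rwa [IsHermitian, conjTranspose_eq_transpose_of_trivial] at this
  have hqu : q ⬝ᵥ (H *ᵥ u) = u ⬝ᵥ e := by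
    rw [dotProduct_comm, dotProduct_mulVec_transpose, hsym, hHq]
  -- This polynomial is the form of `H` at `u - t q`; its discriminant is nonpositive.
  have key : ∀ t : ℝ, 0 ≤ (e ⬝ᵥ q) * (t * t) + (-2 * (u ⬝ᵥ e)) * t + u ⬝ᵥ (H *ᵥ u) := fun t => by
    have h0 := hH.dotProduct_mulVec_nonneg (u - t • q)
    rw [star_trivial, mulVec_sub, mulVec_smul, hHq, sub_dotProduct, dotProduct_sub, dotProduct_sub,
      smul_dotProduct, smul_dotProduct, hqu, dotProduct_smul, dotProduct_smul,
      dotProduct_comm q e] at h0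
    simp only [smul_eq_mul] at h0
    linarith
  have := discrim_le_zero key
  rw [discrim] at this
  linarith

end Spectral

theorem abs_le_maxAbs {ι κ : Type*} [Finite ι] [Finite κ] (A : Matrix ι κ ℝ) (i : ι) (j : κ) :
    |A i j| ≤ maxAbs A :=
  (le_ciSup (f := fun j => |A i j|) (Set.finite_range _).bddAbove j).trans
    (le_ciSup (f := fun i => ⨆ j, |A i j|) (Set.finite_range _).bddAbove i)

/-! ### The Hessian and the conditioning of the design. -/

section Hessian

variable {n p d : ℕ}

theorem kronecker_mulVec_mul {ι κ : Type*} [Fintype ι] [Fintype κ] (A : Matrix ι ι ℝ)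
    (B : Matrix κ κ ℝ) (x : ι → ℝ) (y : κ → ℝ) :
    (A ⊗ₖ B) *ᵥ (fun e => x e.1 * y e.2) = fun e => (A *ᵥ x) e.1 * (B *ᵥ y) e.2 := by
  ext e
  simp only [mulVec, dotProduct, Fintype.sum_prod_type, kroneckerMap_apply, Finset.sum_mul_sum]
  exact Finset.sum_congr rfl fun _ _ => Finset.sum_congr rfl fun _ _ => by ring

theorem dotProduct_mul_mul {ι κ : Type*} [Fintype ι] [Fintype κ] (x x' : ι → ℝ) (y y' : κ → ℝ) :
    (fun e : ι × κ => x e.1 * y e.2) ⬝ᵥ (fun e => x' e.1 * y' e.2) = (x ⬝ᵥ x') * (y ⬝ᵥ y') := by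
  simp only [dotProduct, Fintype.sum_prod_type, Finset.sum_mul_sum]
  exact Finset.sum_congr rfl fun _ _ => Finset.sum_congr rfl fun _ _ => by ring

theorem gram_transpose {ι κ : Type*} (A : Matrix (Fin n) ι ℝ) (B : Matrix (Fin n) κ ℝ) :
    (gram A B)ᵀ = gram B A := by
  simp [gram, transpose_mul]

/-- The block factor is `Eᵀ Λ⁻¹ E + (2/n) Rᵀ R` with `E = (1, 0)` and `R = (-X Θ Λ⁻¹, X)`. -/
theorem hessian_posSemidef (X : Matrix (Fin n) (Fin d) ℝ) {Λ : Matrix (Fin p) (Fin p) ℝ}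
    (hΛ : Λ.PosDef) (Θ : Matrix (Fin d) (Fin p) ℝ) : (hessian X Λ Θ).PosSemidef := by
  have hs : (Λ⁻¹)ᵀ = Λ⁻¹ := by
    have := hΛ.inv.1
    rwa [IsHermitian, conjTranspose_eq_transpose_of_trivial] at this
  refine PosSemidef.kronecker ?_ hΛ.inv.posSemidef
  set R : Matrix (Fin n) (Fin p ⊕ Fin d) ℝ := fromCols (-(X * Θ * Λ⁻¹)) X with hR
  set E : Matrix (Fin p) (Fin p ⊕ Fin d) ℝ := fromCols 1 0 with hE
  have h1 : (Eᴴ * Λ⁻¹ * E).PosSemidef := hΛ.inv.posSemidef.conjTranspose_mul_mul_same E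
  have h2 : ((2 * (n : ℝ)⁻¹) • (Rᴴ * R)).PosSemidef :=
    (posSemidef_conjTranspose_mul_self R).smul (by positivity)
  refine Eq.subst (motive := Matrix.PosSemidef) ?_ (h1.add h2)
  rw [conjTranspose_eq_transpose_of_trivial, conjTranspose_eq_transpose_of_trivial, hE, hR,
    transpose_fromCols, transpose_fromCols, fromRows_mul, fromRows_mul_fromCols,
    fromRows_mul_fromCols, fromBlocks_smul, fromBlocks_add]
  simp only [transpose_one, transpose_zero, Matrix.one_mul, Matrix.mul_one, Matrix.zero_mul,
    Matrix.mul_zero, zero_add, transpose_neg, transpose_mul, hs, gram, Matrix.neg_mul,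
    Matrix.mul_neg, neg_neg, Matrix.mul_smul, Matrix.smul_mul, smul_smul, smul_neg, neg_mul, neg_smul,
    Matrix.mul_assoc]

/-- A bound on the inverse Hessian makes the Gram matrix of the design well conditioned. -/
theorem sq_le_gram_form {X : Matrix (Fin n) (Fin d) ℝ} {Λ : Matrix (Fin p) (Fin p) ℝ}
    (hΛ : Λ.PosDef) {Θ : Matrix (Fin d) (Fin p) ℝ} (hu : IsUnit (hessian X Λ Θ).det)
    {κ s : ℝ} (hκ : kappaH X Λ Θ ≤ κ) (k : Fin p) (hs : Λ⁻¹ k k ≤ s) (v : Fin d → ℝ)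
    (j : Fin d) : v j ^ 2 ≤ 2 * s * κ * (v ⬝ᵥ (gram X X *ᵥ v)) := by
  have hg : 0 ≤ v ⬝ᵥ (gram X X *ᵥ v) := by
    have : (gram X X).PosSemidef := (posSemidef_conjTranspose_mul_self X).smul (by positivity)
    simpa using this.dotProduct_mulVec_nonneg v
  have hkk : 0 < Λ⁻¹ k k := hΛ.inv.diag_pos
  -- The test vector `(0, v) ⊗ e_k` sees only the `(Θ, Θ)` block, where the form is `2 (vᵀ S_xx v)
  -- Λ⁻¹ k k`; its pairing with the unit vector at `(inr j, k)` is `v j`.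
  have h := sq_dotProduct_le_form_mul_inv_form (hessian_posSemidef X hΛ Θ) hu
    (fun e => Sum.elim (0 : Fin p → ℝ) v e.1 * (Pi.single k 1 : Fin p → ℝ) e.2)
    (Pi.single (Sum.inr j, k) 1)
  rw [dotProduct_single] at h
  simp only [single_dotProduct, mulVec_single, MulOpposite.op_one, one_smul, col_apply,
    Sum.elim_inr, Pi.single_eq_same, mul_one, one_mul] at h
  rw [hessian, kronecker_mulVec_mul, dotProduct_mul_mul, ← hessian, fromBlocks_mulVec] at h
  simp only [Sum.elim_comp_inl, Sum.elim_comp_inr, mulVec_zero, zero_add,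
    sumElim_dotProduct_sumElim, zero_dotProduct, smul_mulVec, dotProduct_smul, smul_eq_mul,
    single_dotProduct, one_mul, mulVec_single, MulOpposite.op_one, one_smul, col_apply,
    mul_zero, zero_add] at h
  have hk0 := (hessian_posSemidef X hΛ Θ).inv.diag_nonneg (i := (Sum.inr j, k))
  have hk : (hessian X Λ Θ)⁻¹ (Sum.inr j, k) (Sum.inr j, k) ≤ κ :=
    (le_abs_self _).trans ((abs_le_maxAbs _ _ _).trans hκ)
  have hκ0 : 0 ≤ κ := (abs_nonneg _).trans ((abs_le_maxAbs _ (Sum.inr j, k) (Sum.inr j, k)).trans hκ)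
  calc v j ^ 2 ≤ _ := h
    _ ≤ 2 * (v ⬝ᵥ (gram X X *ᵥ v)) * Λ⁻¹ k k * κ := by gcongr
    _ ≤ 2 * (v ⬝ᵥ (gram X X *ᵥ v)) * s * κ := by gcongr
    _ = _ := by ring

end Hessian

/-! ### Products of functions of independent observations. -/

section ProductMeasure

theorem lintegral_pi_prod {n : ℕ} {E : Type*} [MeasurableSpace E] (μ : Measure E) [SigmaFinite μ]
    {f : Fin n → E → ℝ≥0∞} (hf : ∀ i, Measurable (f i)) :
    ∫⁻ x : Fin n → E, ∏ i, f i (x i) ∂(Measure.pi fun _ => μ) = ∏ i, ∫⁻ x, f i x ∂μ := by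
  induction n with
  | zero => simp
  | succ n ih =>
    have hm : Measurable fun x : Fin n → E => ∏ i : Fin n, f (Fin.succ i) (x i) :=
      Finset.measurable_prod _ fun i _ => (hf _).comp (measurable_pi_apply i)
    calc
      _ = ∫⁻ x : E × (Fin n → E), f 0 x.1 * ∏ i : Fin n, f (Fin.succ i) (x.2 i)
            ∂(μ.prod (Measure.pi fun _ => μ)) := by
          rw [← ((measurePreserving_piFinSuccAbove (fun _ : Fin (n + 1) => μ) 0).symm).lintegral_comp_emb
            (MeasurableEquiv.measurableEmbedding _)]
          simp_rw [MeasurableEquiv.piFinSuccAbove_symm_apply, Fin.insertNthEquiv,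
            Fin.prod_univ_succ, Fin.insertNth_zero, Equiv.coe_fn_mk, Fin.cons_succ, Fin.cons_zero]
          rfl
      _ = (∫⁻ x, f 0 x ∂μ) * ∏ i : Fin n, ∫⁻ x, f (Fin.succ i) x ∂μ := by
          rw [← ih fun i => hf _]
          exact lintegral_prod_mul (hf 0).aemeasurable hm.aemeasurable
      _ = ∏ i, ∫⁻ x, f i x ∂μ := by rw [Fin.prod_univ_succ]

/-- Markov's inequality for a product of functions of independent variables. -/
theorem pi_measure_le_prod_le {n : ℕ} {E : Type*} [MeasurableSpace E] (μ : Measure E)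
    [SigmaFinite μ] {f : E → ℝ≥0∞} (hf : Measurable f) {a b : ℝ≥0∞} (ha : ∫⁻ x, f x ∂μ ≤ a)
    (hb0 : b ≠ 0) (hb : b ≠ ∞) :
    (Measure.pi fun _ : Fin n => μ) {z | b ≤ ∏ i, f (z i)} ≤ a ^ n / b := by
  have hm : Measurable fun z : Fin n → E => ∏ i, f (z i) :=
    Finset.measurable_prod _ fun i _ => hf.comp (measurable_pi_apply i)
  refine (meas_ge_le_lintegral_div hm.aemeasurable hb0 hb).trans ?_
  rw [lintegral_pi_prod μ fun _ => hf, Finset.prod_const, Finset.card_univ, Fintype.card_fin]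
  gcongr

end ProductMeasure

/-! ### Standard Gaussian vectors and the conditional law. -/

/-- The standard Gaussian law on `ℝ^p`. -/
noncomputable def stdNormal (p : ℕ) : Measure (Fin p → ℝ) :=
  Measure.pi fun _ => ProbabilityTheory.gaussianReal 0 1

instance (p : ℕ) : IsProbabilityMeasure (stdNormal p) := by
  unfold stdNormal; infer_instance

variable {p d : ℕ}

/-- The density of the standard Gaussian law. -/
noncomputable def stdDensity (w : Fin p → ℝ) : ℝ :=
  (√(2 * Real.pi))⁻¹ ^ p * Real.exp (-(w ⬝ᵥ w) / 2)

theorem prod_gaussianPDF (w : Fin p → ℝ) :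
    ∏ i, ProbabilityTheory.gaussianPDF 0 1 (w i) = ENNReal.ofReal (stdDensity w) := by
  simp only [ProbabilityTheory.gaussianPDF]
  rw [← ENNReal.ofReal_prod_of_nonneg fun i _ => ProbabilityTheory.gaussianPDFReal_nonneg _ _ _]
  congr 1
  simp only [ProbabilityTheory.gaussianPDFReal, stdDensity, Finset.prod_mul_distrib,
    ← Real.exp_sum]
  simp [← Finset.sum_div, dotProduct, sq]

theorem stdNormal_eq_withDensity :
    stdNormal p = volume.withDensity fun w => ENNReal.ofReal (stdDensity w) := by
  refine Measure.pi_eq fun s hs => ?_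
  rw [withDensity_apply _ (MeasurableSet.univ_pi hs), ← lintegral_indicator (MeasurableSet.univ_pi hs)]
  -- On a box the density times the indicator factors over the coordinates, and boxes determine the
  -- measure.
  have h : ∀ w : Fin p → ℝ, (Set.univ.pi s).indicator (fun w => ENNReal.ofReal (stdDensity w)) w
      = ∏ i, (s i).indicator (ProbabilityTheory.gaussianPDF 0 1) (w i) := fun w => by
    by_cases hw : w ∈ Set.univ.pi s
    · rw [Set.indicator_of_mem hw, ← prod_gaussianPDF]
      exact Finset.prod_congr rfl fun i _ => (Set.indicator_of_mem (hw i trivial) _).symm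
    · rw [Set.indicator_of_notMem hw]
      simp only [Set.mem_univ_pi, not_forall] at hw
      obtain ⟨i, hi⟩ := hw
      exact (Finset.prod_eq_zero (Finset.mem_univ i) (Set.indicator_of_notMem hi _)).symm
  simp only [h]
  rw [volume_pi, lintegral_pi_prod volume fun i =>
    (ProbabilityTheory.measurable_gaussianPDF 0 1).indicator (hs i)]
  refine Finset.prod_congr rfl fun i _ => ?_
  rw [lintegral_indicator (hs i), ProbabilityTheory.gaussianReal_apply _ one_ne_zero]

theorem measurable_mulVec {ι κ : Type*} [Fintype κ] (M : Matrix ι κ ℝ) :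
    Measurable fun w : κ → ℝ => M *ᵥ w := by
  refine measurable_pi_lambda _ fun i => ?_
  simp only [mulVec, dotProduct]
  fun_prop

theorem measurable_dotProduct {α κ : Type*} [MeasurableSpace α] [Fintype κ] {f g : α → κ → ℝ}
    (hf : Measurable f) (hg : Measurable g) : Measurable fun a => f a ⬝ᵥ g a :=
  Finset.measurable_sum _ fun i _ => (measurable_pi_iff.1 hf i).mul (measurable_pi_iff.1 hg i)

theorem measurable_condMean (Λ : Matrix (Fin p) (Fin p) ℝ) (Θ : Matrix (Fin d) (Fin p) ℝ) :
    Measurable (condMean Λ Θ) := (measurable_mulVec _).neg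

theorem measurable_condDensity_uncurry (Λ : Matrix (Fin p) (Fin p) ℝ)
    (Θ : Matrix (Fin d) (Fin p) ℝ) :
    Measurable fun z : (Fin d → ℝ) × (Fin p → ℝ) => condDensity Λ Θ z.1 z.2 := by
  have h : Measurable fun z : (Fin d → ℝ) × (Fin p → ℝ) => z.2 - condMean Λ Θ z.1 :=
    measurable_snd.sub ((measurable_condMean Λ Θ).comp measurable_fst)
  have h2 : Measurable fun z : (Fin d → ℝ) × (Fin p → ℝ) =>
      (z.2 - condMean Λ Θ z.1) ⬝ᵥ (Λ *ᵥ (z.2 - condMean Λ Θ z.1)) :=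
    measurable_dotProduct h ((measurable_mulVec Λ).comp h)
  unfold condDensity
  refine Measurable.const_mul (Measurable.exp ?_) _
  exact h2.neg.div_const 2

theorem measurable_condDensity (Λ : Matrix (Fin p) (Fin p) ℝ)
    (Θ : Matrix (Fin d) (Fin p) ℝ) (x : Fin d → ℝ) : Measurable (condDensity Λ Θ x) :=
  Measurable.comp (g := fun z : (Fin d → ℝ) × (Fin p → ℝ) => condDensity Λ Θ z.1 z.2)
    (f := fun y => (x, y)) (measurable_condDensity_uncurry Λ Θ) measurable_prodMk_left

/-- The conditional law is the image of the standard Gaussian law under an affine map. -/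
theorem condLaw_eq_map {Λ B C : Matrix (Fin p) (Fin p) ℝ} (hB : Bᵀ = B) (hBB : B * B = Λ)
    (hBC : B * C = 1) (Θ : Matrix (Fin d) (Fin p) ℝ) (x : Fin d → ℝ) :
    condLaw Λ Θ x = (stdNormal p).map fun w => condMean Λ Θ x + C *ᵥ w := by
  have hdet : B.det * C.det = 1 := by rw [← det_mul, hBC, det_one]
  have hC0 : C.det ≠ 0 := right_ne_zero_of_mul_eq_one hdet
  have hmeas : Measurable fun w => condMean Λ Θ x + C *ᵥ w :=
    measurable_const.add (measurable_mulVec C)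
  have hform : ∀ w : Fin p → ℝ, (C *ᵥ w) ⬝ᵥ (Λ *ᵥ (C *ᵥ w)) = w ⬝ᵥ w := fun w => by
    have : Λ *ᵥ (C *ᵥ w) = B *ᵥ w := by
      rw [mulVec_mulVec, ← hBB, Matrix.mul_assoc, hBC, Matrix.mul_one]
    rw [this, dotProduct_comm, dotProduct_mulVec_transpose, hB, mulVec_mulVec, hBC, one_mulVec]
  -- The normalizing factor `√(det Λ) = |det B| = |det C|⁻¹` is the one that cancels the Jacobian of
  -- `w ↦ C w`.
  have hval : ∀ w : Fin p → ℝ, ENNReal.ofReal (condDensity Λ Θ x (condMean Λ Θ x + C *ᵥ w))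
      = ENNReal.ofReal |C.det|⁻¹ * ENNReal.ofReal (stdDensity w) := fun w => by
    rw [← ENNReal.ofReal_mul (by positivity), condDensity, add_sub_cancel_left, hform, stdDensity,
      ← mul_assoc]
    congr 2
    rw [← hBB, det_mul, Real.sqrt_div (mul_self_nonneg _), Real.sqrt_mul_self_eq_abs,
      ← abs_inv, eq_inv_of_mul_eq_one_left hdet, div_eq_mul_inv, inv_pow]
    congr 2
    rw [Real.sqrt_eq_iff_mul_self_eq (by positivity) (by positivity), ← mul_pow,
      Real.mul_self_sqrt (by positivity)]
  ext s hs
  rw [condLaw, withDensity_apply _ hs, Measure.map_apply hmeas hs, stdNormal_eq_withDensity,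
    withDensity_apply _ (hmeas hs), ← lintegral_indicator hs, ← lintegral_indicator (hmeas hs),
    ← lintegral_add_left_eq_self _ (condMean Λ Θ x)]
  set G : (Fin p → ℝ) → ℝ≥0∞ := fun z =>
    s.indicator (fun y => ENNReal.ofReal (condDensity Λ Θ x y)) (condMean Λ Θ x + z) with hG
  have hGm : Measurable G :=
    ((measurable_condDensity Λ Θ x).ennreal_ofReal.indicator hs).comp (measurable_const_add _)
  have hmap := Real.map_matrix_volume_pi_eq_smul_volume_pi hC0
  have h1 : ∫⁻ w, G (toLin' C w) = ENNReal.ofReal |C.det⁻¹| * ∫⁻ z, G z := by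
    rw [← smul_eq_mul, ← lintegral_smul_measure, ← hmap]
    exact (lintegral_map hGm (measurable_mulVec C)).symm
  have h2 : ∀ w, G (toLin' C w) = ENNReal.ofReal |C.det⁻¹| *
      ((fun w => condMean Λ Θ x + C *ᵥ w) ⁻¹' s).indicator
        (fun w => ENNReal.ofReal (stdDensity w)) w := fun w => by
    simp only [hG, toLin'_apply, abs_inv]
    by_cases hw : condMean Λ Θ x + C *ᵥ w ∈ s
    · have hw' : w ∈ (fun w => condMean Λ Θ x + C *ᵥ w) ⁻¹' s := hw
      rw [Set.indicator_of_mem hw, Set.indicator_of_mem hw', hval]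
    · have hw' : w ∉ (fun w => condMean Λ Θ x + C *ᵥ w) ⁻¹' s := hw
      rw [Set.indicator_of_notMem hw, Set.indicator_of_notMem hw', mul_zero]
  simp only [h2] at h1
  rw [lintegral_const_mul' _ _ ENNReal.ofReal_ne_top] at h1
  exact ((ENNReal.mul_right_inj (by simpa using hC0) ENNReal.ofReal_ne_top).1 h1).symm

/-! ### Exponential moments and quadratic moments of Gaussian vectors. -/

section Moments

open ProbabilityTheory

theorem stdNormal_map_eval (k : Fin p) :
    (stdNormal p).map (fun w => w k) = gaussianReal 0 1 :=
  (measurePreserving_eval (fun _ : Fin p => gaussianReal 0 1) k).map_eq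

theorem stdNormal_map_pair {k l : Fin p} (h : k ≠ l) :
    (stdNormal p).map (fun w => (w k, w l)) = (gaussianReal 0 1).prod (gaussianReal 0 1) := by
  have hi : iIndepFun (fun (i : Fin p) (w : Fin p → ℝ) => id (w i)) (stdNormal p) :=
    iIndepFun_pi (X := fun _ => id) fun _ => aemeasurable_id
  have := (indepFun_iff_map_prod_eq_prod_map_map (measurable_pi_apply k).aemeasurable
    (measurable_pi_apply l).aemeasurable).1 (hi.indepFun h)
  simp only [stdNormal_map_eval] at this
  exact this

theorem lintegral_exp_mul_gaussian (s : ℝ) :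
    ∫⁻ y, ENNReal.ofReal (Real.exp (s * y)) ∂(gaussianReal 0 1)
      = ENNReal.ofReal (Real.exp (s ^ 2 / 2)) := by
  rw [← ofReal_integral_eq_lintegral_ofReal (integrable_exp_mul_gaussianReal s)
    (Filter.Eventually.of_forall fun _ => (Real.exp_pos _).le)]
  have := congrFun (mgf_id_gaussianReal (μ := 0) (v := 1)) s
  simp only [mgf, id] at this
  rw [this]
  simp

/-- The integral equals `(1 - 2a)^{-1/2}`, and `sub_log_one_add_le` at `-2a` gives `-log (1 - 2a) ≤
2a + 8a²`. -/
theorem lintegral_exp_mul_sq_gaussian {a : ℝ} (h1 : |a| ≤ 1 / 4) :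
    ∫⁻ y, ENNReal.ofReal (Real.exp (a * y ^ 2)) ∂(gaussianReal 0 1)
      ≤ ENNReal.ofReal (Real.exp (a + 4 * a ^ 2)) := by
  have ha := abs_le.1 h1
  have hb : 0 < 1 / 2 - a := by linarith
  rw [gaussianReal_of_var_ne_zero _ one_ne_zero, lintegral_withDensity_eq_lintegral_mul _
    (measurable_gaussianPDF 0 1) (by fun_prop)]
  have h2 : ∀ y : ℝ, (gaussianPDF 0 1 * fun y => ENNReal.ofReal (Real.exp (a * y ^ 2))) y
      = ENNReal.ofReal ((√(2 * Real.pi))⁻¹ * Real.exp (-(1 / 2 - a) * y ^ 2)) := fun y => by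
    rw [Pi.mul_apply, gaussianPDF, ← ENNReal.ofReal_mul (gaussianPDFReal_nonneg _ _ _),
      gaussianPDFReal, mul_assoc, ← Real.exp_add]
    congr 3
    · simp
    · simp only [sub_zero, NNReal.coe_one, mul_one]; ring
  simp only [h2]
  rw [← ofReal_integral_eq_lintegral_ofReal ((integrable_exp_neg_mul_sq hb).const_mul _)
    (Filter.Eventually.of_forall fun _ => by positivity), integral_const_mul, integral_gaussian]
  refine ENNReal.ofReal_le_ofReal ?_
  rw [← Real.sqrt_inv, ← Real.sqrt_mul (by positivity)]
  have h3 : (2 * Real.pi)⁻¹ * (Real.pi / (1 / 2 - a)) = (1 + -2 * a)⁻¹ := by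
    have := Real.pi_pos.ne'
    have : 1 + -2 * a ≠ 0 := by linarith
    field_simp
    ring
  rw [h3, Real.sqrt_le_left (Real.exp_pos _).le, ← Real.exp_nat_mul]
  have h4 := (sub_log_one_add_le (x := -2 * a) (by linarith)).1
  rw [← Real.log_le_iff_le_exp (inv_pos.2 (by linarith)), Real.log_inv]
  push_cast
  linarith

theorem lintegral_exp_stdNormal (s : ℝ) (k : Fin p) :
    ∫⁻ w, ENNReal.ofReal (Real.exp (s * w k)) ∂(stdNormal p)
      = ENNReal.ofReal (Real.exp (s ^ 2 / 2)) := by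
  rw [← lintegral_exp_mul_gaussian, ← stdNormal_map_eval k, lintegral_map (by fun_prop) (by fun_prop)]

/-- For `k = l` this is a centred chi-square variable. For `k ≠ l`, integrating out one coordinate
leaves `exp (s² y² / 2)`, again the exponential of a squared Gaussian. One bound serves both cases.
-/
theorem lintegral_exp_prod_stdNormal {s : ℝ} (hs : |s| ≤ 1 / 4) (k l : Fin p) :
    ∫⁻ w, ENNReal.ofReal (Real.exp (s * (w k * w l - (1 : Matrix (Fin p) (Fin p) ℝ) k l)))
      ∂(stdNormal p) ≤ ENNReal.ofReal (Real.exp (4 * s ^ 2)) := by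
  by_cases h : k = l
  · subst h
    have h1 : ∀ w : Fin p → ℝ, ENNReal.ofReal (Real.exp (s * (w k * w k -
        (1 : Matrix (Fin p) (Fin p) ℝ) k k))) =
        ENNReal.ofReal (Real.exp (-s)) * ENNReal.ofReal (Real.exp (s * w k ^ 2)) := fun w => by
      rw [← ENNReal.ofReal_mul (Real.exp_pos _).le, ← Real.exp_add, one_apply_eq]
      congr 2; ring
    simp only [h1]
    rw [lintegral_const_mul _ (by fun_prop)]
    have h2 := lintegral_exp_mul_sq_gaussian hs
    rw [← stdNormal_map_eval k, lintegral_map (by fun_prop) (by fun_prop)] at h2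
    calc _ ≤ ENNReal.ofReal (Real.exp (-s)) * ENNReal.ofReal (Real.exp (s + 4 * s ^ 2)) := by gcongr
      _ = _ := by
        rw [← ENNReal.ofReal_mul (Real.exp_pos _).le, ← Real.exp_add]; congr 2; ring
  · rw [one_apply_ne h]
    have h1 : ∫⁻ w, ENNReal.ofReal (Real.exp (s * (w k * w l - 0))) ∂(stdNormal p)
        = ∫⁻ y : ℝ × ℝ, ENNReal.ofReal (Real.exp (s * y.1 * y.2))
          ∂((gaussianReal 0 1).prod (gaussianReal 0 1)) := by
      rw [← stdNormal_map_pair h, lintegral_map (by fun_prop) (by fun_prop)]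
      simp only [sub_zero, mul_assoc]
    rw [h1, lintegral_prod _ (by fun_prop)]
    simp only [lintegral_exp_mul_gaussian]
    have hs2 := abs_le.1 hs
    have hs3 : s ^ 2 ≤ 1 / 16 := by nlinarith
    calc _ = ∫⁻ y, ENNReal.ofReal (Real.exp (s ^ 2 / 2 * y ^ 2)) ∂(gaussianReal 0 1) := by
          refine lintegral_congr fun y => ?_
          congr 2; ring
      _ ≤ _ := lintegral_exp_mul_sq_gaussian (by rw [abs_of_nonneg (by positivity)]; linarith)
      _ ≤ _ := by
          refine ENNReal.ofReal_le_ofReal (Real.exp_le_exp.2 ?_)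
          nlinarith [sq_nonneg s]

theorem integrable_stdNormal_eval (k : Fin p) :
    Integrable (fun w : Fin p → ℝ => w k) (stdNormal p) ∧ ∫ w, w k ∂(stdNormal p) = 0 := by
  have h1 : Integrable (fun y : ℝ => y) (gaussianReal 0 1) :=
    memLp_one_iff_integrable.1 (memLp_id_gaussianReal 1)
  have h2 : ∫ y, y ∂(gaussianReal 0 1) = 0 := integral_id_gaussianReal
  rw [← stdNormal_map_eval k] at h1 h2
  rw [integral_map (measurable_pi_apply k).aemeasurable (by fun_prop)] at h2
  exact ⟨(integrable_map_measure h1.aestronglyMeasurable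
    (measurable_pi_apply k).aemeasurable).1 h1, h2⟩

theorem integrable_stdNormal_eval_mul (k l : Fin p) :
    Integrable (fun w : Fin p → ℝ => w k * w l) (stdNormal p) ∧
      ∫ w, w k * w l ∂(stdNormal p) = (1 : Matrix (Fin p) (Fin p) ℝ) k l := by
  by_cases h : k = l
  · subst h
    have h1 : Integrable (fun y : ℝ => y * y) (gaussianReal 0 1) := by
      simpa only [id, ← sq] using (memLp_id_gaussianReal (μ := 0) (v := 1) 2).integrable_sq
    have h2 : ∫ y, y * y ∂(gaussianReal 0 1) = 1 := by
      have := variance_id_gaussianReal (μ := 0) (v := 1)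
      rw [variance_eq_integral (by fun_prop)] at this
      simpa [integral_id_gaussianReal, ← sq] using this
    rw [← stdNormal_map_eval k] at h1 h2
    rw [integral_map (measurable_pi_apply k).aemeasurable (by fun_prop)] at h2
    rw [one_apply_eq]
    exact ⟨(integrable_map_measure h1.aestronglyMeasurable
    (measurable_pi_apply k).aemeasurable).1 h1, h2⟩
  · have h0 : Integrable (fun y : ℝ => y) (gaussianReal 0 1) :=
      memLp_one_iff_integrable.1 (memLp_id_gaussianReal 1)
    have h1 : Integrable (fun y : ℝ × ℝ => y.1 * y.2) ((gaussianReal 0 1).prod (gaussianReal 0 1)) :=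
      h0.mul_prod h0
    have h2 : ∫ y : ℝ × ℝ, y.1 * y.2 ∂((gaussianReal 0 1).prod (gaussianReal 0 1)) = 0 := by
      rw [integral_prod_mul (fun y : ℝ => y) fun y : ℝ => y, integral_id_gaussianReal, zero_mul]
    rw [← stdNormal_map_pair h] at h1 h2
    rw [integral_map (by fun_prop) (by fun_prop)] at h2
    rw [one_apply_ne h]
    exact ⟨(integrable_map_measure (by fun_prop) (by fun_prop)).1 h1, h2⟩

theorem integrable_stdNormal_form (Q : Matrix (Fin p) (Fin p) ℝ) :
    Integrable (fun w : Fin p → ℝ => w ⬝ᵥ (Q *ᵥ w)) (stdNormal p) ∧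
      ∫ w, w ⬝ᵥ (Q *ᵥ w) ∂(stdNormal p) = Q.trace := by
  have he : ∀ w : Fin p → ℝ, w ⬝ᵥ (Q *ᵥ w) = ∑ k, ∑ l, Q k l * (w k * w l) := fun w => by
    simp only [dotProduct, mulVec, Finset.mul_sum]
    exact Finset.sum_congr rfl fun _ _ => Finset.sum_congr rfl fun _ _ => by ring
  have hi : ∀ k l, Integrable (fun w : Fin p → ℝ => Q k l * (w k * w l)) (stdNormal p) :=
    fun k l => (integrable_stdNormal_eval_mul k l).1.const_mul _
  simp only [he]
  refine ⟨integrable_finsetSum _ fun k _ => integrable_finsetSum _ fun l _ => hi k l, ?_⟩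
  rw [integral_finsetSum _ fun k _ => integrable_finsetSum _ fun l _ => hi k l]
  refine Finset.sum_congr rfl fun k _ => ?_
  rw [integral_finsetSum _ fun l _ => hi k l]
  simp only [integral_const_mul, (integrable_stdNormal_eval_mul _ _).2, one_apply, mul_ite,
    mul_one, mul_zero, Finset.sum_ite_eq, Finset.mem_univ, if_true, diag_apply]

theorem integrable_stdNormal_linear (b : Fin p → ℝ) :
    Integrable (fun w : Fin p → ℝ => b ⬝ᵥ w) (stdNormal p) ∧
      ∫ w, b ⬝ᵥ w ∂(stdNormal p) = 0 := by
  have hi : ∀ k, Integrable (fun w : Fin p → ℝ => b k * w k) (stdNormal p) :=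
    fun k => (integrable_stdNormal_eval k).1.const_mul _
  simp only [dotProduct]
  refine ⟨integrable_finsetSum _ fun k _ => hi k, ?_⟩
  rw [integral_finsetSum _ fun k _ => hi k]
  simp only [integral_const_mul, (integrable_stdNormal_eval _).2, mul_zero, Finset.sum_const_zero]

theorem integrable_stdNormal_affine_form (a : Fin p → ℝ) (C M : Matrix (Fin p) (Fin p) ℝ) :
    Integrable (fun w : Fin p → ℝ => (a + C *ᵥ w) ⬝ᵥ (M *ᵥ (a + C *ᵥ w))) (stdNormal p) ∧
      ∫ w, (a + C *ᵥ w) ⬝ᵥ (M *ᵥ (a + C *ᵥ w)) ∂(stdNormal p)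
        = a ⬝ᵥ (M *ᵥ a) + (Cᵀ * M * C).trace := by
  have he : ∀ w : Fin p → ℝ, (a + C *ᵥ w) ⬝ᵥ (M *ᵥ (a + C *ᵥ w)) =
      a ⬝ᵥ (M *ᵥ a) + (Cᵀ *ᵥ (M *ᵥ a) + Cᵀ *ᵥ (Mᵀ *ᵥ a)) ⬝ᵥ w + w ⬝ᵥ ((Cᵀ * M * C) *ᵥ w) :=
    fun w => by
    have e1 : (Cᵀ *ᵥ (M *ᵥ a)) ⬝ᵥ w = (C *ᵥ w) ⬝ᵥ (M *ᵥ a) := by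
      rw [dotProduct_mulVec_transpose, transpose_transpose, dotProduct_comm]
    have e2 : (Cᵀ *ᵥ (Mᵀ *ᵥ a)) ⬝ᵥ w = a ⬝ᵥ (M *ᵥ (C *ᵥ w)) := by
      rw [dotProduct_mulVec_transpose, transpose_transpose, dotProduct_mulVec_transpose,
        transpose_transpose]
    rw [← mulVec_mulVec, ← mulVec_mulVec, ← dotProduct_mulVec_transpose C, mulVec_add,
      dotProduct_add, add_dotProduct, add_dotProduct, add_dotProduct, e1, e2]
    ring
  have hi := ((integrable_const (a ⬝ᵥ (M *ᵥ a))).add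
    (integrable_stdNormal_linear (Cᵀ *ᵥ (M *ᵥ a) + Cᵀ *ᵥ (Mᵀ *ᵥ a))).1)
  simp only [he]
  refine ⟨hi.add (integrable_stdNormal_form _).1, ?_⟩
  refine (integral_add hi (integrable_stdNormal_form _).1).trans ?_
  rw [(integrable_stdNormal_form _).2, integral_add' (integrable_const _)
    (integrable_stdNormal_linear _).1, (integrable_stdNormal_linear _).2]
  simp

end Moments

/-! ### The divergence between two conditional normal laws. -/

section KullbackLeibler

variable {p d : ℕ}

theorem exists_sqrt_of_posDef {ι : Type*} [Fintype ι] [DecidableEq ι] {A : Matrix ι ι ℝ}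
    (hA : A.PosDef) : ∃ B C : Matrix ι ι ℝ, Bᵀ = B ∧ Cᵀ = C ∧ B * B = A ∧ B * C = 1 ∧ C * B = 1 := by
  obtain ⟨a, ha, hle⟩ : ∃ a : ℝ, 0 < a ∧ ∀ i, a ≤ hA.1.eigenvalues i := by
    rcases isEmpty_or_nonempty ι with h | h
    · exact ⟨1, one_pos, fun i => isEmptyElim i⟩
    · obtain ⟨i, hi⟩ := Finite.exists_min hA.1.eigenvalues
      exact ⟨_, hA.eigenvalues_pos i, hi⟩
  obtain ⟨b, hb⟩ := (Set.finite_range hA.1.eigenvalues).bddAbove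
  obtain ⟨B, C, h1, h2, h3, h4, h5, -, -⟩ :=
    exists_sqrt hA.1 ha fun i => ⟨hle i, hb (Set.mem_range_self i)⟩
  exact ⟨B, C, h1, h2, h3, h4, h5⟩

theorem inv_eq_of_sqrt {ι : Type*} [Fintype ι] [DecidableEq ι] {A B C : Matrix ι ι ℝ}
    (hBB : B * B = A) (hBC : B * C = 1) : A⁻¹ = C * C := by
  refine inv_eq_right_inv ?_
  rw [← hBB, Matrix.mul_assoc, ← Matrix.mul_assoc B C, hBC, Matrix.one_mul, hBC]

theorem isProbabilityMeasure_condLaw {Λ : Matrix (Fin p) (Fin p) ℝ} (hΛ : Λ.PosDef)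
    (Θ : Matrix (Fin d) (Fin p) ℝ) (x : Fin d → ℝ) : IsProbabilityMeasure (condLaw Λ Θ x) := by
  obtain ⟨B, C, hB, -, hBB, hBC, -⟩ := exists_sqrt_of_posDef hΛ
  rw [condLaw_eq_map hB hBB hBC]
  exact Measure.isProbabilityMeasure_map
    (measurable_const.add (measurable_mulVec C)).aemeasurable

theorem condDensity_pos {Λ : Matrix (Fin p) (Fin p) ℝ} (hΛ : Λ.PosDef)
    (Θ : Matrix (Fin d) (Fin p) ℝ) (x : Fin d → ℝ) (y : Fin p → ℝ) : 0 < condDensity Λ Θ x y := by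
  have := hΛ.det_pos
  unfold condDensity
  positivity

theorem log_condDensity {Λ : Matrix (Fin p) (Fin p) ℝ} (hΛ : Λ.PosDef)
    (Θ : Matrix (Fin d) (Fin p) ℝ) (x : Fin d → ℝ) (y : Fin p → ℝ) :
    Real.log (condDensity Λ Θ x y) = 1 / 2 * (Real.log Λ.det - Real.log ((2 * Real.pi) ^ p)
      - (y - condMean Λ Θ x) ⬝ᵥ (Λ *ᵥ (y - condMean Λ Θ x))) := by
  have h1 := hΛ.det_pos
  have h2 : (0 : ℝ) < (2 * Real.pi) ^ p := by positivity
  rw [condDensity, Real.log_mul (by positivity) (Real.exp_pos _).ne', Real.log_exp,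
    Real.log_sqrt (by positivity), Real.log_div h1.ne' h2.ne']
  ring

/-- Both densities are positive everywhere, so the first law has the quotient of densities as its
density with respect to the second. -/
theorem llr_condLaw {Λ₁ Λ₂ : Matrix (Fin p) (Fin p) ℝ} (h₁ : Λ₁.PosDef) (h₂ : Λ₂.PosDef)
    (Θ₁ Θ₂ : Matrix (Fin d) (Fin p) ℝ) (x : Fin d → ℝ) :
    condLaw Λ₁ Θ₁ x ≪ condLaw Λ₂ Θ₂ x ∧
    llr (condLaw Λ₁ Θ₁ x) (condLaw Λ₂ Θ₂ x) =ᵐ[condLaw Λ₁ Θ₁ x]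
      fun y => Real.log (condDensity Λ₁ Θ₁ x y) - Real.log (condDensity Λ₂ Θ₂ x y) := by
  have := isProbabilityMeasure_condLaw h₂ Θ₂ x
  have hm₁ := measurable_condDensity Λ₁ Θ₁ x
  have hm₂ := measurable_condDensity Λ₂ Θ₂ x
  have hq : Measurable fun y =>
      ENNReal.ofReal (condDensity Λ₁ Θ₁ x y / condDensity Λ₂ Θ₂ x y) :=
    (hm₁.div hm₂).ennreal_ofReal
  have heq : condLaw Λ₁ Θ₁ x = (condLaw Λ₂ Θ₂ x).withDensity
      fun y => ENNReal.ofReal (condDensity Λ₁ Θ₁ x y / condDensity Λ₂ Θ₂ x y) := by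
    rw [condLaw, condLaw, ← withDensity_mul _ hm₂.ennreal_ofReal hq]
    congr 1
    ext y
    rw [Pi.mul_apply, ← ENNReal.ofReal_mul (condDensity_pos h₂ _ _ _).le,
      mul_div_cancel₀ _ (condDensity_pos h₂ _ _ _).ne']
  have hac : condLaw Λ₁ Θ₁ x ≪ condLaw Λ₂ Θ₂ x := by
    rw [heq]; exact withDensity_absolutelyContinuous _ _
  refine ⟨hac, ?_⟩
  have hrn := Measure.rnDeriv_withDensity (condLaw Λ₂ Θ₂ x) hq
  have hrn' : (condLaw Λ₁ Θ₁ x).rnDeriv (condLaw Λ₂ Θ₂ x) =ᵐ[condLaw Λ₂ Θ₂ x]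
      fun y => ENNReal.ofReal (condDensity Λ₁ Θ₁ x y / condDensity Λ₂ Θ₂ x y) := by
    conv_lhs => rw [heq]
    exact hrn
  filter_upwards [hac.ae_le hrn'] with y hy
  rw [llr, hy, ENNReal.toReal_ofReal (div_nonneg (condDensity_pos h₁ _ _ _).le
    (condDensity_pos h₂ _ _ _).le), Real.log_div (condDensity_pos h₁ _ _ _).ne'
    (condDensity_pos h₂ _ _ _).ne']

/-- The Kullback-Leibler divergence between two conditional normal laws. -/
theorem klDiv_condLaw {Λ₁ Λ₂ : Matrix (Fin p) (Fin p) ℝ} (h₁ : Λ₁.PosDef) (h₂ : Λ₂.PosDef)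
    (Θ₁ Θ₂ : Matrix (Fin d) (Fin p) ℝ) (x : Fin d → ℝ) :
    InformationTheory.klDiv (condLaw Λ₁ Θ₁ x) (condLaw Λ₂ Θ₂ x) =
      ENNReal.ofReal (1 / 2 * (Real.log Λ₁.det - Real.log Λ₂.det +
        (condMean Λ₁ Θ₁ x - condMean Λ₂ Θ₂ x) ⬝ᵥ (Λ₂ *ᵥ (condMean Λ₁ Θ₁ x - condMean Λ₂ Θ₂ x)) +
        (Λ₂ * Λ₁⁻¹).trace - p)) := by
  obtain ⟨B, C, hB, hC, hBB, hBC, hCB⟩ := exists_sqrt_of_posDef h₁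
  have hP₁ := isProbabilityMeasure_condLaw h₁ Θ₁ x
  have hP₂ := isProbabilityMeasure_condLaw h₂ Θ₂ x
  obtain ⟨hac, hllr⟩ := llr_condLaw h₁ h₂ Θ₁ Θ₂ x
  set μ₁ := condMean Λ₁ Θ₁ x with hμ₁
  set μ₂ := condMean Λ₂ Θ₂ x with hμ₂
  have hmap := condLaw_eq_map hB hBB hBC Θ₁ x
  have hmeas : Measurable fun w => μ₁ + C *ᵥ w := measurable_const.add (measurable_mulVec C)
  set D : (Fin p → ℝ) → ℝ := fun y =>
    Real.log (condDensity Λ₁ Θ₁ x y) - Real.log (condDensity Λ₂ Θ₂ x y) with hD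
  have hDm : Measurable D :=
    (measurable_condDensity _ _ _).log.sub (measurable_condDensity _ _ _).log
  -- In the coordinate `w` of the first law, the log ratio is a difference of quadratic forms. The
  -- summand `0` puts the second form in the shape of `integrable_stdNormal_affine_form`.
  have hDw : ∀ w : Fin p → ℝ, D (μ₁ + C *ᵥ w) = 1 / 2 * ((Real.log Λ₁.det - Real.log Λ₂.det) +
      ((μ₁ - μ₂ + C *ᵥ w) ⬝ᵥ (Λ₂ *ᵥ (μ₁ - μ₂ + C *ᵥ w))
        - (0 + C *ᵥ w) ⬝ᵥ (Λ₁ *ᵥ (0 + C *ᵥ w)))) := fun w => by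
    simp only [hD]
    rw [log_condDensity h₁, log_condDensity h₂, ← hμ₁, ← hμ₂, add_sub_cancel_left, zero_add,
      add_sub_right_comm]
    ring
  obtain ⟨hi₂, he₂⟩ := integrable_stdNormal_affine_form (μ₁ - μ₂) C Λ₂
  obtain ⟨hi₁, he₁⟩ := integrable_stdNormal_affine_form 0 C Λ₁
  have ht₁ : (Cᵀ * Λ₁ * C).trace = p := by
    rw [hC, ← hBB, Matrix.mul_assoc, Matrix.mul_assoc B, hBC, Matrix.mul_one, hCB]
    simp
  have ht₂ : (Cᵀ * Λ₂ * C).trace = (Λ₂ * Λ₁⁻¹).trace := by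
    rw [hC, trace_mul_comm, ← Matrix.mul_assoc, inv_eq_of_sqrt hBB hBC, trace_mul_comm]
  have hint : Integrable (fun w => D (μ₁ + C *ᵥ w)) (stdNormal p) := by
    simp only [hDw]
    exact ((integrable_const _).add (hi₂.sub hi₁)).const_mul _
  have hval : ∫ w, D (μ₁ + C *ᵥ w) ∂(stdNormal p) = 1 / 2 * (Real.log Λ₁.det - Real.log Λ₂.det +
        (μ₁ - μ₂) ⬝ᵥ (Λ₂ *ᵥ (μ₁ - μ₂)) + (Λ₂ * Λ₁⁻¹).trace - p) := by
    simp only [hDw]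
    rw [integral_const_mul, integral_add (integrable_const _) (by exact hi₂.sub hi₁),
      integral_sub hi₂ hi₁, he₁, he₂, ht₁, ht₂]
    simp
    ring
  have hD1 : Integrable D (condLaw Λ₁ Θ₁ x) := by
    rw [hmap]
    exact (integrable_map_measure hDm.aestronglyMeasurable hmeas.aemeasurable).2 hint
  -- The general formula also contains the difference of the total masses, which vanishes for
  -- probability measures.
  rw [InformationTheory.klDiv_of_ac_of_integrable hac (hD1.congr hllr.symm),
    integral_congr_ae hllr, hmap, integral_map hmeas.aemeasurable hDm.aestronglyMeasurable, hval,
    ← hmap]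
  simp [hμ₁, hμ₂]

end KullbackLeibler

/-! ### The law of the sample and Chernoff's bound. -/

section SampleLaw

variable {n p d : ℕ}

theorem isProbabilityMeasure_law {f : (Fin d → ℝ) → ℝ} (hf : IsDensity f) :
    IsProbabilityMeasure (law f) :=
  ⟨by rw [law, withDensity_apply _ MeasurableSet.univ, Measure.restrict_univ]; exact hf.2.2⟩

/-- The whitened noise of an observation. -/
noncomputable def whiteNoise (B Λ : Matrix (Fin p) (Fin p) ℝ) (Θ : Matrix (Fin d) (Fin p) ℝ)
    (z : (Fin d → ℝ) × (Fin p → ℝ)) : Fin p → ℝ :=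
  B *ᵥ (z.2 - condMean Λ Θ z.1)

theorem measurable_whiteNoise (B Λ : Matrix (Fin p) (Fin p) ℝ) (Θ : Matrix (Fin d) (Fin p) ℝ) :
    Measurable (whiteNoise B Λ Θ) :=
  (measurable_mulVec B).comp (measurable_snd.sub ((measurable_condMean Λ Θ).comp measurable_fst))

/-- The covariate is independent of the whitened noise, which is standard Gaussian. -/
theorem lintegral_jointLaw_whiteNoise {f : (Fin d → ℝ) → ℝ} (hf : IsDensity f)
    {Λ B C : Matrix (Fin p) (Fin p) ℝ} (hB : Bᵀ = B) (hBB : B * B = Λ) (hBC : B * C = 1)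
    (Θ : Matrix (Fin d) (Fin p) ℝ) {F : (Fin d → ℝ) × (Fin p → ℝ) → ℝ≥0∞} (hF : Measurable F) :
    ∫⁻ z, F (z.1, whiteNoise B Λ Θ z) ∂(jointLaw f Λ Θ) =
      ∫⁻ x, ∫⁻ w, F (x, w) ∂(stdNormal p) ∂(law f) := by
  have hfm : Measurable fun z : (Fin d → ℝ) × (Fin p → ℝ) => f z.1 := hf.1.comp measurable_fst
  have hcm := measurable_condDensity_uncurry Λ Θ
  have hprod : Measurable fun z : (Fin d → ℝ) × (Fin p → ℝ) =>
      ENNReal.ofReal (f z.1 * condDensity Λ Θ z.1 z.2) := (hfm.mul hcm).ennreal_ofReal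
  have hG : Measurable fun z : (Fin d → ℝ) × (Fin p → ℝ) => F (z.1, whiteNoise B Λ Θ z) :=
    hF.comp (measurable_fst.prodMk (measurable_whiteNoise B Λ Θ))
  rw [jointLaw, lintegral_withDensity_eq_lintegral_mul _ hprod hG,
    Measure.volume_eq_prod, lintegral_prod _ (hprod.mul hG).aemeasurable,
    law, lintegral_withDensity_eq_lintegral_mul _ hf.1.ennreal_ofReal
      (hF.lintegral_prod_right')]
  refine lintegral_congr fun x => ?_
  have hGx : Measurable fun y => F (x, whiteNoise B Λ Θ (x, y)) := hG.comp measurable_prodMk_left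
  have hc := (measurable_condDensity Λ Θ x).ennreal_ofReal
  calc _ = ∫⁻ y, ENNReal.ofReal (f x) * (ENNReal.ofReal (condDensity Λ Θ x y) *
        F (x, whiteNoise B Λ Θ (x, y))) := by
        refine lintegral_congr fun y => ?_
        rw [Pi.mul_apply, ENNReal.ofReal_mul (hf.2.1 x), mul_assoc]
    _ = ENNReal.ofReal (f x) * ∫⁻ y, F (x, whiteNoise B Λ Θ (x, y)) ∂(condLaw Λ Θ x) := by
        rw [lintegral_const_mul _ (by exact hc.mul hGx), condLaw,
          lintegral_withDensity_eq_lintegral_mul _ hc hGx]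
        rfl
    _ = _ := by
        rw [condLaw_eq_map hB hBB hBC, lintegral_map hGx
          (by exact measurable_const.add (measurable_mulVec C))]
        simp only [whiteNoise, add_sub_cancel_left, mulVec_mulVec, hBC, one_mulVec]
        rfl

theorem isProbabilityMeasure_jointLaw {f : (Fin d → ℝ) → ℝ} (hf : IsDensity f)
    {Λ : Matrix (Fin p) (Fin p) ℝ} (hΛ : Λ.PosDef) (Θ : Matrix (Fin d) (Fin p) ℝ) :
    IsProbabilityMeasure (jointLaw f Λ Θ) := by
  obtain ⟨B, C, hB, -, hBB, hBC, -⟩ := exists_sqrt_of_posDef hΛ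
  have := isProbabilityMeasure_law hf
  have h := lintegral_jointLaw_whiteNoise hf hB hBB hBC Θ (F := fun _ => 1) measurable_const
  exact ⟨by simpa using h⟩

/-- Chernoff's bound for a sum over an i.i.d. sample. -/
theorem pi_measure_le_sum_le {E : Type*} [MeasurableSpace E] (μ : Measure E) [SigmaFinite μ]
    {h : E → ℝ} (hh : Measurable h) {a : ℝ}
    (ha : ∫⁻ x, ENNReal.ofReal (Real.exp (h x)) ∂μ ≤ ENNReal.ofReal (Real.exp a)) (t : ℝ) :
    (Measure.pi fun _ : Fin n => μ) {z | t ≤ ∑ i, h (z i)} ≤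
      ENNReal.ofReal (Real.exp (n * a - t)) := by
  have h1 := pi_measure_le_prod_le (n := n) μ hh.exp.ennreal_ofReal ha
    (b := ENNReal.ofReal (Real.exp t)) (by simp [Real.exp_pos]) ENNReal.ofReal_ne_top
  refine (measure_mono fun z hz => ?_).trans (h1.trans_eq ?_)
  · simp only [Set.mem_ofPred_eq] at hz ⊢
    rw [← ENNReal.ofReal_prod_of_nonneg fun i _ => (Real.exp_pos _).le, ← Real.exp_sum]
    exact ENNReal.ofReal_le_ofReal (Real.exp_le_exp.2 hz)
  · rw [← ENNReal.ofReal_pow (Real.exp_pos _).le, ← ENNReal.ofReal_div_of_pos (Real.exp_pos _),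
      ← Real.exp_nat_mul, Real.exp_sub]

theorem measurableSet_le_sum {E : Type*} [MeasurableSpace E] {h : E → ℝ} (hh : Measurable h)
    (t : ℝ) : MeasurableSet {z : Fin n → E | t ≤ ∑ i, h (z i)} :=
  measurableSet_le measurable_const
    (Finset.measurable_sum _ fun i _ => hh.comp (measurable_pi_apply i))

end SampleLaw

/-! ### Tail bounds for the noise and for the design. -/

section Tails

variable {n p d : ℕ}

/-- A union of finitely many Chernoff bounds. -/
theorem exists_measurableSet_forall_sum_lt {ι E : Type*} [Fintype ι] [MeasurableSpace E]
    (μ : Measure E) [SigmaFinite μ] {h : ι → E → ℝ} (hh : ∀ e, Measurable (h e)) {a : ℝ}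
    (ha : ∀ e, ∫⁻ x, ENNReal.ofReal (Real.exp (h e x)) ∂μ ≤ ENNReal.ofReal (Real.exp a)) (t : ℝ) :
    ∃ bad : Set (Fin n → E), MeasurableSet bad ∧
      (Measure.pi fun _ : Fin n => μ) bad ≤
        ENNReal.ofReal (Fintype.card ι * Real.exp (n * a - t)) ∧
      ∀ z ∉ bad, ∀ e, ∑ i, h e (z i) < t := by
  refine ⟨⋃ e, {z | t ≤ ∑ i, h e (z i)},
    MeasurableSet.iUnion fun e => measurableSet_le_sum (hh e) t, ?_, ?_⟩
  · refine (measure_iUnion_fintype_le _ _).trans ?_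
    refine (Finset.sum_le_sum fun e _ => pi_measure_le_sum_le μ (hh e) (ha e) t).trans_eq ?_
    rw [Finset.sum_const, Finset.card_univ, nsmul_eq_mul, ENNReal.ofReal_mul (Nat.cast_nonneg _),
      ENNReal.ofReal_natCast]
  · intro z hz e
    simp only [Set.mem_iUnion, not_exists] at hz
    exact not_le.1 (hz e)

/-- The sign attached to a Boolean. -/
def boolSign (b : Bool) : ℝ := if b then 1 else -1

theorem abs_lt_of_boolSign {x t : ℝ} (h : ∀ b, boolSign b * x < t) : |x| < t := by
  have h1 := h true
  have h2 := h false
  simp only [boolSign, if_true, one_mul, Bool.false_eq_true, if_false] at h1 h2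
  exact abs_lt.2 ⟨by linarith, by linarith⟩

theorem boolSign_sq (b : Bool) : boolSign b ^ 2 = 1 := by
  cases b <;> simp [boolSign]

theorem abs_boolSign (b : Bool) : |boolSign b| = 1 := by
  cases b <;> simp [boolSign]

variable {f : (Fin d → ℝ) → ℝ} {Λ B C : Matrix (Fin p) (Fin p) ℝ}

/-- A self-normalized tail bound for the cross products of the covariates and the noise. -/
theorem exists_cross_tail (n : ℕ) (hf : IsDensity f) (hΛ : Λ.PosDef) (hB : Bᵀ = B)
    (hBB : B * B = Λ) (hBC : B * C = 1) (Θ : Matrix (Fin d) (Fin p) ℝ) (r t : ℝ) :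
    ∃ bad : Set (Fin n → (Fin d → ℝ) × (Fin p → ℝ)), MeasurableSet bad ∧
      sampleLaw n f Λ Θ bad ≤ ENNReal.ofReal (2 * (d * p) * Real.exp (-t)) ∧
      ∀ z ∉ bad, ∀ j k, |r * ∑ i, (z i).1 j * whiteNoise B Λ Θ (z i) k| <
        t + r ^ 2 / 2 * ∑ i, (z i).1 j ^ 2 := by
  have := isProbabilityMeasure_jointLaw hf hΛ Θ
  have := isProbabilityMeasure_law hf
  have hwm : ∀ k, Measurable fun z : (Fin d → ℝ) × (Fin p → ℝ) => whiteNoise B Λ Θ z k :=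
    fun k => (measurable_pi_apply k).comp (measurable_whiteNoise B Λ Θ)
  have hxm : ∀ j, Measurable fun z : (Fin d → ℝ) × (Fin p → ℝ) => z.1 j :=
    fun j => (measurable_pi_apply j).comp measurable_fst
  -- Given `x`, the subtracted term `r² x_j² / 2` is the exact log moment generating function of the
  -- Gaussian term. The exponential therefore has mean `1`, whence `a = 0`, with no moment condition
  -- on `X`. The Boolean index covers both signs.
  obtain ⟨bad, h1, h2, h3⟩ := exists_measurableSet_forall_sum_lt (n := n) (jointLaw f Λ Θ)
    (h := fun (e : Fin d × Fin p × Bool) z => boolSign e.2.2 * (r * (z.1 e.1 *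
      whiteNoise B Λ Θ z e.2.1)) - r ^ 2 / 2 * z.1 e.1 ^ 2) (a := 0)
    (fun e => ((((hxm _).mul (hwm _)).const_mul _).const_mul _).sub
      (((hxm _).pow_const 2).const_mul _)) (fun e => by
      have hF : Measurable fun q : (Fin d → ℝ) × (Fin p → ℝ) => ENNReal.ofReal (Real.exp
          (boolSign e.2.2 * (r * (q.1 e.1 * q.2 e.2.1)) - r ^ 2 / 2 * q.1 e.1 ^ 2)) := by
        fun_prop
      rw [lintegral_jointLaw_whiteNoise hf hB hBB hBC Θ hF]
      have hx : ∀ x : Fin d → ℝ, ∫⁻ w : Fin p → ℝ, ENNReal.ofReal (Real.exp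
          (boolSign e.2.2 * (r * (x e.1 * w e.2.1)) - r ^ 2 / 2 * x e.1 ^ 2)) ∂(stdNormal p) = 1 := by
        intro x
        have hw : ∀ w : Fin p → ℝ, ENNReal.ofReal (Real.exp
            (boolSign e.2.2 * (r * (x e.1 * w e.2.1)) - r ^ 2 / 2 * x e.1 ^ 2)) =
            ENNReal.ofReal (Real.exp (-(r ^ 2 / 2 * x e.1 ^ 2))) *
              ENNReal.ofReal (Real.exp (boolSign e.2.2 * r * x e.1 * w e.2.1)) := fun w => by
          rw [← ENNReal.ofReal_mul (Real.exp_pos _).le, ← Real.exp_add]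
          congr 2; ring
        simp only [hw]
        rw [lintegral_const_mul _ (by fun_prop), lintegral_exp_stdNormal,
          ← ENNReal.ofReal_mul (Real.exp_pos _).le, ← Real.exp_add, mul_pow, mul_pow, boolSign_sq]
        ring_nf
        simp
      simp only [hx]
      simp) t
  refine ⟨bad, h1, h2.trans_eq ?_, fun z hz j k => abs_lt_of_boolSign fun b => ?_⟩
  · simp only [Fintype.card_prod, Fintype.card_fin, Fintype.card_bool]
    push_cast
    ring_nf
  · have := h3 z hz (j, k, b)
    simp only [Finset.sum_sub_distrib, ← Finset.mul_sum] at this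
    linarith

/-- A tail bound for the empirical second moments of the noise. -/
theorem exists_gram_tail (n : ℕ) (hf : IsDensity f) (hΛ : Λ.PosDef) (hB : Bᵀ = B)
    (hBB : B * B = Λ) (hBC : B * C = 1) (Θ : Matrix (Fin d) (Fin p) ℝ) {s : ℝ}
    (hs : |s| ≤ 1 / 4) (t : ℝ) :
    ∃ bad : Set (Fin n → (Fin d → ℝ) × (Fin p → ℝ)), MeasurableSet bad ∧
      sampleLaw n f Λ Θ bad ≤
        ENNReal.ofReal (2 * (p * p) * Real.exp (n * (4 * s ^ 2) - t)) ∧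
      ∀ z ∉ bad, ∀ k l, |s * ∑ i, (whiteNoise B Λ Θ (z i) k * whiteNoise B Λ Θ (z i) l -
        (1 : Matrix (Fin p) (Fin p) ℝ) k l)| < t := by
  have := isProbabilityMeasure_jointLaw hf hΛ Θ
  have := isProbabilityMeasure_law hf
  have hwm : ∀ k, Measurable fun z : (Fin d → ℝ) × (Fin p → ℝ) => whiteNoise B Λ Θ z k :=
    fun k => (measurable_pi_apply k).comp (measurable_whiteNoise B Λ Θ)
  obtain ⟨bad, h1, h2, h3⟩ := exists_measurableSet_forall_sum_lt (n := n) (jointLaw f Λ Θ)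
    (h := fun (e : Fin p × Fin p × Bool) z => boolSign e.2.2 * (s * (whiteNoise B Λ Θ z e.1 *
      whiteNoise B Λ Θ z e.2.1 - (1 : Matrix (Fin p) (Fin p) ℝ) e.1 e.2.1))) (a := 4 * s ^ 2)
    (fun e => ((((hwm _).mul (hwm _)).sub_const _).const_mul _).const_mul _) (fun e => by
      have hF : Measurable fun q : (Fin d → ℝ) × (Fin p → ℝ) => ENNReal.ofReal (Real.exp
          (boolSign e.2.2 * (s * (q.2 e.1 * q.2 e.2.1 -
            (1 : Matrix (Fin p) (Fin p) ℝ) e.1 e.2.1)))) := by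
        fun_prop
      rw [lintegral_jointLaw_whiteNoise hf hB hBB hBC Θ hF]
      have := lintegral_exp_prod_stdNormal (p := p) (s := boolSign e.2.2 * s)
        (by rw [abs_mul, abs_boolSign, one_mul]; exact hs) e.1 e.2.1
      simp only [mul_pow, boolSign_sq, one_mul, mul_assoc] at this
      exact (lintegral_mono fun _ => this).trans (by simp)) t
  refine ⟨bad, h1, h2.trans_eq ?_, fun z hz k l => abs_lt_of_boolSign fun b => ?_⟩
  · simp only [Fintype.card_prod, Fintype.card_fin, Fintype.card_bool]
    push_cast
    ring_nf
  · have := h3 z hz (k, l, b)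
    simp only [← Finset.mul_sum] at this
    exact this

theorem dotProduct_self_nonneg' {ι : Type*} [Fintype ι] (v : ι → ℝ) : 0 ≤ v ⬝ᵥ v :=
  Finset.sum_nonneg fun _ _ => mul_self_nonneg _

/-- A tail bound for a product over the rows of the design. -/
theorem exists_design_tail (n : ℕ) (hf : IsDensity f) (hΛ : Λ.PosDef)
    (Θ : Matrix (Fin d) (Fin p) ℝ) {m : ℝ} (hm : 0 ≤ m) (hfm : secondMoment f ≤ ENNReal.ofReal m)
    {s : ℝ} (hs : 0 ≤ s) (t : ℝ) :
    ∃ bad : Set (Fin n → (Fin d → ℝ) × (Fin p → ℝ)), MeasurableSet bad ∧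
      sampleLaw n f Λ Θ bad ≤ ENNReal.ofReal (Real.exp (n * (s * m) - t)) ∧
      ∀ z ∉ bad, ∏ i, (1 + s * ((z i).1 ⬝ᵥ (z i).1)) < Real.exp t := by
  have := isProbabilityMeasure_jointLaw hf hΛ Θ
  have := isProbabilityMeasure_law hf
  obtain ⟨B, C, hB, -, hBB, hBC, -⟩ := exists_sqrt_of_posDef hΛ
  have hpos : ∀ x : Fin d → ℝ, 0 < 1 + s * (x ⬝ᵥ x) := fun x => by
    have := mul_nonneg hs (dotProduct_self_nonneg' x); linarith
  have hdm : Measurable fun x : Fin d → ℝ => x ⬝ᵥ x :=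
    measurable_dotProduct measurable_id measurable_id
  have hlm : Measurable fun x : Fin d → ℝ => Real.log (1 + s * (x ⬝ᵥ x)) :=
    ((hdm.const_mul s).const_add 1).log
  -- Taking logarithms makes the product a sum; the exponential of each summand has mean at most `1
  -- + s m ≤ exp (s m)`, so second moments suffice.
  obtain ⟨bad, h1, h2, h3⟩ := exists_measurableSet_forall_sum_lt (n := n) (jointLaw f Λ Θ)
    (h := fun (_ : Unit) z => Real.log (1 + s * (z.1 ⬝ᵥ z.1))) (a := s * m)
    (fun _ => hlm.comp measurable_fst) (fun _ => by
      simp only [Real.exp_log (hpos _)]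
      have hF : Measurable fun q : (Fin d → ℝ) × (Fin p → ℝ) =>
          ENNReal.ofReal (1 + s * (q.1 ⬝ᵥ q.1)) :=
        (((hdm.comp measurable_fst).const_mul s).const_add 1).ennreal_ofReal
      rw [lintegral_jointLaw_whiteNoise hf hB hBB hBC Θ hF]
      simp only [lintegral_const, measure_univ, mul_one]
      calc ∫⁻ x, ENNReal.ofReal (1 + s * (x ⬝ᵥ x)) ∂(law f)
          = ∫⁻ x, (1 + ENNReal.ofReal s * ENNReal.ofReal (x ⬝ᵥ x)) ∂(law f) := by
            refine lintegral_congr fun x => ?_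
            rw [ENNReal.ofReal_add one_pos.le (mul_nonneg hs (dotProduct_self_nonneg' x)),
              ENNReal.ofReal_one, ENNReal.ofReal_mul hs]
        _ = 1 + ENNReal.ofReal s * secondMoment f := by
            rw [lintegral_add_left measurable_const, lintegral_const_mul _ hdm.ennreal_ofReal,
              secondMoment]
            simp
        _ ≤ 1 + ENNReal.ofReal s * ENNReal.ofReal m := by gcongr
        _ = ENNReal.ofReal (1 + s * m) := by
            rw [ENNReal.ofReal_add one_pos.le (mul_nonneg hs hm), ENNReal.ofReal_one,
              ENNReal.ofReal_mul hs]
        _ ≤ _ := ENNReal.ofReal_le_ofReal (by linarith [Real.add_one_le_exp (s * m)])) t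
  refine ⟨bad, h1, h2.trans_eq (by simp), fun z hz => ?_⟩
  have h := Real.exp_lt_exp.2 (h3 z hz ())
  rw [Real.exp_sum] at h
  simpa only [Real.exp_log (hpos _)] using h

end Tails

/-! ### The likelihood in whitened coordinates and the basic inequalities. -/

section Deterministic

variable {n p d : ℕ}

theorem transpose_of_posDef {ι : Type*} [Fintype ι] {Λ : Matrix ι ι ℝ} (h : Λ.PosDef) :
    Λᵀ = Λ := by
  have := h.1
  rwa [IsHermitian, conjTranspose_eq_transpose_of_trivial] at this

theorem gram_mul_mul {ι κ ι' κ' : Type*} [Fintype ι] [Fintype κ] (A : Matrix (Fin n) ι ℝ)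
    (B : Matrix (Fin n) κ ℝ) (M : Matrix ι ι' ℝ) (N : Matrix κ κ' ℝ) :
    gram (A * M) (B * N) = Mᵀ * gram A B * N := by
  simp only [gram, transpose_mul, Matrix.mul_smul, Matrix.smul_mul, Matrix.mul_assoc]

theorem gram_sub_sub {ι : Type*} (A B : Matrix (Fin n) ι ℝ) :
    gram (A - B) (A - B) = gram A A - gram A B - gram B A + gram B B := by
  simp only [gram, transpose_sub, Matrix.sub_mul, Matrix.mul_sub, smul_sub]
  abel

/-- The negative log likelihood in terms of the residuals. -/
theorem negLogLik_eq_residual (X : Matrix (Fin n) (Fin d) ℝ) (Y : Matrix (Fin n) (Fin p) ℝ)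
    {Λ : Matrix (Fin p) (Fin p) ℝ} (hΛ : Λ.PosDef) (Θ : Matrix (Fin d) (Fin p) ℝ) :
    negLogLik X Y Λ Θ = -Real.log Λ.det +
      (Λ * gram (Y - X * -(Θ * Λ⁻¹)) (Y - X * -(Θ * Λ⁻¹))).trace := by
  have hu : IsUnit Λ.det := (isUnit_iff_isUnit_det _).1 hΛ.isUnit
  have hs : (Λ⁻¹)ᵀ = Λ⁻¹ := transpose_of_posDef hΛ.inv
  have h1 : gram Y (X * -(Θ * Λ⁻¹)) = -((gram X Y)ᵀ * (Θ * Λ⁻¹)) := by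
    have := gram_mul_mul Y X (1 : Matrix (Fin p) (Fin p) ℝ) (-(Θ * Λ⁻¹))
    rw [Matrix.mul_one, transpose_one, Matrix.one_mul] at this
    rw [this, Matrix.mul_neg, gram_transpose]
  have h2 : gram (X * -(Θ * Λ⁻¹)) Y = -(Λ⁻¹ * Θᵀ * gram X Y) := by
    rw [← gram_transpose, h1, transpose_neg, transpose_mul, transpose_mul, hs, transpose_transpose]
  have h3 : gram (X * -(Θ * Λ⁻¹)) (X * -(Θ * Λ⁻¹)) = Λ⁻¹ * Θᵀ * gram X X * Θ * Λ⁻¹ := by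
    rw [gram_mul_mul, transpose_neg, transpose_mul, hs]
    simp only [Matrix.neg_mul, Matrix.mul_neg, neg_neg, Matrix.mul_assoc]
  have t1 : (Λ * ((gram X Y)ᵀ * (Θ * Λ⁻¹))).trace = ((gram X Y)ᵀ * Θ).trace := by
    rw [trace_mul_comm, Matrix.mul_assoc, Matrix.mul_assoc, nonsing_inv_mul _ hu, Matrix.mul_one]
  have t2 : (Λ * (Λ⁻¹ * Θᵀ * gram X Y)).trace = ((gram X Y)ᵀ * Θ).trace := by
    rw [Matrix.mul_assoc, ← Matrix.mul_assoc Λ, mul_nonsing_inv _ hu, Matrix.one_mul,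
      ← trace_transpose, transpose_mul, transpose_transpose]
  have t3 : (Λ * (Λ⁻¹ * Θᵀ * gram X X * Θ * Λ⁻¹)).trace =
      (Λ⁻¹ * Θᵀ * (gram X X)ᵀ * Θ).trace := by
    rw [trace_mul_comm, Matrix.mul_assoc _ _ Λ, nonsing_inv_mul _ hu, Matrix.mul_one,
      gram_transpose]
  rw [negLogLik, gram_sub_sub, h1, h2, h3, sub_neg_eq_add, sub_neg_eq_add, Matrix.mul_add,
    Matrix.mul_add, Matrix.mul_add]
  simp only [trace_add]
  rw [t1, t2, t3, trace_smul, trace_mul_comm Λ (gram Y Y), smul_eq_mul]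
  ring

/-- The normalized loss in whitened coordinates: `1 + N` is the whitened precision matrix, `W` the
whitened error in the regression coefficients, `G` the whitened noise. -/
noncomputable def whiteLoss (X : Matrix (Fin n) (Fin d) ℝ) (G : Matrix (Fin n) (Fin p) ℝ)
    (N : Matrix (Fin p) (Fin p) ℝ) (W : Matrix (Fin d) (Fin p) ℝ) : ℝ :=
  -Real.log (1 + N).det + ((1 + N) * gram (G - X * W) (G - X * W)).trace

/-- With precision `B (1 + N) B` and parameter `Θ` equal to `M - W C` times that precision, the
residual is `(G - X W) C`. The factors `B` and `C` then cancel in the trace, and the loss no longer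
involves the true parameters except for `log det Λ₀`. -/
theorem negLogLik_eq_whiteLoss (X : Matrix (Fin n) (Fin d) ℝ) (G : Matrix (Fin n) (Fin p) ℝ)
    {B C N Λ₀ : Matrix (Fin p) (Fin p) ℝ} (hC : Cᵀ = C) (hBB : B * B = Λ₀) (hBC : B * C = 1)
    (hCB : C * B = 1) (hN : 0 < (1 + N).det) (hΛ : (B * (1 + N) * B).PosDef)
    (M W : Matrix (Fin d) (Fin p) ℝ) :
    negLogLik X (G * C - X * M) (B * (1 + N) * B) ((M - W * C) * (B * (1 + N) * B)) =
      -Real.log Λ₀.det + whiteLoss X G N W := by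
  have hu : IsUnit (B * (1 + N) * B).det := (isUnit_iff_isUnit_det _).1 hΛ.isUnit
  have hB0 : 0 < Λ₀.det := by
    have : B.det ≠ 0 := left_ne_zero_of_mul_eq_one (by rw [← det_mul, hBC, det_one])
    rw [← hBB, det_mul]
    exact mul_self_pos.2 this
  have hres : G * C - X * M - X * -((M - W * C) * (B * (1 + N) * B) * (B * (1 + N) * B)⁻¹) =
      (G - X * W) * C := by
    rw [Matrix.mul_assoc _ (B * (1 + N) * B), mul_nonsing_inv _ hu, Matrix.mul_one, Matrix.mul_neg,
      Matrix.mul_sub, Matrix.sub_mul, Matrix.mul_assoc X]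
    abel
  have hdet : (B * (1 + N) * B).det = Λ₀.det * (1 + N).det := by
    rw [← hBB]; simp only [det_mul]; ring
  rw [negLogLik_eq_residual X _ hΛ, hres, gram_mul_mul, hC, hdet,
    Real.log_mul hB0.ne' hN.ne', whiteLoss]
  have : (B * (1 + N) * B * (C * gram (G - X * W) (G - X * W) * C)).trace =
      ((1 + N) * gram (G - X * W) (G - X * W)).trace := by
    rw [trace_mul_comm]
    calc _ = (C * (gram (G - X * W) (G - X * W) * ((C * B) * (1 + N) * B))).trace := by
          simp only [Matrix.mul_assoc]
      _ = ((gram (G - X * W) (G - X * W) * (1 + N)) * (B * C)).trace := by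
          rw [hCB, Matrix.one_mul, trace_mul_comm]; simp only [Matrix.mul_assoc]
      _ = _ := by rw [hBC, Matrix.mul_one, trace_mul_comm]
  rw [this]
  ring

theorem whiteLoss_sub (X : Matrix (Fin n) (Fin d) ℝ) (G : Matrix (Fin n) (Fin p) ℝ)
    {N : Matrix (Fin p) (Fin p) ℝ} (hN : Nᵀ = N) (W : Matrix (Fin d) (Fin p) ℝ) :
    whiteLoss X G N W = -Real.log (1 + N).det + ((1 + N) * gram G G).trace
      - 2 * (gram G X * (W * (1 + N))).trace + ((1 + N) * gram (X * W) (X * W)).trace := by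
  have h1 : gram G (X * W) = gram G X * W := by
    have := gram_mul_mul G X (1 : Matrix (Fin p) (Fin p) ℝ) W
    rwa [Matrix.mul_one, transpose_one, Matrix.one_mul] at this
  have h2 : gram (X * W) G = (gram G X * W)ᵀ := by rw [← h1, gram_transpose]
  have t1 : ((1 + N) * (gram G X * W)).trace = (gram G X * (W * (1 + N))).trace := by
    rw [trace_mul_comm, Matrix.mul_assoc]
  have t2 : ((1 + N) * (gram G X * W)ᵀ).trace = (gram G X * (W * (1 + N))).trace := by
    rw [← t1, ← trace_transpose, transpose_mul, transpose_transpose, transpose_add, transpose_one,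
      hN, trace_mul_comm]
  rw [whiteLoss, gram_sub_sub, h1, h2, Matrix.mul_add, Matrix.mul_sub, Matrix.mul_sub, trace_add,
    trace_sub, trace_sub, t1, t2]
  ring

theorem trace_one_add_mul_gram_ge {N : Matrix (Fin p) (Fin p) ℝ}
    (hN2 : frob N ≤ 1 / 2) (A : Matrix (Fin n) (Fin p) ℝ) :
    1 / 2 * (gram A A).trace ≤ ((1 + N) * gram A A).trace := by
  have h1 : ((1 + N) * gram A A).trace = (n : ℝ)⁻¹ * ∑ i, A i ⬝ᵥ ((1 + N) *ᵥ A i) := by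
    rw [gram, Matrix.mul_smul, trace_smul, smul_eq_mul, ← Matrix.mul_assoc, trace_mul_comm]
    rfl
  have h2 : (gram A A).trace = (n : ℝ)⁻¹ * ∑ i, A i ⬝ᵥ A i := by
    rw [gram, trace_smul, smul_eq_mul, trace_mul_comm]
    rfl
  rw [h1, h2, mul_left_comm, Finset.mul_sum]
  gcongr with i _
  exact (half_le_one_add_form hN2 _).1

/-- The hypothesis controls one coordinate at a time; summing over the `d` coordinates of each
column produces the factor `d`. -/
theorem frob_sq_le_trace_gram {X : Matrix (Fin n) (Fin d) ℝ} {κ : ℝ}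
    (hκ : ∀ (v : Fin d → ℝ) j, v j ^ 2 ≤ κ * (v ⬝ᵥ (gram X X *ᵥ v)))
    (W : Matrix (Fin d) (Fin p) ℝ) :
    frob W ^ 2 ≤ d * κ * (gram (X * W) (X * W)).trace := by
  have h1 : (gram (X * W) (X * W)).trace =
      ∑ k, (fun j => W j k) ⬝ᵥ (gram X X *ᵥ fun j => W j k) := by
    rw [gram_mul_mul, Matrix.mul_assoc, trace]
    refine Finset.sum_congr rfl fun k _ => ?_
    simp only [diag_apply, mul_apply, dotProduct, mulVec, transpose_apply]
  rw [h1, frob_sq_eq_sum_col, Finset.mul_sum]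
  refine Finset.sum_le_sum fun k _ => ?_
  rw [dotProduct]
  refine (Finset.sum_le_card_nsmul _ _ (κ * ((fun j => W j k) ⬝ᵥ (gram X X *ᵥ fun j => W j k)))
    fun j _ => ?_).trans_eq ?_
  · rw [← sq]; exact hκ (fun j => W j k) j
  · rw [Finset.card_univ, Fintype.card_fin, nsmul_eq_mul, mul_assoc]

theorem frob_mul_le_right {A : Matrix (Fin p) (Fin p) ℝ} (hA : Aᵀ = A) {c : ℝ} (hc : 0 ≤ c)
    (h : ∀ v, (A *ᵥ v) ⬝ᵥ (A *ᵥ v) ≤ c ^ 2 * (v ⬝ᵥ v)) {ι : Type*} [Fintype ι]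
    (M : Matrix ι (Fin p) ℝ) : frob (M * A) ≤ c * frob M := by
  have := frob_mul_le_of_form hc h Mᵀ
  rwa [← frob_transpose, transpose_mul, transpose_transpose, hA, frob_transpose] at this

theorem frob_mul_one_add_le {N : Matrix (Fin p) (Fin p) ℝ} (hN : frob N ≤ 1 / 2) {ι : Type*}
    [Fintype ι] (M : Matrix ι (Fin p) ℝ) : frob (M * (1 + N)) ≤ 3 / 2 * frob M := by
  rw [Matrix.mul_add, Matrix.mul_one]
  have h1 := frob_add_le M (M * N)
  have h2 := frob_mul_le M N
  nlinarith [frob_nonneg M, mul_le_mul_of_nonneg_left hN (frob_nonneg M)]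

theorem sum_abs_sub_sum_abs_le {ι κ : Type*} [Fintype ι] [Fintype κ] (A A' : Matrix ι κ ℝ) :
    ∑ i, ∑ j, |A' i j| - ∑ i, ∑ j, |A i j| ≤
      Real.sqrt (Fintype.card ι * Fintype.card κ) * frob (A' - A) := by
  refine le_trans ?_ (sum_sum_abs_le _)
  rw [← Finset.sum_sub_distrib]
  refine Finset.sum_le_sum fun i _ => ?_
  rw [← Finset.sum_sub_distrib]
  exact Finset.sum_le_sum fun j _ => abs_sub_abs_le_abs_sub _ _

/-- Entries off the support of `A` contribute `-|A' i j| ≤ 0`, so Cauchy-Schwarz runs over `sTheta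
A` entries instead of `d p`. -/
theorem sum_abs_sub_sum_abs_le_support (A A' : Matrix (Fin d) (Fin p) ℝ) :
    ∑ i, ∑ j, |A i j| - ∑ i, ∑ j, |A' i j| ≤ Real.sqrt (sTheta A) * frob (A' - A) := by
  classical
  have h := sum_abs_le_sqrt_card_mul_frob
    (Finset.univ.filter fun e : Fin d × Fin p => A e.1 e.2 ≠ 0) (A' - A)
  have hs : (Finset.univ.filter fun e : Fin d × Fin p => A e.1 e.2 ≠ 0).card = sTheta A := by
    unfold sTheta; congr
  rw [hs] at h
  refine le_trans ?_ h
  rw [← Fintype.sum_prod_type' fun i j => |A i j|, ← Fintype.sum_prod_type' fun i j => |A' i j|,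
    ← Finset.sum_sub_distrib, Finset.sum_filter]
  refine Finset.sum_le_sum fun e _ => ?_
  split_ifs with he
  · rw [Matrix.sub_apply, abs_sub_comm]; exact abs_sub_abs_le_abs_sub _ _
  · rw [not_not.1 he]; simp

theorem offDiag_sub_offDiag_le (A A' : Matrix (Fin p) (Fin p) ℝ) :
    (∑ i, ∑ j, if i = j then 0 else |A i j|) - (∑ i, ∑ j, if i = j then 0 else |A' i j|) ≤
      p * frob (A' - A) := by
  have h := sum_sum_abs_le (A' - A)
  rw [Fintype.card_fin, Real.sqrt_mul_self (Nat.cast_nonneg _)] at h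
  refine le_trans ?_ h
  rw [← Finset.sum_sub_distrib]
  refine Finset.sum_le_sum fun i _ => ?_
  rw [← Finset.sum_sub_distrib]
  refine Finset.sum_le_sum fun j _ => ?_
  split_ifs
  · simp
  · rw [Matrix.sub_apply, abs_sub_comm]; exact abs_sub_abs_le_abs_sub _ _

/-- The two basic inequalities for a penalized estimate, in whitened coordinates. -/
theorem basic_inequalities {X : Matrix (Fin n) (Fin d) ℝ} {G : Matrix (Fin n) (Fin p) ℝ}
    {B C N Λ₀ : Matrix (Fin p) (Fin p) ℝ} (hB : Bᵀ = B) (hC : Cᵀ = C) (hBB : B * B = Λ₀)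
    (hBC : B * C = 1) (hCB : C * B = 1) (hΛ₀ : Λ₀.PosDef) {b c : ℝ} (hb : 0 ≤ b) (hc : 0 ≤ c)
    (hBb : ∀ v, (B *ᵥ v) ⬝ᵥ (B *ᵥ v) ≤ b ^ 2 * (v ⬝ᵥ v))
    (hCc : ∀ v, (C *ᵥ v) ⬝ᵥ (C *ᵥ v) ≤ c ^ 2 * (v ⬝ᵥ v))
    (hN : Nᵀ = N) (hN2 : frob N ≤ 1 / 2)
    (Θ₀ W : Matrix (Fin d) (Fin p) ℝ) {lam₂ lam₃ : ℝ} (h₂ : 0 ≤ lam₂) (h₃ : 0 ≤ lam₃)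
    (hest : IsEstimate X (G * C - X * (Θ₀ * C * C)) lam₂ lam₃ (B * (1 + N) * B)
      ((Θ₀ * C * C - W * C) * (B * (1 + N) * B)))
    {κ : ℝ} (hκ : 0 < κ) (hd : 0 < d)
    (hκX : ∀ (v : Fin d → ℝ) j, v j ^ 2 ≤ κ * (v ⬝ᵥ (gram X X *ᵥ v))) :
    frob W ^ 2 ≤ 2 * d * κ * ((3 * frob (gram G X) +
        3 / 2 * b * lam₃ * Real.sqrt (d * p)) * frob W) ∧
    frob N ^ 2 / 6 ≤ frob (gram G G - 1) * frob N + 3 * frob (gram G X) * frob W +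
      lam₂ * (p * (b ^ 2 * frob N)) + lam₃ * (Real.sqrt (sTheta Θ₀) *
        (b * c * frob Θ₀ * frob N + 3 / 2 * b * frob W)) := by
  have hNh : N.IsHermitian := by
    rw [IsHermitian, conjTranspose_eq_transpose_of_trivial]; exact hN
  obtain ⟨hdet, hlow, -, -⟩ := logdet_bounds hNh hN2
  set Λ' := B * (1 + N) * B with hΛ'
  set M := Θ₀ * C * C with hM
  set Y := G * C - X * M with hY
  have hd0 : (0 : ℝ) < d := Nat.cast_pos.2 hd
  have hdet0 : (0 : ℝ) < (1 + (0 : Matrix (Fin p) (Fin p) ℝ)).det := by simp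
  have hΛ0' : B * (1 + 0) * B = Λ₀ := by rw [add_zero, Matrix.mul_one, hBB]
  -- the comparison values of the likelihood
  have e1 := negLogLik_eq_whiteLoss X G hC hBB hBC hCB hdet hest.1 M W
  have e2 := negLogLik_eq_whiteLoss X G hC hBB hBC hCB hdet hest.1 M 0
  have e3 := negLogLik_eq_whiteLoss X G hC hBB hBC hCB hdet0 (hΛ0'.symm ▸ hΛ₀) M 0
  rw [Matrix.zero_mul, sub_zero] at e2 e3
  rw [hΛ0'] at e3
  -- Here `M = Θ₀ Λ₀⁻¹`. The three points compared are the estimate, the estimated precision with `W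
  -- = 0`, and the truth `N = 0`, `W = 0`.
  have hMΛ : M * Λ₀ = Θ₀ := by
    rw [hM, ← hBB, Matrix.mul_assoc (Θ₀ * C), ← Matrix.mul_assoc C, hCB, Matrix.one_mul,
      Matrix.mul_assoc, hCB, Matrix.mul_one]
  rw [hMΛ] at e3
  rw [whiteLoss_sub X G hN] at e1 e2
  rw [whiteLoss_sub X G (N := 0) (by simp)] at e3
  simp only [Matrix.mul_zero, Matrix.zero_mul, trace_zero, add_zero, det_one, Real.log_one,
    Matrix.one_mul, neg_zero, zero_add, sub_zero, mul_zero] at e2 e3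
  have hz : gram (0 : Matrix (Fin n) (Fin p) ℝ) (0 : Matrix (Fin n) (Fin p) ℝ) = 0 := by
    simp [gram]
  rw [hz] at e2 e3
  simp only [Matrix.mul_zero, trace_zero, add_zero] at e2 e3
  -- the quadratic and the cross term
  have hq := trace_one_add_mul_gram_ge hN2 (X * W)
  have hq0 := frob_sq_le_trace_gram hκX W
  have htr0 : 0 ≤ (gram (X * W) (X * W)).trace := by
    have : 0 < d * κ := by positivity
    by_contra hneg
    nlinarith [sq_nonneg (frob W), mul_pos this (neg_pos.2 (not_le.1 hneg))]
  have hcross : (gram G X * (W * (1 + N))).trace ≤ frob (gram G X) * (3 / 2 * frob W) :=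
    (le_abs_self _).trans ((abs_trace_mul_le _ _).trans
      (mul_le_mul_of_nonneg_left (frob_mul_one_add_le hN2 W) (frob_nonneg _)))
  have hWΛ : W * C * Λ' = W * (1 + N) * B := by
    rw [hΛ', Matrix.mul_assoc W, ← Matrix.mul_assoc C, ← Matrix.mul_assoc C, hCB, Matrix.one_mul,
      Matrix.mul_assoc]
  have hWB : frob (W * C * Λ') ≤ b * (3 / 2 * frob W) := by
    rw [hWΛ]
    exact (frob_mul_le_right hB hb hBb _).trans
      (mul_le_mul_of_nonneg_left (frob_mul_one_add_le hN2 W) hb)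
  constructor
  -- The competitor has the same precision, so the determinant, the noise term and the off-diagonal
  -- penalty cancel, and only terms in `W` remain.
  · have h := hest.2 Λ' (M * Λ') hest.1
    rw [objective, objective, e1, e2] at h
    have hpen := sum_abs_sub_sum_abs_le ((M - W * C) * Λ') (M * Λ')
    have hdiff : M * Λ' - (M - W * C) * Λ' = W * C * Λ' := by
      rw [Matrix.sub_mul]; abel
    rw [hdiff, Fintype.card_fin, Fintype.card_fin] at hpen
    have hpen2 := mul_le_mul_of_nonneg_left
      (hpen.trans (mul_le_mul_of_nonneg_left hWB (Real.sqrt_nonneg _))) h₃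
    have hkey : 1 / 2 * (gram (X * W) (X * W)).trace ≤
        (3 * frob (gram G X) + 3 / 2 * b * lam₃ * Real.sqrt (d * p)) * frob W := by
      linarith
    have := mul_le_mul_of_nonneg_left hkey (show 0 ≤ 2 * (d * κ) by positivity)
    linarith
  · have h := hest.2 Λ₀ Θ₀ hΛ₀
    rw [objective, objective, e1, e3] at h
    have hΛd : Λ' - Λ₀ = B * N * B := by
      rw [hΛ', Matrix.mul_add, Matrix.add_mul, Matrix.mul_one, hBB]; abel
    have hpen1 := offDiag_sub_offDiag_le Λ₀ Λ'
    have hBNB : frob (B * N * B) ≤ b ^ 2 * frob N := by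
      refine (frob_mul_le_right hB hb hBb _).trans ?_
      rw [sq, mul_assoc]
      exact mul_le_mul_of_nonneg_left (frob_mul_le_of_form hb hBb N) hb
    rw [hΛd] at hpen1
    have hpen1' := mul_le_mul_of_nonneg_left
      (hpen1.trans (mul_le_mul_of_nonneg_left hBNB (Nat.cast_nonneg p))) h₂
    have hpen2 := sum_abs_sub_sum_abs_le_support Θ₀ ((M - W * C) * Λ')
    have hΘd : (M - W * C) * Λ' - Θ₀ = Θ₀ * C * N * B - W * C * Λ' := by
      have h1 : M * Λ' = Θ₀ + Θ₀ * C * N * B := by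
        have : Λ' = Λ₀ + B * N * B := by rw [← hΛd]; abel
        rw [this, Matrix.mul_add, hMΛ, hM]
        congr 1
        rw [Matrix.mul_assoc (Θ₀ * C) C, ← Matrix.mul_assoc C, ← Matrix.mul_assoc C, hCB,
          Matrix.one_mul, ← Matrix.mul_assoc]
      rw [Matrix.sub_mul, h1]; abel
    have hΘb : frob ((M - W * C) * Λ' - Θ₀) ≤ b * c * frob Θ₀ * frob N + 3 / 2 * b * frob W := by
      rw [hΘd]
      refine (frob_sub_le _ _).trans (add_le_add ?_ (hWB.trans_eq (by ring)))
      refine (frob_mul_le_right hB hb hBb _).trans ?_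
      have h1 := (frob_mul_le (Θ₀ * C) N).trans
        (mul_le_mul_of_nonneg_right (frob_mul_le_right hC hc hCc Θ₀) (frob_nonneg N))
      exact (mul_le_mul_of_nonneg_left h1 hb).trans_eq (by ring)
    have hpen2' := mul_le_mul_of_nonneg_left
      (hpen2.trans (mul_le_mul_of_nonneg_left hΘb (Real.sqrt_nonneg _))) h₃
    -- The isolated `tr N` joins `-log det (1 + N)` to give the curvature `‖N‖²/6`; the rest is
    -- linear in `N` with small coefficient `gram G G - 1`.
    have hG : ((1 + N) * gram G G).trace - (gram G G).trace = N.trace +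
        ((gram G G - 1) * N).trace := by
      rw [Matrix.add_mul, Matrix.one_mul, trace_add, Matrix.sub_mul, trace_sub, Matrix.one_mul,
        trace_mul_comm N]
      ring
    have hGn : -(frob (gram G G - 1) * frob N) ≤ ((gram G G - 1) * N).trace :=
      (abs_le.1 (abs_trace_mul_le _ _)).1
    linarith

end Deterministic

/-! ### From whitened errors to the symmetrized divergence. -/

section Divergence

variable {n p d : ℕ}

/-- Pointwise bounds of the divergences, in both directions. -/
theorem klDiv_condLaw_le {B C N Λ₀ Λ' : Matrix (Fin p) (Fin p) ℝ} (hB : Bᵀ = B) (hC : Cᵀ = C)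
    (hBB : B * B = Λ₀) (hBC : B * C = 1) (hCB : C * B = 1) (hΛ₀ : Λ₀.PosDef) (hΛ' : Λ'.PosDef)
    (hN : Nᵀ = N) (hN2 : frob N ≤ 1 / 2) (hNΛ : B * (1 + N) * B = Λ')
    {Θ₀ Θ' W : Matrix (Fin d) (Fin p) ℝ} (hW : W = (Θ₀ * C * C - Θ' * Λ'⁻¹) * B) (x : Fin d → ℝ) :
    InformationTheory.klDiv (condLaw Λ₀ Θ₀ x) (condLaw Λ' Θ' x) ≤
        ENNReal.ofReal (frob N ^ 2 + frob W ^ 2 * (x ⬝ᵥ x)) ∧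
      InformationTheory.klDiv (condLaw Λ' Θ' x) (condLaw Λ₀ Θ₀ x) ≤
        ENNReal.ofReal (frob N ^ 2 + frob W ^ 2 * (x ⬝ᵥ x)) := by
  have hNh : N.IsHermitian := by
    rw [IsHermitian, conjTranspose_eq_transpose_of_trivial]; exact hN
  obtain ⟨hdet, -, hup, hup'⟩ := logdet_bounds hNh hN2
  have hu : IsUnit (1 + N).det := hdet.ne'.isUnit
  have hB0 : 0 < Λ₀.det := hΛ₀.det_pos
  have hlog : Real.log Λ'.det = Real.log Λ₀.det + Real.log (1 + N).det := by
    rw [← Real.log_mul hB0.ne' hdet.ne', ← hNΛ, ← hBB]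
    simp only [det_mul]
    ring_nf
  have hinv₀ : Λ₀⁻¹ = C * C := inv_eq_of_sqrt hBB hBC
  have hinv' : Λ'⁻¹ = C * (1 + N)⁻¹ * C := by
    refine inv_eq_right_inv ?_
    rw [← hNΛ]
    calc _ = B * (1 + N) * (B * C) * (1 + N)⁻¹ * C := by simp only [Matrix.mul_assoc]
      _ = 1 := by
        rw [hBC, Matrix.mul_one, Matrix.mul_assoc B, mul_nonsing_inv _ hu, Matrix.mul_one, hBC]
  have ht₁ : (Λ' * Λ₀⁻¹).trace = p + N.trace := by
    rw [hinv₀, ← hNΛ]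
    calc _ = ((B * (1 + N)) * (B * C) * C).trace := by simp only [Matrix.mul_assoc]
      _ = ((1 + N) * (C * B)).trace := by
        rw [hBC, Matrix.mul_one, Matrix.mul_assoc, trace_mul_comm, Matrix.mul_assoc]
      _ = _ := by rw [hCB, Matrix.mul_one, trace_add, trace_one, Fintype.card_fin]
  have ht₂ : (Λ₀ * Λ'⁻¹).trace = ((1 + N)⁻¹).trace := by
    rw [hinv', ← hBB]
    calc _ = (B * ((B * C) * (1 + N)⁻¹ * C)).trace := by simp only [Matrix.mul_assoc]
      _ = _ := by
        rw [hBC, Matrix.one_mul, trace_mul_comm, Matrix.mul_assoc, hCB, Matrix.mul_one]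
  set δ := condMean Λ₀ Θ₀ x - condMean Λ' Θ' x with hδ
  have hs' : (Λ'⁻¹)ᵀ = Λ'⁻¹ := transpose_of_posDef hΛ'.inv
  -- The whitened difference of conditional means is linear in `x` with matrix `-Wᵀ`; this is why
  -- `W` is defined with the factor `B` on the right.
  have hBδ : B *ᵥ δ = -(Wᵀ *ᵥ x) := by
    have hWt : Wᵀ = B * (C * C * Θ₀ᵀ - Λ'⁻¹ * Θ'ᵀ) := by
      rw [hW]
      simp only [transpose_mul, transpose_sub, hB, hC, hs', Matrix.mul_assoc]
    rw [hWt, ← mulVec_mulVec, sub_mulVec, hδ, ← mulVec_neg _ B]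
    simp only [condMean, hinv₀]
    congr 1
    abel
  have hWx : (B *ᵥ δ) ⬝ᵥ (B *ᵥ δ) ≤ frob W ^ 2 * (x ⬝ᵥ x) := by
    rw [hBδ, neg_dotProduct, dotProduct_neg, neg_neg, ← frob_transpose W]
    exact mulVec_dotProduct_self_le Wᵀ x
  have hf₀ : δ ⬝ᵥ (Λ₀ *ᵥ δ) = (B *ᵥ δ) ⬝ᵥ (B *ᵥ δ) := by
    rw [dotProduct_mulVec_transpose, hB, mulVec_mulVec, hBB]
  have hf' : δ ⬝ᵥ (Λ' *ᵥ δ) = (B *ᵥ δ) ⬝ᵥ ((1 + N) *ᵥ (B *ᵥ δ)) := by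
    rw [dotProduct_mulVec_transpose, hB, mulVec_mulVec, mulVec_mulVec, hNΛ]
  have hform := (half_le_one_add_form hN2 (B *ᵥ δ)).2
  have h0 : 0 ≤ (B *ᵥ δ) ⬝ᵥ (B *ᵥ δ) := dotProduct_self_nonneg' _
  have hneg : condMean Λ' Θ' x - condMean Λ₀ Θ₀ x = -δ := by rw [hδ, neg_sub]
  rw [Fintype.card_fin] at hup'
  rw [klDiv_condLaw hΛ₀ hΛ', klDiv_condLaw hΛ' hΛ₀, hneg, mulVec_neg, neg_dotProduct,
    dotProduct_neg, neg_neg, ← hδ, ht₁, ht₂, hlog, hf₀, hf']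
  -- The determinant and trace terms give `2 ‖N‖²`, and the mean term at most `3/2 ‖W‖² xᵀx`; the
  -- factor `1/2` brings both within the stated bound.
  constructor <;> refine ENNReal.ofReal_le_ofReal ?_ <;> linarith

theorem lintegral_quadratic_le {f : (Fin d → ℝ) → ℝ} (hf : IsDensity f) {a b m : ℝ} (ha : 0 ≤ a)
    (hb : 0 ≤ b) (hm : 0 ≤ m) (hfm : secondMoment f ≤ ENNReal.ofReal m) :
    ∫⁻ x, ENNReal.ofReal (a + b * (x ⬝ᵥ x)) ∂(law f) ≤ ENNReal.ofReal (a + b * m) := by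
  have := isProbabilityMeasure_law hf
  have hdm : Measurable fun x : Fin d → ℝ => x ⬝ᵥ x :=
    measurable_dotProduct measurable_id measurable_id
  calc ∫⁻ x, ENNReal.ofReal (a + b * (x ⬝ᵥ x)) ∂(law f)
      = ∫⁻ x, (ENNReal.ofReal a + ENNReal.ofReal b * ENNReal.ofReal (x ⬝ᵥ x)) ∂(law f) := by
        refine lintegral_congr fun x => ?_
        rw [ENNReal.ofReal_add ha (mul_nonneg hb (dotProduct_self_nonneg' x)), ENNReal.ofReal_mul hb]
    _ = ENNReal.ofReal a + ENNReal.ofReal b * secondMoment f := by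
        rw [lintegral_add_left measurable_const, lintegral_const_mul _ hdm.ennreal_ofReal,
          secondMoment]
        simp
    _ ≤ ENNReal.ofReal a + ENNReal.ofReal b * ENNReal.ofReal m := by gcongr
    _ = _ := by rw [ENNReal.ofReal_add ha (mul_nonneg hb hm), ENNReal.ofReal_mul hb]

theorem condSKL_le {B C N Λ₀ Λ' : Matrix (Fin p) (Fin p) ℝ} (hB : Bᵀ = B) (hC : Cᵀ = C)
    (hBB : B * B = Λ₀) (hBC : B * C = 1) (hCB : C * B = 1) (hΛ₀ : Λ₀.PosDef) (hΛ' : Λ'.PosDef)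
    (hN : Nᵀ = N) (hN2 : frob N ≤ 1 / 2) (hNΛ : B * (1 + N) * B = Λ')
    {Θ₀ Θ' W : Matrix (Fin d) (Fin p) ℝ} (hW : W = (Θ₀ * C * C - Θ' * Λ'⁻¹) * B)
    {f₀ f' : (Fin d → ℝ) → ℝ} (hf₀ : IsDensity f₀) (hf' : IsDensity f') {m : ℝ} (hm : 0 ≤ m)
    (hm₀ : secondMoment f₀ ≤ ENNReal.ofReal m) (hm' : secondMoment f' ≤ ENNReal.ofReal m) :
    condSKL f₀ Λ₀ Θ₀ f' Λ' Θ' ≤ ENNReal.ofReal (2 * (frob N ^ 2 + frob W ^ 2 * m)) := by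
  have h := klDiv_condLaw_le hB hC hBB hBC hCB hΛ₀ hΛ' hN hN2 hNΛ hW
  have h1 := (lintegral_mono fun x => (h x).1).trans
    (lintegral_quadratic_le hf₀ (sq_nonneg (frob N)) (sq_nonneg (frob W)) hm hm₀)
  have h2 := (lintegral_mono fun x => (h x).2).trans
    (lintegral_quadratic_le hf' (sq_nonneg (frob N)) (sq_nonneg (frob W)) hm hm')
  have h0 : 0 ≤ frob N ^ 2 + frob W ^ 2 * m := by positivity
  rw [condSKL, two_mul, ENNReal.ofReal_add h0 h0]
  exact add_le_add h1 h2

end Divergence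

/-! ### Solving the basic inequalities for the rates. -/

section Rates

theorem le_of_sq_le_mul {ω M : ℝ} (hω : 0 ≤ ω) (hM : 0 ≤ M) (h : ω ^ 2 ≤ M * ω) : ω ≤ M := by
  rcases hω.eq_or_lt with h0 | h0
  · rw [← h0]; exact hM
  · rw [sq] at h; exact le_of_mul_le_mul_right h h0

set_option maxHeartbeats 1000000 in
/-- The rates that follow from the two basic inequalities. -/
theorem rates_of_basic_inequalities {η ω r v ρ l₂ l₃ sq θ b c κ d p e₁ e₂ k s q c₁ : ℝ}
    (hη0 : 0 ≤ η) (hω0 : 0 ≤ ω) (hr : 0 ≤ r) (hv : 0 ≤ v) (hl₃ : 0 ≤ l₃)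
    (hsq : 0 ≤ sq) (hθ : 0 ≤ θ) (hb : 0 ≤ b) (hc : 0 ≤ c) (hκ : 0 ≤ κ) (hd : 1 ≤ d) (hp : 1 ≤ p)
    (he₁ : 0 ≤ e₁) (he₂ : 0 ≤ e₂) (hk : 0 ≤ k) (hs : 0 ≤ s) (hq : 0 ≤ q)
    (hdp : d ^ 3 ≤ c₁ * p)
    (h1 : ω ^ 2 ≤ 2 * d * κ * ((3 * v + 3 / 2 * b * l₃ * √(d * p)) * ω))
    (h2 : η ^ 2 / 6 ≤ ρ * η + 3 * v * ω + l₂ * (p * (b ^ 2 * η)) +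
      l₃ * (sq * (b * c * θ * η + 3 / 2 * b * ω)))
    (hv' : v ≤ e₁ * r * √(d * p)) (hl₂' : l₂ ≤ k * r) (hl₃' : l₃ ≤ k * r) (hsq' : sq ≤ s * √p)
    (hθ' : θ ≤ q * √p) (hρ : ρ ≤ e₂ * r * p ∨ 1 ≤ r) (hη' : η ≤ 1 / 2) :
    ω ^ 2 ≤ (2 * κ * (3 * e₁ + 3 / 2 * b * k)) ^ 2 * c₁ * (r ^ 2 * p ^ 2) ∧
    η ^ 2 ≤ (36 * (e₂ + k * b ^ 2 + k * s * (b * c * q)) ^ 2 +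
      12 * ((3 * e₁ + 3 / 2 * b * k * s) * (2 * κ * (3 * e₁ + 3 / 2 * b * k)) * c₁) + 1) *
        (r ^ 2 * p ^ 2) := by
  have hp0 : 0 ≤ p := zero_le_one.trans hp
  have hd0 : 0 ≤ d := zero_le_one.trans hd
  set t := √(d * p) with ht
  have ht0 : 0 ≤ t := Real.sqrt_nonneg _
  have ht2 : t ^ 2 = d * p := Real.sq_sqrt (by positivity)
  set u := √p with hu
  have hu0 : 0 ≤ u := Real.sqrt_nonneg _
  have hu2 : u ^ 2 = p := Real.sq_sqrt hp0
  have hut : u ≤ t := Real.sqrt_le_sqrt (by nlinarith)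
  have hc₁ : 0 ≤ c₁ := by
    by_contra hneg
    nlinarith [pow_pos (zero_lt_one.trans_le hd) 3]
  set Ka := 2 * κ * (3 * e₁ + 3 / 2 * b * k) with hKa
  have hKa0 : 0 ≤ Ka := by positivity
  have hω : ω ≤ Ka * (d * r * t) := by
    refine (le_of_sq_le_mul hω0 (M := 2 * d * κ * (3 * v + 3 / 2 * b * l₃ * t)) (by positivity)
      (by linarith)).trans ?_
    calc 2 * d * κ * (3 * v + 3 / 2 * b * l₃ * t)
        ≤ 2 * d * κ * (3 * (e₁ * r * t) + 3 / 2 * b * (k * r) * t) := by gcongr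
      _ = Ka * (d * r * t) := by rw [hKa]; ring
  clear_value Ka t u
  -- Here the restriction on `d` enters: squaring `d r √(d p)` gives `d³ p r²`, which becomes `c₁ p²
  -- r²`.
  have hd3 : d ^ 3 * p ≤ c₁ * p ^ 2 := by nlinarith
  have hd2 : d ^ 2 * p ≤ c₁ * p ^ 2 := by
    refine le_trans (mul_le_mul_of_nonneg_right ?_ hp0) hd3
    exact pow_le_pow_right₀ hd (by norm_num)
  constructor
  · calc ω ^ 2 ≤ (Ka * (d * r * t)) ^ 2 := by gcongr
      _ = Ka ^ 2 * r ^ 2 * (d ^ 2 * t ^ 2) := by ring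
      _ = Ka ^ 2 * r ^ 2 * (d ^ 3 * p) := by rw [ht2]; ring
      _ ≤ Ka ^ 2 * r ^ 2 * (c₁ * p ^ 2) := by gcongr
      _ = _ := by ring
  rcases hρ with hρ | hr1
  · set α := e₂ + k * b ^ 2 + k * s * (b * c * q) with hα
    set β := (3 * e₁ + 3 / 2 * b * k * s) * Ka * c₁ with hβ
    have hα0 : 0 ≤ α := by positivity
    clear_value α β
    have htω : t * ω ≤ Ka * r * (c₁ * p ^ 2) := by
      calc t * ω ≤ t * (Ka * (d * r * t)) := by gcongr
        _ = Ka * r * (d ^ 2 * p) := by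
          have : t * (Ka * (d * r * t)) = Ka * r * (d * t ^ 2) := by ring
          rw [this, ht2]; ring
        _ ≤ _ := by gcongr
    have hbound : η ^ 2 / 6 ≤ α * (r * p) * η + β * (r ^ 2 * p ^ 2) := by
      refine h2.trans ?_
      calc ρ * η + 3 * v * ω + l₂ * (p * (b ^ 2 * η)) + l₃ * (sq * (b * c * θ * η + 3 / 2 * b * ω))
          ≤ (e₂ * r * p) * η + 3 * (e₁ * r * t) * ω + (k * r) * (p * (b ^ 2 * η)) +
            (k * r) * ((s * u) * (b * c * (q * u) * η + 3 / 2 * b * ω)) := by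
            have i1 : ρ * η ≤ (e₂ * r * p) * η := mul_le_mul_of_nonneg_right hρ hη0
            have i2 : 3 * v * ω ≤ 3 * (e₁ * r * t) * ω :=
              mul_le_mul_of_nonneg_right (by linarith) hω0
            have i3 : l₂ * (p * (b ^ 2 * η)) ≤ (k * r) * (p * (b ^ 2 * η)) :=
              mul_le_mul_of_nonneg_right hl₂' (by positivity)
            have i4 : b * c * θ * η ≤ b * c * (q * u) * η :=
              mul_le_mul_of_nonneg_right (mul_le_mul_of_nonneg_left hθ' (by positivity)) hη0
            have i5 : l₃ * (sq * (b * c * θ * η + 3 / 2 * b * ω)) ≤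
                (k * r) * ((s * u) * (b * c * (q * u) * η + 3 / 2 * b * ω)) :=
              mul_le_mul hl₃' (mul_le_mul hsq' (by linarith) (by positivity) (by positivity))
                (by positivity) (by positivity)
            linarith
        _ = (e₂ + k * b ^ 2) * (r * p) * η + k * s * (b * c * q) * (r * u ^ 2) * η +
            3 * e₁ * r * (t * ω) + 3 / 2 * b * k * s * r * (u * ω) := by ring
        _ ≤ (e₂ + k * b ^ 2) * (r * p) * η + k * s * (b * c * q) * (r * u ^ 2) * η +
            3 * e₁ * r * (t * ω) + 3 / 2 * b * k * s * r * (t * ω) := by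
            have := mul_le_mul_of_nonneg_left (mul_le_mul_of_nonneg_right hut hω0)
              (show 0 ≤ 3 / 2 * b * k * s * r by positivity)
            linarith
        _ = α * (r * p) * η + (3 * e₁ + 3 / 2 * b * k * s) * r * (t * ω) := by
            rw [hu2, hα]; ring
        _ ≤ α * (r * p) * η + (3 * e₁ + 3 / 2 * b * k * s) * r * (Ka * r * (c₁ * p ^ 2)) := by
            have := mul_le_mul_of_nonneg_left htω
              (show 0 ≤ (3 * e₁ + 3 / 2 * b * k * s) * r by positivity)
            linarith
        _ = _ := by rw [hβ]; ring
    -- The linear term is absorbed by `6 x η ≤ η²/2 + 18 x²`.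
    have hfin : η ^ 2 ≤ 36 * (α * (r * p)) ^ 2 + 12 * (β * (r ^ 2 * p ^ 2)) := by
      nlinarith [sq_nonneg (η - 6 * (α * (r * p)))]
    have : 0 ≤ r ^ 2 * p ^ 2 := by positivity
    have hgoal : η ^ 2 ≤ (36 * α ^ 2 + 12 * β + 1) * (r ^ 2 * p ^ 2) := by linarith
    exact hgoal
  -- When `r ≥ 1` the target exceeds `η² ≤ 1` by itself; the summand `1` in the constant serves this
  -- case.
  · have h1 : 1 ≤ r ^ 2 * p ^ 2 := by
      rw [← mul_pow]; exact one_le_pow₀ (one_le_mul_of_one_le_of_one_le hr1 hp)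
    have h4 : η ^ 2 ≤ 1 := by nlinarith
    refine h4.trans ?_
    have h5 : (1 : ℝ) ≤ 36 * (e₂ + k * b ^ 2 + k * s * (b * c * q)) ^ 2 +
        12 * ((3 * e₁ + 3 / 2 * b * k * s) * Ka * c₁) + 1 := by
      have : 0 ≤ 36 * (e₂ + k * b ^ 2 + k * s * (b * c * q)) ^ 2 +
        12 * ((3 * e₁ + 3 / 2 * b * k * s) * Ka * c₁) := by positivity
      linarith
    exact one_le_mul_of_one_le_of_one_le h5 h1

end Rates

/-! ### The sample in matrix form. -/

section Sample

variable {n p d : ℕ}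

/-- The whitened noise matrix of a sample. -/
noncomputable def noiseMat (B Λ : Matrix (Fin p) (Fin p) ℝ) (Θ : Matrix (Fin d) (Fin p) ℝ)
    (z : Fin n → (Fin d → ℝ) × (Fin p → ℝ)) : Matrix (Fin n) (Fin p) ℝ :=
  Matrix.of fun i => whiteNoise B Λ Θ (z i)

theorem yMat_eq {B C Λ : Matrix (Fin p) (Fin p) ℝ} (hC : Cᵀ = C) (hBB : B * B = Λ)
    (hBC : B * C = 1) (hCB : C * B = 1) (Θ : Matrix (Fin d) (Fin p) ℝ)
    (z : Fin n → (Fin d → ℝ) × (Fin p → ℝ)) :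
    yMat z = noiseMat B Λ Θ z * C - xMat z * (Θ * C * C) := by
  have hrow : ∀ (m : ℕ) (M : Matrix (Fin n) (Fin m) ℝ) (A : Matrix (Fin m) (Fin p) ℝ) (i : Fin n),
      (M * A) i = Aᵀ *ᵥ M i := fun m M A i => by
    ext k
    simp only [mul_apply, mulVec, dotProduct, transpose_apply]
    exact Finset.sum_congr rfl fun _ _ => mul_comm _ _
  ext i k
  have h1 : (noiseMat B Λ Θ z * C) i = (z i).2 - condMean Λ Θ (z i).1 := by
    rw [hrow, hC]
    change C *ᵥ (B *ᵥ _) = _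
    rw [mulVec_mulVec, hCB, one_mulVec]
  have h2 : (xMat z * (Θ * C * C)) i = -condMean Λ Θ (z i).1 := by
    rw [hrow, condMean, neg_neg, inv_eq_of_sqrt hBB hBC, transpose_mul, transpose_mul, hC,
      Matrix.mul_assoc]
    rfl
  rw [Matrix.sub_apply, h1, h2]
  simp [yMat]

theorem gram_noise_entry {B Λ : Matrix (Fin p) (Fin p) ℝ} {Θ : Matrix (Fin d) (Fin p) ℝ}
    (z : Fin n → (Fin d → ℝ) × (Fin p → ℝ)) (k : Fin p) (j : Fin d) :
    gram (noiseMat B Λ Θ z) (xMat z) k j =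
      (n : ℝ)⁻¹ * ∑ i, (z i).1 j * whiteNoise B Λ Θ (z i) k := by
  simp only [gram, Matrix.smul_apply, mul_apply, transpose_apply, smul_eq_mul, noiseMat, xMat, of_apply]
  congr 1
  exact Finset.sum_congr rfl fun _ _ => mul_comm _ _

theorem gram_noise_sub_one_entry (hn : 0 < n) {B Λ : Matrix (Fin p) (Fin p) ℝ}
    {Θ : Matrix (Fin d) (Fin p) ℝ}
    (z : Fin n → (Fin d → ℝ) × (Fin p → ℝ)) (k l : Fin p) :
    (gram (noiseMat B Λ Θ z) (noiseMat B Λ Θ z) - 1) k l =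
      (n : ℝ)⁻¹ * ∑ i, (whiteNoise B Λ Θ (z i) k * whiteNoise B Λ Θ (z i) l -
        (1 : Matrix (Fin p) (Fin p) ℝ) k l) := by
  have : (n : ℝ) ≠ 0 := by positivity
  simp only [gram, Matrix.sub_apply, Matrix.smul_apply, mul_apply, transpose_apply, smul_eq_mul, noiseMat,
    of_apply, Finset.sum_sub_distrib, Finset.sum_const, Finset.card_univ, Fintype.card_fin,
    nsmul_eq_mul, mul_sub]
  rw [inv_mul_cancel_left₀ this]

theorem sum_sq_le_of_cX_le (hn : 0 < n) {X : Matrix (Fin n) (Fin d) ℝ} {c : ℝ} (h : cX X ≤ c)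
    (j : Fin d) : ∑ i, X i j ^ 2 ≤ n * c ^ 2 := by
  have hn' : (0 : ℝ) < n := by positivity
  have h1 : √(∑ i, X i j ^ 2) / √n ≤ c :=
    (le_ciSup (f := fun j => √(∑ i, X i j ^ 2) / √n) (Set.finite_range _).bddAbove j).trans h
  have h2 := pow_le_pow_left₀ (by positivity) h1 2
  rw [div_pow, Real.sq_sqrt (Finset.sum_nonneg fun _ _ => sq_nonneg _), Real.sq_sqrt hn'.le,
    div_le_iff₀ hn'] at h2
  linarith

theorem frob_sq_le_sTheta (Θ : Matrix (Fin d) (Fin p) ℝ) {c : ℝ} (h : maxAbs Θ ≤ c) :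
    frob Θ ^ 2 ≤ sTheta Θ * c ^ 2 := by
  classical
  have hs : (Finset.univ.filter fun e : Fin d × Fin p => Θ e.1 e.2 ≠ 0).card = sTheta Θ := by
    unfold sTheta; congr
  rw [frob_sq, ← Fintype.sum_prod_type' fun i j => Θ i j ^ 2, ← hs, ← nsmul_eq_mul,
    ← Finset.sum_const, Finset.sum_filter]
  refine Finset.sum_le_sum fun e _ => ?_
  split_ifs with he
  · have := (abs_le_maxAbs Θ e.1 e.2).trans h
    exact sq_le_sq.2 (this.trans (le_abs_self c))
  · rw [not_not.1 he]; simp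

end Sample

/-! ### The two exceptional events. -/

section Events

variable {n p d : ℕ}

/-- With `d` large, the Gram matrix is unlikely to satisfy `v j ^ 2 ≤ κ vᵀ S v`. -/
theorem exists_design_event (hn : 0 < n) (hd : 0 < d) {f : (Fin d → ℝ) → ℝ}
    {Λ : Matrix (Fin p) (Fin p) ℝ} (hf : IsDensity f) (hΛ : Λ.PosDef) (Θ : Matrix (Fin d) (Fin p) ℝ)
    {κ m : ℝ} (hκ : 0 < κ) (hm : 0 < m) (hfm : secondMoment f ≤ ENNReal.ofReal m) :
    ∃ bad : Set (Fin n → (Fin d → ℝ) × (Fin p → ℝ)), MeasurableSet bad ∧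
      sampleLaw n f Λ Θ bad ≤ ENNReal.ofReal (Real.exp (d - d * Real.log (d / (κ * m)))) ∧
      ∀ z ∉ bad, ¬ ∀ (v : Fin d → ℝ) (j : Fin d),
        v j ^ 2 ≤ κ * (v ⬝ᵥ (gram (xMat z) (xMat z) *ᵥ v)) := by
  have hn' : (0 : ℝ) < n := by positivity
  have hd' : (0 : ℝ) < d := by positivity
  -- The scale `s = d / (n m)` makes the mean of the product at most `exp (n s m) = exp d`, and the
  -- threshold is `(d / (κ m))^d`.
  obtain ⟨bad, hmeas, hprob, hbad⟩ := exists_design_tail n hf hΛ Θ hm.le hfm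
    (s := d / (n * m)) (by positivity) (d * Real.log (d / (κ * m)))
  refine ⟨bad, hmeas, ?_, fun z hz h => ?_⟩
  · have : (n : ℝ) * (d / (n * m) * m) = d := by field_simp
    rwa [this] at hprob
  · set s : ℝ := d / (n * m) with hs
    have hs0 : 0 < s := by positivity
    set X := xMat z with hX
    have hps : (Xᵀ * X).PosSemidef := by
      have := posSemidef_conjTranspose_mul_self X
      rwa [conjTranspose_eq_transpose_of_trivial] at this
    have hM : (1 + s • (Xᵀ * X)).PosDef := PosDef.one.add_posSemidef (hps.smul hs0.le)
    have hform : ∀ (v : Fin d → ℝ) (j : Fin d),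
        v j ^ 2 ≤ κ * m / d * (v ⬝ᵥ ((1 + s • (Xᵀ * X)) *ᵥ v)) := by
      intro v j
      refine (h v j).trans ?_
      have hg : v ⬝ᵥ (gram X X *ᵥ v) = (n : ℝ)⁻¹ * (v ⬝ᵥ ((Xᵀ * X) *ᵥ v)) := by
        rw [gram, smul_mulVec, dotProduct_smul, smul_eq_mul]
      rw [hg, add_mulVec, one_mulVec, dotProduct_add, smul_mulVec, dotProduct_smul,
        smul_eq_mul, mul_add]
      have h0 : 0 ≤ κ * m / d * (v ⬝ᵥ v) :=
        mul_nonneg (by positivity) (dotProduct_self_nonneg' v)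
      have h1 : κ * m / d * (s * (v ⬝ᵥ ((Xᵀ * X) *ᵥ v))) =
          κ * ((n : ℝ)⁻¹ * (v ⬝ᵥ ((Xᵀ * X) *ᵥ v))) := by
        rw [hs]; field_simp
      linarith
    -- The conditioning would force the ridge determinant up to `(d / (κ m))^d`, while it is bounded
    -- by the product over the rows, which is smaller off the bad set.
    have h1 := pow_le_det_of_sq_le_form hM (by positivity) hform
    have h2 := det_one_add_smul_transpose_mul_le X hs0.le
    have h3 := hbad z hz
    have h4 : Real.exp (d * Real.log (d / (κ * m))) = (d / (κ * m)) ^ d := by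
      rw [mul_comm, ← Real.rpow_def_of_pos (by positivity), Real.rpow_natCast]
    rw [h4] at h3
    rw [Fintype.card_fin, inv_div] at h1
    exact absurd (h1.trans h2) (not_le.2 h3)

/-- The first cube gives `log (d / (κ m)) ≥ 2`, so the exponent is at most `-d`. The second gives `d
≥ 3 (τ - 2) p^{1/3} ≥ (τ - 2) log p`, by `log p ≤ 3 p^{1/3}`. -/
theorem exp_sub_mul_log_le (hp : 0 < p) {κ m τ : ℝ} (hκ : 0 < κ) (hm : 0 < m)
    (hτ : 2 < τ)
    (h : ((Real.exp 2 * (κ * m)) ^ 3 + (3 * (τ - 2)) ^ 3) * p < (d : ℝ) ^ 3) :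
    Real.exp (d - d * Real.log (d / (κ * m))) ≤ (p : ℝ) ^ (-(τ - 2)) := by
  have hp1 : (1 : ℝ) ≤ p := by exact_mod_cast hp
  have hp0 : (0 : ℝ) < p := by positivity
  have hd0 : (0 : ℝ) ≤ d := by positivity
  have hτ' : 0 < τ - 2 := by linarith
  have hκm : 0 < κ * m := by positivity
  have hE : 0 < Real.exp 2 * (κ * m) := by positivity
  have h1 : (Real.exp 2 * (κ * m)) ^ 3 < (d : ℝ) ^ 3 := by
    refine lt_of_le_of_lt ?_ h
    have : 0 < (3 * (τ - 2)) ^ 3 := by positivity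
    nlinarith [pow_pos hE 3]
  have h1' : Real.exp 2 * (κ * m) < d := lt_of_pow_lt_pow_left₀ 3 hd0 h1
  have hlog : 2 ≤ Real.log (d / (κ * m)) := by
    rw [Real.le_log_iff_exp_le (div_pos (hE.trans h1') hκm), le_div_iff₀ hκm]
    exact h1'.le
  set u : ℝ := (p : ℝ) ^ (1 / 3 : ℝ) with hu
  have hu0 : 0 < u := by positivity
  have hu3 : u ^ 3 = p := by
    rw [hu, ← Real.rpow_natCast, ← Real.rpow_mul hp0.le]; norm_num
  have h2 : (3 * (τ - 2) * u) ^ 3 < (d : ℝ) ^ 3 := by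
    refine lt_of_le_of_lt ?_ h
    rw [mul_pow, hu3]
    have := pow_pos hE 3
    nlinarith
  have h2' : 3 * (τ - 2) * u < d := lt_of_pow_lt_pow_left₀ 3 hd0 h2
  have hlp : Real.log p ≤ 3 * u := by
    rw [← hu3, Real.log_pow]
    have := Real.log_le_sub_one_of_pos hu0
    push_cast
    linarith
  rw [Real.rpow_def_of_pos hp0]
  refine Real.exp_le_exp.2 ?_
  have h3 := mul_le_mul_of_nonneg_left hlp hτ'.le
  have h4 := mul_le_mul_of_nonneg_left hlog hd0
  linarith

/-- Each tail is `(pd)^{-(τ+3)}`, and the union bounds count at most `2dp + 2p² ≤ (pd)⁴` events. The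
cross term is self-normalized, so the bound `c` on `cX` may be imposed after the event is chosen. -/
theorem exists_noise_event (hn : 0 < n) (hp : 2 ≤ p) (hd : 0 < d) {f : (Fin d → ℝ) → ℝ}
    {Λ B C : Matrix (Fin p) (Fin p) ℝ} (hf : IsDensity f) (hΛ : Λ.PosDef) (hB : Bᵀ = B)
    (hBB : B * B = Λ) (hBC : B * C = 1) (Θ : Matrix (Fin d) (Fin p) ℝ) {τ r : ℝ} (hr : 0 < r)
    (hr2 : n * r ^ 2 = Real.log (p * d)) :
    ∃ bad : Set (Fin n → (Fin d → ℝ) × (Fin p → ℝ)), MeasurableSet bad ∧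
      sampleLaw n f Λ Θ bad ≤ ENNReal.ofReal (((p : ℝ) * d) ^ (-(τ - 1))) ∧
      ∀ z ∉ bad,
        (∀ c, cX (xMat z) ≤ c → ∀ k j,
          |gram (noiseMat B Λ Θ z) (xMat z) k j| ≤ (τ + 3 + c ^ 2 / 2) * r) ∧
        (r ≤ 1 → ∀ k l,
          |(gram (noiseMat B Λ Θ z) (noiseMat B Λ Θ z) - 1) k l| ≤ (4 * (τ + 3) + 1) * r) := by
  have hn' : (0 : ℝ) < n := by positivity
  have hp2 : (2 : ℝ) ≤ p := by exact_mod_cast hp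
  have hd1 : (1 : ℝ) ≤ d := by exact_mod_cast hd
  set L := Real.log (p * d) with hL
  set Q : ℝ := p * d with hQ
  have hQ2 : 2 ≤ Q := by nlinarith
  have hpQ : (p : ℝ) ≤ Q := by nlinarith
  have hQ0 : 0 < Q := by linarith
  obtain ⟨b₁, hm₁, hP₁, hb₁⟩ := exists_cross_tail n hf hΛ hB hBB hBC Θ r ((τ + 3) * L)
  have hgram : ∃ b₂ : Set (Fin n → (Fin d → ℝ) × (Fin p → ℝ)), MeasurableSet b₂ ∧
      sampleLaw n f Λ Θ b₂ ≤ ENNReal.ofReal (2 * (p * p) * Real.exp (-((τ + 3) * L))) ∧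
      ∀ z ∉ b₂, r ≤ 1 → ∀ k l,
        |(gram (noiseMat B Λ Θ z) (noiseMat B Λ Θ z) - 1) k l| ≤ (4 * (τ + 3) + 1) * r := by
    -- The Chernoff parameter `r / 4` must not exceed `1/4`. Its cost `n * 4 * (r / 4)²` is `L / 4`,
    -- which explains the extra `1/4` in the threshold.
    by_cases hr1 : r ≤ 1
    · obtain ⟨b₂, hm₂, hP₂, hb₂⟩ := exists_gram_tail n hf hΛ hB hBB hBC Θ (s := r / 4)
        (by rw [abs_of_pos (by positivity)]; linarith) ((τ + 3 + 1 / 4) * L)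
      refine ⟨b₂, hm₂, ?_, fun z hz _ k l => ?_⟩
      · have : (n : ℝ) * (4 * (r / 4) ^ 2) - (τ + 3 + 1 / 4) * L = -((τ + 3) * L) := by
          rw [← hr2]; ring
        rwa [this] at hP₂
      · have h := hb₂ z hz k l
        rw [abs_mul, abs_of_pos (by positivity : 0 < r / 4), ← hr2] at h
        rw [gram_noise_sub_one_entry hn, abs_mul, abs_of_pos (by positivity : 0 < (n : ℝ)⁻¹),
          inv_mul_le_iff₀ hn']
        have h' : r * |∑ i, (whiteNoise B Λ Θ (z i) k * whiteNoise B Λ Θ (z i) l -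
            (1 : Matrix (Fin p) (Fin p) ℝ) k l)| ≤ r * (n * ((4 * (τ + 3) + 1) * r)) := by
          linarith
        exact le_of_mul_le_mul_left h' hr
    · exact ⟨∅, MeasurableSet.empty, by simp, fun z _ h => absurd h hr1⟩
  obtain ⟨b₂, hm₂, hP₂, hb₂⟩ := hgram
  refine ⟨b₁ ∪ b₂, hm₁.union hm₂, ?_, fun z hz => ⟨fun c hc k j => ?_, fun h k l => ?_⟩⟩
  · refine (measure_union_le _ _).trans ((add_le_add hP₁ hP₂).trans ?_)
    rw [← ENNReal.ofReal_add (by positivity) (by positivity)]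
    refine ENNReal.ofReal_le_ofReal ?_
    have hexp : Q ^ 4 * Real.exp (-((τ + 3) * L)) = Q ^ (-(τ - 1)) := by
      have h4 : Q ^ 4 = Real.exp (L * 4) := by
        rw [hL, Real.exp_mul, Real.exp_log hQ0]; norm_cast
      rw [Real.rpow_def_of_pos hQ0, h4, ← Real.exp_add]
      congr 1; ring
    rw [← hexp, ← add_mul]
    refine mul_le_mul_of_nonneg_right ?_ (Real.exp_pos _).le
    have hpp : (p : ℝ) * p ≤ Q * Q := by gcongr
    calc 2 * ((d : ℝ) * p) + 2 * (p * p) ≤ 2 * Q + 2 * (Q * Q) := by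
          rw [hQ] at *; linarith
      _ ≤ Q ^ 4 := by
        nlinarith [mul_le_mul hQ2 hQ2 (by norm_num) hQ0.le, sq_nonneg (Q ^ 2 - 4), sq_nonneg Q]
  · rw [Set.mem_union, not_or] at hz
    have h := hb₁ z hz.1 j k
    have hX := sum_sq_le_of_cX_le hn hc j
    simp only [xMat, of_apply] at hX
    rw [abs_mul, abs_of_pos hr, ← hr2] at h
    rw [gram_noise_entry, abs_mul, abs_of_pos (by positivity : 0 < (n : ℝ)⁻¹),
      inv_mul_le_iff₀ hn']
    have h2 := mul_le_mul_of_nonneg_left hX (by positivity : 0 ≤ r ^ 2 / 2)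
    have h' : r * |∑ i, (z i).1 j * whiteNoise B Λ Θ (z i) k| ≤
        r * (n * ((τ + 3 + c ^ 2 / 2) * r)) := by linarith
    exact le_of_mul_le_mul_left h' hr
  · rw [Set.mem_union, not_or] at hz
    exact hb₂ z hz.2 h k l

end Events

/-! ### The divergence bound off the exceptional events. -/

section Bounds

variable {n p d : ℕ}

theorem cX_nonneg (X : Matrix (Fin n) (Fin d) ℝ) : 0 ≤ cX X :=
  Real.iSup_nonneg fun _ => by positivity

theorem regLevel_le (hp : 2 ≤ p) (hd : 0 < d) {X : Matrix (Fin n) (Fin d) ℝ}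
    {Λ : Matrix (Fin p) (Fin p) ℝ} {τ α a c : ℝ} (hτ : 0 ≤ τ) (hα : 0 < α) (ha : 0 ≤ a)
    (hΛ : ∀ i, Λ⁻¹ i i ≤ a) (hc : cX X ≤ c) :
    regLevel X Λ τ α ≤
      8 * α⁻¹ * a * max (c ^ 2) 1 * √3200 * √(τ + 2) * √(Real.log (p * d) / n) := by
  have hp2 : (2 : ℝ) ≤ p := by exact_mod_cast hp
  have hd1 : (1 : ℝ) ≤ d := by exact_mod_cast hd
  have : Nonempty (Fin p) := ⟨⟨0, by omega⟩⟩
  have hσ : cSigma Λ ≤ a := ciSup_le hΛ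
  have hX : cX X ^ 2 ≤ c ^ 2 := pow_le_pow_left₀ (cX_nonneg X) hc 2
  -- Since `p d ≥ 2`, the constant `log 4` is absorbed, changing `τ` into `τ + 2`.
  have hlog : Real.log 4 ≤ 2 * Real.log (p * d) := by
    rw [show (4 : ℝ) = 2 ^ 2 by norm_num, Real.log_pow]
    push_cast
    have := Real.log_le_log (by norm_num : (0 : ℝ) < 2) (by nlinarith : (2 : ℝ) ≤ p * d)
    linarith
  have hs : √((τ * Real.log (p * d) + Real.log 4) / n) ≤
      √(τ + 2) * √(Real.log (p * d) / n) := by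
    rw [← Real.sqrt_mul (by linarith), ← mul_div_assoc]
    refine Real.sqrt_le_sqrt (div_le_div_of_nonneg_right ?_ (by positivity))
    linarith
  rw [regLevel, mul_assoc (8 * α⁻¹ * a * max (c ^ 2) 1 * √3200)]
  refine mul_le_mul ?_ hs (by positivity) (by positivity)
  refine mul_le_mul_of_nonneg_right ?_ (by positivity)
  refine mul_le_mul ?_ (max_le_max hX le_rfl) (by positivity) (by positivity)
  exact mul_le_mul_of_nonneg_left hσ (by positivity)

/-- The divergence bound on the event of small noise. -/
theorem condSKL_le_of_noise_bounds {B C Λ₀ : Matrix (Fin p) (Fin p) ℝ} (hp : 0 < p) (hd : 0 < d)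
    (hB : Bᵀ = B) (hC : Cᵀ = C) (hBB : B * B = Λ₀) (hBC : B * C = 1) (hCB : C * B = 1)
    (hΛ₀ : Λ₀.PosDef) {b c : ℝ} (hb : 0 ≤ b) (hc : 0 ≤ c)
    (hBb : ∀ v, (B *ᵥ v) ⬝ᵥ (B *ᵥ v) ≤ b ^ 2 * (v ⬝ᵥ v))
    (hCc : ∀ v, (C *ᵥ v) ⬝ᵥ (C *ᵥ v) ≤ c ^ 2 * (v ⬝ᵥ v)) {Θ₀ : Matrix (Fin d) (Fin p) ℝ}
    {f₀ f' : (Fin d → ℝ) → ℝ} (hf₀ : IsDensity f₀) (hf' : IsDensity f') {m : ℝ} (hm : 0 ≤ m)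
    (hm₀ : secondMoment f₀ ≤ ENNReal.ofReal m) (hm' : secondMoment f' ≤ ENNReal.ofReal m)
    {z : Fin n → (Fin d → ℝ) × (Fin p → ℝ)} {κ e₁ e₂ k s q c₁ r lam₂ lam₃ : ℝ} (hκ : 0 < κ)
    (hκX : ∀ (v : Fin d → ℝ) j, v j ^ 2 ≤ κ * (v ⬝ᵥ (gram (xMat z) (xMat z) *ᵥ v)))
    (hdp : (d : ℝ) ^ 3 ≤ c₁ * p) (hr : 0 ≤ r) (he₁ : 0 ≤ e₁) (he₂ : 0 ≤ e₂) (hk : 0 ≤ k)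
    (hs : 0 ≤ s) (hq : 0 ≤ q)
    (hV : ∀ i j, |gram (noiseMat B Λ₀ Θ₀ z) (xMat z) i j| ≤ e₁ * r)
    (hρ : (∀ i j, |(gram (noiseMat B Λ₀ Θ₀ z) (noiseMat B Λ₀ Θ₀ z) - 1) i j| ≤ e₂ * r) ∨ 1 ≤ r)
    (h₂ : 0 ≤ lam₂) (h₃ : 0 ≤ lam₃) (h₂' : lam₂ ≤ k * r) (h₃' : lam₃ ≤ k * r)
    (hsΘ : √(sTheta Θ₀) ≤ s * √p) (hqΘ : frob Θ₀ ≤ q * √p)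
    {Λ' : Matrix (Fin p) (Fin p) ℝ} {Θ' : Matrix (Fin d) (Fin p) ℝ}
    (hest : IsEstimate (xMat z) (yMat z) lam₂ lam₃ Λ' Θ')
    (hclose : c * (c * frob (Λ' - Λ₀)) ≤ 1 / 2) :
    condSKL f₀ Λ₀ Θ₀ f' Λ' Θ' ≤ ENNReal.ofReal (2 *
      ((36 * (e₂ + k * b ^ 2 + k * s * (b * c * q)) ^ 2 +
        12 * ((3 * e₁ + 3 / 2 * b * k * s) * (2 * κ * (3 * e₁ + 3 / 2 * b * k)) * c₁) + 1) +
      (2 * κ * (3 * e₁ + 3 / 2 * b * k)) ^ 2 * c₁ * m) * (r ^ 2 * p ^ 2)) := by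
  have hp1 : (1 : ℝ) ≤ p := by exact_mod_cast hp
  have hd1 : (1 : ℝ) ≤ d := by exact_mod_cast hd
  have hΛ' : Λ'.PosDef := hest.1
  have hu : IsUnit Λ'.det := hΛ'.det_pos.ne'.isUnit
  set N := C * (Λ' - Λ₀) * C with hNdef
  set W := (Θ₀ * C * C - Θ' * Λ'⁻¹) * B with hW
  have hN : Nᵀ = N := by
    rw [hNdef]
    simp only [transpose_mul, transpose_sub, hC, transpose_of_posDef hΛ', transpose_of_posDef hΛ₀,
      Matrix.mul_assoc]
  have hN2 : frob N ≤ 1 / 2 :=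
    (frob_mul_le_right hC hc hCc _).trans
      ((mul_le_mul_of_nonneg_left (frob_mul_le_of_form hc hCc _) hc).trans hclose)
  have hNΛ : B * (1 + N) * B = Λ' := by
    have h1 : B * N * B = Λ' - Λ₀ := by
      calc B * N * B = (B * C) * (Λ' - Λ₀) * (C * B) := by
            rw [hNdef]; simp only [Matrix.mul_assoc]
        _ = _ := by rw [hBC, hCB, Matrix.one_mul, Matrix.mul_one]
    rw [Matrix.mul_add, Matrix.add_mul, h1, Matrix.mul_one, hBB]
    abel
  have hΘ' : (Θ₀ * C * C - W * C) * (B * (1 + N) * B) = Θ' := by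
    have h1 : W * C = Θ₀ * C * C - Θ' * Λ'⁻¹ := by
      rw [hW, Matrix.mul_assoc, hBC, Matrix.mul_one]
    rw [h1, sub_sub_cancel, hNΛ, Matrix.mul_assoc, nonsing_inv_mul _ hu, Matrix.mul_one]
  have hest' : IsEstimate (xMat z) (noiseMat B Λ₀ Θ₀ z * C - xMat z * (Θ₀ * C * C)) lam₂ lam₃
      (B * (1 + N) * B) ((Θ₀ * C * C - W * C) * (B * (1 + N) * B)) := by
    rw [hΘ', hNΛ, ← yMat_eq hC hBB hBC hCB]
    exact hest
  obtain ⟨i1, i2⟩ := basic_inequalities hB hC hBB hBC hCB hΛ₀ hb hc hBb hCc hN hN2 Θ₀ W h₂ h₃ hest'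
    hκ hd hκX
  have hV' := frob_le_of_abs_le hV (by positivity)
  rw [Fintype.card_fin, Fintype.card_fin, mul_comm (p : ℝ)] at hV'
  have hρ' : frob (gram (noiseMat B Λ₀ Θ₀ z) (noiseMat B Λ₀ Θ₀ z) - 1) ≤ e₂ * r * p ∨ 1 ≤ r := by
    refine hρ.imp_left fun h => ?_
    have := frob_le_of_abs_le h (by positivity)
    rwa [Fintype.card_fin, Real.sqrt_mul_self (by positivity)] at this
  obtain ⟨hω, hη⟩ := rates_of_basic_inequalities (frob_nonneg N) (frob_nonneg W) hr (frob_nonneg _)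
    h₃ (Real.sqrt_nonneg _) (frob_nonneg Θ₀) hb hc hκ.le hd1 hp1 he₁ he₂ hk hs hq hdp i1 i2
    hV' h₂' h₃' hsΘ hqΘ hρ' hN2
  refine (condSKL_le hB hC hBB hBC hCB hΛ₀ hΛ' hN hN2 hNΛ hW hf₀ hf' hm hm₀ hm').trans
    (ENNReal.ofReal_le_ofReal ?_)
  have := mul_le_mul_of_nonneg_right hω hm
  linarith

end Bounds

/-! ### Probability of the complement, sparsity bounds and the final rate. -/

section Final

variable {n p d : ℕ}

theorem failProb_nonneg (p d : ℕ) (τ : ℝ) : 0 ≤ failProb p d τ := by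
  unfold failProb; positivity

theorem le_compl_of_measure_le {E : Type*} [MeasurableSpace E] {μ : Measure E}
    [IsProbabilityMeasure μ] {bad : Set E} (hm : MeasurableSet bad) {ε : ℝ} (hε : 0 ≤ ε)
    (h : μ bad ≤ ENNReal.ofReal ε) : ENNReal.ofReal (1 - ε) ≤ μ badᶜ := by
  rw [prob_compl_eq_one_sub hm, ENNReal.ofReal_sub 1 hε, ENNReal.ofReal_one]
  exact tsub_le_tsub_left h 1

theorem inv_apply_self_le {A B C : Matrix (Fin p) (Fin p) ℝ} (hC : Cᵀ = C) (hBB : B * B = A)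
    (hBC : B * C = 1) {a : ℝ} (h : ∀ v, (C *ᵥ v) ⬝ᵥ (C *ᵥ v) ≤ a * (v ⬝ᵥ v)) (i : Fin p) :
    A⁻¹ i i ≤ a := by
  have h1 := h (Pi.single i 1)
  rw [dotProduct_single, Pi.single_eq_same, mul_one, mul_one, mulVec_single_one] at h1
  rw [inv_eq_of_sqrt hBB hBC, mul_apply]
  refine le_trans (le_of_eq ?_) h1
  refine Finset.sum_congr rfl fun j _ => ?_
  have : C i j = C j i := by conv_lhs => rw [← hC, transpose_apply]
  rw [this]; rfl

/-- The errors are bounded by the second term of the rate alone; the first is nonnegative. -/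
theorem mul_sq_log_le_rate (n p d : ℕ) :
    (n : ℝ)⁻¹ * (p : ℝ) ^ 2 * Real.log (p * d) ≤ rate n p d := by
  have h : 0 ≤ Real.log ((p : ℝ) * d) := by
    rw [← Nat.cast_mul]; exact Real.log_natCast_nonneg _
  have : 0 ≤ (n : ℝ) ^ (-(5 / 2) : ℝ) * (p : ℝ) ^ (5 / 2 : ℝ) *
      Real.log (p * d) ^ (5 / 2 : ℝ) := by positivity
  unfold rate
  linarith

theorem sqrt_sTheta_le {Θ : Matrix (Fin d) (Fin p) ℝ} {s : ℝ} (h : (sTheta Θ : ℝ) ≤ s * p) :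
    √(sTheta Θ) ≤ √(max s 0) * √p := by
  rw [← Real.sqrt_mul (le_max_right _ _)]
  exact Real.sqrt_le_sqrt (h.trans (mul_le_mul_of_nonneg_right (le_max_left _ _) (by positivity)))

theorem frob_le_of_sTheta_le {Θ : Matrix (Fin d) (Fin p) ℝ} {s c : ℝ}
    (h : (sTheta Θ : ℝ) ≤ s * p) (hc : maxAbs Θ ≤ c) :
    frob Θ ≤ |c| * √(max s 0) * √p := by
  refine (pow_le_pow_iff_left₀ (frob_nonneg Θ) (by positivity) two_ne_zero).1 ?_
  refine (frob_sq_le_sTheta Θ hc).trans ?_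
  have h1 := pow_le_pow_left₀ (Real.sqrt_nonneg _) (sqrt_sTheta_le h) 2
  rw [Real.sq_sqrt (by positivity)] at h1
  calc (sTheta Θ : ℝ) * c ^ 2 ≤ (√(max s 0) * √p) ^ 2 * c ^ 2 := by gcongr
    _ = _ := by rw [← sq_abs c]; ring

end Final

end CGGM

/-! ### Constants and case distinction for the theorem. -/

theorem theorem2 (C_L C_U τ α κ₀ cX₀ cΘ₀ s₀ m₀ : ℝ) (hCL : 0 < C_L) (hCLU : C_L ≤ C_U)
    (hτ : 2 < τ) (hα : α ∈ Set.Ioo (0 : ℝ) 1) :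
    ∃ K : ℝ, 0 < K ∧
      ∀ (n p d : ℕ), 0 < n → 0 < p → 0 < d →
      ∀ (Λ₀ : Matrix (Fin p) (Fin p) ℝ) (Θ₀ : Matrix (Fin d) (Fin p) ℝ) (f₀ : (Fin d → ℝ) → ℝ)
        (hΛ₀ : Λ₀.IsHermitian),
        (∀ i, C_L ≤ hΛ₀.eigenvalues i ∧ hΛ₀.eigenvalues i ≤ C_U) →
        CGGM.maxAbs Θ₀ ≤ cΘ₀ →
        (p + CGGM.sLambda Λ₀ : ℝ) ≤ s₀ * p →
        (CGGM.sTheta Θ₀ : ℝ) ≤ s₀ * p →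
        CGGM.IsDensity f₀ →
        CGGM.secondMoment f₀ ≤ ENNReal.ofReal m₀ →
        ∃ A : Set (Fin n → (Fin d → ℝ) × (Fin p → ℝ)), MeasurableSet A ∧
          ENNReal.ofReal (1 - CGGM.failProb p d τ) ≤ CGGM.sampleLaw n f₀ Λ₀ Θ₀ A ∧
          ∀ z ∈ A,
            CGGM.RestrictedConvexity (CGGM.xMat z) Θ₀ →
            IsUnit (CGGM.hessian (CGGM.xMat z) Λ₀ Θ₀).det →
            CGGM.MutualIncoherence (CGGM.xMat z) Λ₀ Θ₀ α →
            CGGM.SampleSizeBound (CGGM.xMat z) Λ₀ Θ₀ τ α →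
            CGGM.kappaH (CGGM.xMat z) Λ₀ Θ₀ ≤ κ₀ →
            CGGM.cX (CGGM.xMat z) ≤ cX₀ →
            ∀ (lam₂ lam₃ : ℝ), 0 ≤ lam₂ → 0 ≤ lam₃ →
              max lam₂ lam₃ = CGGM.regLevel (CGGM.xMat z) Λ₀ τ α →
            ∀ (Λ' : Matrix (Fin p) (Fin p) ℝ) (Θ' : Matrix (Fin d) (Fin p) ℝ),
              CGGM.IsEstimate (CGGM.xMat z) (CGGM.yMat z) lam₂ lam₃ Λ' Θ' →
            ∀ f' : (Fin d → ℝ) → ℝ,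
              CGGM.IsDensity f' →
              CGGM.secondMoment f' ≤ ENNReal.ofReal m₀ →
              CGGM.frob (Λ' - Λ₀) ≤ C_L / 2 →
              CGGM.condSKL f₀ Λ₀ Θ₀ f' Λ' Θ' ≤ ENNReal.ofReal (K * CGGM.rate n p d) := by
  -- The maxima with `1` make `m` and `κ` positive. The factor `2 C_L⁻¹` in `κ` is that of
  -- `sq_le_gram_form`, and `c₁` is the threshold of `exp_sub_mul_log_le`.
  obtain ⟨m, hm⟩ : ∃ m, m = max m₀ 1 := ⟨_, rfl⟩
  obtain ⟨κ, hκ⟩ : ∃ κ, κ = 2 * C_L⁻¹ * max κ₀ 1 := ⟨_, rfl⟩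
  obtain ⟨c₁, hc₁⟩ : ∃ c₁, c₁ = (Real.exp 2 * (κ * m)) ^ 3 + (3 * (τ - 2)) ^ 3 := ⟨_, rfl⟩
  obtain ⟨e₁, he₁⟩ : ∃ e₁, e₁ = τ + 3 + cX₀ ^ 2 / 2 := ⟨_, rfl⟩
  obtain ⟨e₂, he₂⟩ : ∃ e₂, e₂ = 4 * (τ + 3) + 1 := ⟨_, rfl⟩
  obtain ⟨k, hk⟩ : ∃ k, k = 8 * α⁻¹ * C_L⁻¹ * max (cX₀ ^ 2) 1 * √3200 * √(τ + 2) := ⟨_, rfl⟩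
  obtain ⟨s, hs⟩ : ∃ s, s = √(max s₀ 0) := ⟨_, rfl⟩
  obtain ⟨q, hq⟩ : ∃ q, q = |cΘ₀| * √(max s₀ 0) := ⟨_, rfl⟩
  obtain ⟨b, hb⟩ : ∃ b, b = √C_U := ⟨_, rfl⟩
  obtain ⟨c, hc⟩ : ∃ c, c = √C_L⁻¹ := ⟨_, rfl⟩
  have hα0 : 0 < α := hα.1
  have hCLi : 0 < C_L⁻¹ := inv_pos.2 hCL
  have hτ2 : 0 < τ - 2 := by linarith
  have hm0 : 0 < m := hm ▸ lt_max_of_lt_right one_pos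
  have hκ0 : 0 < κ := by
    have : 0 < max κ₀ 1 := lt_max_of_lt_right one_pos
    rw [hκ]; positivity
  have hc₁0 : 0 ≤ c₁ := by rw [hc₁]; positivity
  have he₁0 : 0 ≤ e₁ := by rw [he₁]; positivity
  have he₂0 : 0 ≤ e₂ := by rw [he₂]; positivity
  have hk0 : 0 ≤ k := by rw [hk]; positivity
  have hs0 : 0 ≤ s := by rw [hs]; positivity
  have hq0 : 0 ≤ q := by rw [hq]; positivity
  have hb0 : 0 ≤ b := by rw [hb]; positivity
  have hc0 : 0 ≤ c := by rw [hc]; positivity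
  have hb2 : b ^ 2 = C_U := by rw [hb, Real.sq_sqrt (hCL.le.trans hCLU)]
  have hc2 : c ^ 2 = C_L⁻¹ := by rw [hc, Real.sq_sqrt hCLi.le]
  have hmm : ∀ {d : ℕ} {f : (Fin d → ℝ) → ℝ}, CGGM.secondMoment f ≤ ENNReal.ofReal m₀ →
      CGGM.secondMoment f ≤ ENNReal.ofReal m := fun h =>
    h.trans (ENNReal.ofReal_le_ofReal (hm ▸ le_max_left _ _))
  obtain ⟨K, hK⟩ : ∃ K, K = 2 *
      ((36 * (e₂ + k * b ^ 2 + k * s * (b * c * q)) ^ 2 +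
        12 * ((3 * e₁ + 3 / 2 * b * k * s) * (2 * κ * (3 * e₁ + 3 / 2 * b * k)) * c₁) + 1) +
      (2 * κ * (3 * e₁ + 3 / 2 * b * k)) ^ 2 * c₁ * m) := ⟨_, rfl⟩
  have hK0 : 0 < K := by rw [hK]; positivity
  refine ⟨K, hK0, ?_⟩
  intro n p d hn hp hd Λ₀ Θ₀ f₀ hΛ₀ heig hΘ _ hsΘ hf₀ hfm
  have hpd : Λ₀.PosDef := hΛ₀.posDef_iff_eigenvalues_pos.2 fun i => hCL.trans_le (heig i).1
  have := CGGM.isProbabilityMeasure_jointLaw hf₀ hpd Θ₀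
  have : IsProbabilityMeasure (CGGM.sampleLaw n f₀ Λ₀ Θ₀) := by
    unfold CGGM.sampleLaw; infer_instance
  obtain ⟨B, C, hB, hC, hBB, hBC, hCB, hBb, hCc⟩ := CGGM.exists_sqrt hΛ₀ hCL heig
  have hinv := CGGM.inv_apply_self_le hC hBB hBC hCc
  have hκX : ∀ z : Fin n → (Fin d → ℝ) × (Fin p → ℝ),
      IsUnit (CGGM.hessian (CGGM.xMat z) Λ₀ Θ₀).det →
      CGGM.kappaH (CGGM.xMat z) Λ₀ Θ₀ ≤ κ₀ → ∀ (v : Fin d → ℝ) (j : Fin d),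
        v j ^ 2 ≤ κ * (v ⬝ᵥ (CGGM.gram (CGGM.xMat z) (CGGM.xMat z) *ᵥ v)) :=
    fun z hu hle => hκ ▸ CGGM.sq_le_gram_form hpd hu (hle.trans (le_max_left _ _)) ⟨0, hp⟩ (hinv _)
  have hfail := CGGM.failProb_nonneg p d τ
  suffices h : ∃ bad : Set (Fin n → (Fin d → ℝ) × (Fin p → ℝ)), MeasurableSet bad ∧
      CGGM.sampleLaw n f₀ Λ₀ Θ₀ bad ≤ ENNReal.ofReal (CGGM.failProb p d τ) ∧
      ∀ z ∉ bad, IsUnit (CGGM.hessian (CGGM.xMat z) Λ₀ Θ₀).det →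
        CGGM.kappaH (CGGM.xMat z) Λ₀ Θ₀ ≤ κ₀ → CGGM.cX (CGGM.xMat z) ≤ cX₀ →
        ∀ (lam₂ lam₃ : ℝ), 0 ≤ lam₂ → 0 ≤ lam₃ →
          max lam₂ lam₃ = CGGM.regLevel (CGGM.xMat z) Λ₀ τ α →
        ∀ (Λ' : Matrix (Fin p) (Fin p) ℝ) (Θ' : Matrix (Fin d) (Fin p) ℝ),
          CGGM.IsEstimate (CGGM.xMat z) (CGGM.yMat z) lam₂ lam₃ Λ' Θ' →
        ∀ f' : (Fin d → ℝ) → ℝ, CGGM.IsDensity f' →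
          CGGM.secondMoment f' ≤ ENNReal.ofReal m₀ → CGGM.frob (Λ' - Λ₀) ≤ C_L / 2 →
          CGGM.condSKL f₀ Λ₀ Θ₀ f' Λ' Θ' ≤ ENNReal.ofReal (K * CGGM.rate n p d) by
    obtain ⟨bad, hmeas, hprob, hgood⟩ := h
    exact ⟨badᶜ, hmeas.compl, CGGM.le_compl_of_measure_le hmeas hfail hprob,
      fun z hz _ hu _ _ => hgood z hz hu⟩
  have hp0 : (0 : ℝ) ≤ (p : ℝ) ^ (-(τ - 2)) := by positivity
  have hpd0 : (0 : ℝ) ≤ ((p : ℝ) * d) ^ (-(τ - 1)) := by positivity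
  -- For `p = 1` the allowed failure probability is at least `1`, so the whole space may be
  -- exceptional.
  rcases (show p = 1 ∨ 2 ≤ p by omega) with rfl | hp2
  · refine ⟨Set.univ, MeasurableSet.univ, ?_, fun z hz => absurd (Set.mem_univ z) hz⟩
    rw [measure_univ, ← ENNReal.ofReal_one]
    refine ENNReal.ofReal_le_ofReal ?_
    simp only [Nat.cast_one] at hpd0
    simp only [CGGM.failProb, Nat.cast_one, Real.one_rpow]
    linarith
  -- For large `d` the Hessian conditions fail outside the exceptional set, so the conclusion is
  -- vacuous there; otherwise the noise bounds apply.
  rcases lt_or_ge (c₁ * p) ((d : ℝ) ^ 3) with hcase | hdp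
  · obtain ⟨bad, hmeas, hprob, hbad⟩ :=
      CGGM.exists_design_event hn hd hf₀ hpd Θ₀ hκ0 hm0 (hmm hfm)
    refine ⟨bad, hmeas, hprob.trans (ENNReal.ofReal_le_ofReal ?_),
      fun z hz hu hle => absurd (hκX z hu hle) (hbad z hz)⟩
    have := CGGM.exp_sub_mul_log_le hp hκ0 hm0 hτ (hc₁ ▸ hcase)
    unfold CGGM.failProb
    linarith
  have hn0 : (0 : ℝ) < n := by positivity
  have hp2' : (2 : ℝ) ≤ p := by exact_mod_cast hp2
  have hd1 : (1 : ℝ) ≤ d := by exact_mod_cast hd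
  have hL : 0 < Real.log ((p : ℝ) * d) := Real.log_pos (by nlinarith)
  obtain ⟨r, hr⟩ : ∃ r, r = √(Real.log ((p : ℝ) * d) / n) := ⟨_, rfl⟩
  have hr0 : 0 < r := by rw [hr]; positivity
  have hr2 : n * r ^ 2 = Real.log (p * d) := by
    rw [hr, Real.sq_sqrt (by positivity)]; field_simp
  obtain ⟨bad, hmeas, hprob, hbad⟩ :=
    CGGM.exists_noise_event hn hp2 hd hf₀ hpd hB hBB hBC Θ₀ (τ := τ) hr0 hr2
  refine ⟨bad, hmeas, hprob.trans (ENNReal.ofReal_le_ofReal ?_), ?_⟩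
  · unfold CGGM.failProb
    linarith
  intro z hz hu hle hcX lam₂ lam₃ h₂ h₃ hmax Λ' Θ' hest f' hf' hfm' hclose
  have hreg : max lam₂ lam₃ ≤ k * r := by
    rw [hmax, hk, hr]
    exact CGGM.regLevel_le hp2 hd (by linarith) hα0 hCLi.le hinv hcX
  -- Whitening costs `c² = C_L⁻¹`, so the radius `C_L / 2` becomes the bound `1/2` required of `N`.
  have hclose' : c * (c * CGGM.frob (Λ' - Λ₀)) ≤ 1 / 2 := by
    rw [← mul_assoc, ← sq, hc2, inv_mul_le_iff₀ hCL]
    linarith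
  have hbound := CGGM.condSKL_le_of_noise_bounds hp hd hB hC hBB hBC hCB hpd hb0 hc0
    (hb2 ▸ hBb) (hc2 ▸ hCc) hf₀ hf' hm0.le (hmm hfm) (hmm hfm') hκ0 (hκX z hu hle) hdp hr0.le he₁0
    he₂0 hk0 hs0 hq0 (he₁ ▸ (hbad z hz).1 cX₀ hcX)
    ((le_total r 1).imp (fun h => he₂ ▸ (hbad z hz).2 h) id) h₂ h₃ ((le_max_left _ _).trans hreg)
    ((le_max_right _ _).trans hreg) (hs ▸ CGGM.sqrt_sTheta_le hsΘ)
    (hq ▸ CGGM.frob_le_of_sTheta_le hsΘ hΘ) hest hclose'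
  rw [← hK] at hbound
  refine hbound.trans (ENNReal.ofReal_le_ofReal (mul_le_mul_of_nonneg_left ?_ hK0.le))
  refine le_trans (le_of_eq ?_) (CGGM.mul_sq_log_le_rate n p d)
  rw [← hr2]
  field_simp
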